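/- Let $p$ be a prime, $V$ a $2$-dimensional $\mathbb{Q}$-vector space, $L\subset V$ a lattice, $L_p=L\otimes\mathbb{Z}_p\subset V_p=V\otimes\mathbb{Q}_p$, and $w_1,w_2$ a basis of $V$. *Measures.* Let $\mathcal{M}(L_p)$ be the space of $p$-adic measures on $L_p$ (continuous linear functionals on the continuous functions $L_p\to\mathbb{Q}_p$), and $\widetilde{\mathcal{M}}(L_p)=S^{-1}\mathcal{M}(L_p)$ the space of pseudo-measures, where $S$ is generated under convolution by the elements $\delta_0-\delta_v$, $0\neq v\in L_p$. A formal sum $\sum_{v\in V\cap L_p}g(v)\delta_v$ with $g(v)\in\mathbb{Z}$ represents $x\in\widetilde{\mathcal{M}}(L_p)$ if for some finite product $s$ of elements $\delta_0-\delta_u$ ($0\ne u\in V\cap L_p$) the formal product $s*\sum_v g(v)\delta_v$ is a finite sum and is equal to $s*x$; such an $x$ is unique. *Test functions.* Let $0\neq f'\in\mathcal{S}(V^{(p)})=\bigotimes'_{\ell\ne p}\mathcal{S}(V_\ell)$ be a nonzero $\mathbb{Z}$-valued test function away from $p$, regarded as a function on $V$. Let $[L_p]$ be the characteristic function of $L_p$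 and $\Gamma\subset \mathrm{GL}(V)$ the stabilizer of $f'\otimes[L_p]$ for $(f|\gamma)(v)=f(\gamma v)$. The function $f'$ satisfies the Vanishing Hypothesis for $w\neq 0$ if, for every $v\in V$, the test function $x\mapsto f'(v+xw)$ on $\mathbb{Q}$ away from $p$ has Haar measure $h^{(p)}$ equal to $0$, where $h^{(p)}(g)=h_{\mathbb{Q}}(g\otimes[\mathbb{Z}_p])$ and $h_{\mathbb{Q}}(g)=\frac1N\sum_{x\in\mathbb{Q}/N\mathbb{Z}}g(x)$ if $g$ is $N\mathbb{Z}$-periodic. *Hill's cocycle.* Let $\mathbb{F}=\mathbb{Q}((\varepsilon_1))((\varepsilon_2))$, ordered so that $\varepsilon_1$ is a positive infinitesimal and $\varepsilon_2$ is positive and smaller than every positive element of $\mathbb{Q}((\varepsilon_1))$. Put $b_i=w_1+\varepsilon_iw_2\in V\otimes\mathbb{F}$ and, for $\alpha_1,\alpha_2\in\mathrm{GL}(V)$, $$\sigma(\alpha_1,\alpha_2)=\operatorname{sign}\det(\alpha_1b_1,\alpha_2b_2)\,[C^o(\alpha_1b_1,\alpha_2b_2)]\big|_V ,$$ where $C^o$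 denotes the open cone of positive linear combinations, $[\cdot]$ a characteristic function, and the determinant is taken in the basis $w_1,w_2$. Let $\mathcal{K}_V$ be the group of functions $V\to\mathbb{Z}$ generated by the characteristic functions of the open cones $C^o(v_1,\dots,v_r)$ (positive rational combinations), $v_1,\dots,v_r\in V$ linearly independent, $r\ge0$. **Statement.** Suppose that $f'$ satisfies the Vanishing Hypothesis for $w_1$. Then: 1. For all $\alpha_1,\alpha_2\in\Gamma$, $\sigma(\alpha_1,\alpha_2)\in\mathcal{K}_V$, and the formal sum $\sum_{v}\sigma(\alpha_1,\alpha_2)(v)\,(f'\otimes[L_p])(v)\,\delta_v$ represents a pseudo-measure. Let $\Phi_{f'}(\alpha_1,\alpha_2)$ be its class in $\widetilde{\mathcal{M}}(L_p)/\mathbb{Z}\delta_0$. 2. Every $\gamma\in\Gamma$ preserves $L_p$, and so acts on $\widetilde{\mathcal{M}}(L_p)/\mathbb{Z}\delta_0$ by push-forward $\gamma_*$; for all $\alpha_1,\alpha_2\in\Gamma$, $\Phi_{f'}(\gamma\alpha_1,\gamma\alpha_2)=\operatorname{sign}(\det\gamma)\,\gamma_*\Phi_{f'}(\alpha_1,\alpha_2)$.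 3. For all $\alpha_0,\alpha_1,\alpha_2\in\Gamma$, $\Phi_{f'}(\alpha_1,\alpha_2)-\Phi_{f'}(\alpha_0,\alpha_2)+\Phi_{f'}(\alpha_0,\alpha_1)=0$ in $\widetilde{\mathcal{M}}(L_p)/\mathbb{Z}\delta_0$. 4. For all $\alpha_1,\alpha_2\in\Gamma$ (including those for which $\alpha_1w_1,\alpha_2w_1$ are linearly dependent), $\Phi_{f'}(\alpha_1,\alpha_2)$ is a measure, i.e. lies in the image of $\mathcal{M}(L_p)$. That is, $\Phi_{f'}$ is a measure-valued (homogeneous) $1$-cocycle for $\Gamma$, where $\gamma\in\Gamma$ acts by $\operatorname{sign}(\det\gamma)\gamma_*$. -/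

import Mathlib

open scoped TensorProduct

noncomputable section

namespace PadicShintani

/-! ### Local vector spaces and lattices -/

section Local

variable (p : ℕ) [Fact p.Prime]

/-- The `p`-adic completion `V_p = ℚ_p ⊗ V` of a rational vector space. -/
abbrev LocalSpace (V : Type*) [AddCommGroup V] [Module ℚ V] : Type _ := ℚ_[p] ⊗[ℚ] V

variable {V : Type*} [AddCommGroup V] [Module ℚ V]

/-- The canonical topology of `V_p` (for finite-dimensional `V`: the product topology in any
system of linear coordinates). -/
instance : TopologicalSpace (LocalSpace p V) := moduleTopology ℚ_[p] (LocalSpace p V)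

instance : IsModuleTopology ℚ_[p] (LocalSpace p V) := ⟨rfl⟩

instance : IsTopologicalAddGroup (LocalSpace p V) :=
  IsModuleTopology.topologicalAddGroup ℚ_[p] (LocalSpace p V)

/-- The lattice `L_p = ℤ_p ⊗ L`, realised as the `ℤ_p`-span of `L` inside `V_p`. -/
def localLattice (L : Submodule ℤ V) : Submodule ℤ_[p] (LocalSpace p V) :=
  Submodule.span ℤ_[p] {x | ∃ l ∈ L, x = (1 : ℚ_[p]) ⊗ₜ[ℚ] l}

/-- The rational points `V ∩ L_p` of the lattice `L_p`. -/
def ratPoints (L : Submodule ℤ V) : AddSubgroup V where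
  carrier := {v | (1 : ℚ_[p]) ⊗ₜ[ℚ] v ∈ localLattice p L}
  zero_mem' := by simp
  add_mem' {a b} ha hb := by
    simp only [Set.mem_ofPred_eq, TensorProduct.tmul_add] at *
    exact add_mem ha hb
  neg_mem' {a} ha := by
    simp only [Set.mem_ofPred_eq, TensorProduct.tmul_neg] at *
    exact neg_mem ha

/-- The inclusion `V ∩ L_p → L_p`. -/
def toLattice (L : Submodule ℤ V) (v : ratPoints p L) : localLattice p L :=
  ⟨(1 : ℚ_[p]) ⊗ₜ[ℚ] (v : V), v.2⟩

/-! ### Test functions -/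

/-- Step functions on `V_p`: locally constant, compactly supported, integer valued. -/
def IsStep (φ : LocalSpace p V → ℤ) : Prop := IsLocallyConstant φ ∧ HasCompactSupport φ

/-- The primes different from `p`. -/
abbrev PrimesAway : Type := {q : ℕ // q.Prime ∧ q ≠ p}

instance (q : PrimesAway p) : Fact (q : ℕ).Prime := ⟨q.2.1⟩

/-- The group `𝒮(V^(p))` of test functions away from `p`: the restricted tensor product over the
primes `q ≠ p` of the groups of step functions on `V_q`, with respect to the characteristic
functions of the lattices `L_q`. As usual a pure tensor `⊗ φ_q` is viewed as the function
`v ↦ ∏ φ_q(v)` on `V`, which is dense in the restricted product of the `V_q`. -/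
def testFunctionsAway (L : Submodule ℤ V) : AddSubgroup (V → ℤ) :=
  AddSubgroup.closure {g | ∃ φ : ∀ q : PrimesAway p, LocalSpace (q : ℕ) V → ℤ,
    (∀ q : PrimesAway p, IsStep (q : ℕ) (φ q)) ∧
    (∀ᶠ q : PrimesAway p in Filter.cofinite,
      φ q = Set.indicator (localLattice (q : ℕ) L : Set (LocalSpace (q : ℕ) V)) 1) ∧
    g = fun v => ∏ᶠ q : PrimesAway p, φ q ((1 : ℚ_[(q : ℕ)]) ⊗ₜ[ℚ] v)}

/-- The test function `f' ⊗ [L_p]` on `V`. -/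
def globalTest (L : Submodule ℤ V) (f' : V → ℤ) : V → ℤ :=
  Set.indicator (ratPoints p L : Set V) f'

open Classical in
/-- The Haar measure of a test function `g` on `ℚ`, normalised by `ℤ`: if `g` is periodic modulo
`N ℤ` then it is `[ℤ : N ℤ]⁻¹` times the sum of `g` over `ℚ / N ℤ` (which does not depend
on `N`). -/
def haarRat (g : ℚ → ℤ) : ℚ :=
  if h : ∃ N : ℕ, 0 < N ∧ ∀ x, g (x + N) = g x then
    (1 / (h.choose : ℚ)) * ((∑ᶠ x ∈ Set.Ico (0 : ℚ) (h.choose : ℚ), g x : ℤ) : ℚ)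
  else 0

/-- The Haar measure `h^(p)(g) = h_ℚ(g ⊗ [ℤ_p])` of a test function on `ℚ` away from `p`. -/
def haarAway (g : ℚ → ℤ) : ℚ := haarRat (Set.indicator {x : ℚ | ‖(x : ℚ_[p])‖ ≤ 1} g)

/-- The Vanishing Hypothesis for `w`: the restriction `x ↦ f'(v + x w)` of `f'` to each line
parallel to `w` has Haar measure `0`. -/
def VanishingHypothesis (f' : V → ℤ) (w : V) : Prop :=
  ∀ v : V, haarAway p (fun x : ℚ => f' (v + x • w)) = 0

/-- The stabiliser of `f' ⊗ [L_p]` in `GL(V)`, for the action `(f | γ)(v) = f(γ v)`. -/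
def stabilizer (L : Submodule ℤ V) (f' : V → ℤ) : Subgroup (V ≃ₗ[ℚ] V) where
  carrier := {γ | ∀ v, globalTest p L f' (γ v) = globalTest p L f' v}
  one_mem' := fun _ => rfl
  mul_mem' {a b} ha hb := fun v => by
    simp only [Set.mem_ofPred_eq] at ha hb
    rw [LinearEquiv.mul_apply, ha, hb]
  inv_mem' {a} ha := fun v => by
    simp only [Set.mem_ofPred_eq] at ha
    rw [← ha (a⁻¹ v), ← LinearEquiv.mul_apply, mul_inv_cancel, LinearEquiv.coe_one, id]

/-! ### Measures -/

/-- The space `ℳ(L_p)` of `p`-adic measures: continuous linear functionals on the space of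
continuous functions on `L_p`, with its compact-open (i.e. sup-norm) topology. -/
def PMeasure (L : Submodule ℤ V) : Type _ := C(localLattice p L, ℚ_[p]) →L[ℚ_[p]] ℚ_[p]

instance (L : Submodule ℤ V) : AddCommGroup (PMeasure p L) :=
  inferInstanceAs (AddCommGroup (C(localLattice p L, ℚ_[p]) →L[ℚ_[p]] ℚ_[p]))

variable {p}

/-- The Dirac measure at a point of `L_p`. -/
def dirac {L : Submodule ℤ V} (x : localLattice p L) : PMeasure p L :=
  ContinuousMap.evalCLM ℚ_[p] x

/-- The integral of a continuous function against a measure. -/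
def PMeasure.integral {L : Submodule ℤ V} (μ : PMeasure p L) (f : C(localLattice p L, ℚ_[p])) :
    ℚ_[p] :=
  (show C(localLattice p L, ℚ_[p]) →L[ℚ_[p]] ℚ_[p] from μ) f

theorem PMeasure.ext {L : Submodule ℤ V} {μ ν : PMeasure p L}
    (h : ∀ f, μ.integral f = ν.integral f) : μ = ν :=
  ContinuousLinearMap.ext h

/-- Composition with a continuous map, as a continuous linear map. -/
def precomp {L : Submodule ℤ V} (T : C(localLattice p L, localLattice p L)) :
    C(localLattice p L, ℚ_[p]) →L[ℚ_[p]] C(localLattice p L, ℚ_[p]) where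
  toFun f := f.comp T
  map_add' _ _ := by ext; rfl
  map_smul' _ _ := by ext; rfl
  cont := ContinuousMap.continuous_precomp T

/-- The push-forward `(T_* μ)(f) = μ(f ∘ T)` of measures along a continuous map. -/
def pushForward {L : Submodule ℤ V} (T : C(localLattice p L, localLattice p L)) :
    PMeasure p L →+ PMeasure p L where
  toFun μ := ContinuousLinearMap.comp μ (precomp T)
  map_zero' := rfl
  map_add' _ _ := rfl

theorem pushForward_integral {L : Submodule ℤ V} (T : C(localLattice p L, localLattice p L))
    (μ : PMeasure p L) (f : C(localLattice p L, ℚ_[p])) :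
    (pushForward T μ).integral f = μ.integral (f.comp T) := rfl

/-- Translation by `u` on `L_p`. -/
def translation {L : Submodule ℤ V} (u : localLattice p L) :
    C(localLattice p L, localLattice p L) := ⟨fun x => x + u, by fun_prop⟩

/-- The action of the group ring `ℤ[L_p]` on measures by convolution; `u` acts as convolution
with `δ_u`, that is by translation. -/
def convolution (L : Submodule ℤ V) :
    AddMonoidAlgebra ℤ (localLattice p L) →ₐ[ℤ] Module.End ℤ (PMeasure p L) :=
  AddMonoidAlgebra.lift ℤ (Module.End ℤ (PMeasure p L)) (localLattice p L)
    { toFun := fun u => (pushForward (translation u.toAdd)).toIntLinearMap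
      map_one' := by
        refine LinearMap.ext fun μ => PMeasure.ext fun f => ?_
        change μ.integral (f.comp _) = μ.integral f
        congr 1
        ext x
        simp [translation]
      map_mul' := fun u v => by
        refine LinearMap.ext fun μ => PMeasure.ext fun f => ?_
        change μ.integral (f.comp _) = μ.integral ((f.comp _).comp _)
        congr 1
        ext x
        simp [translation, add_comm, add_left_comm] }

instance (L : Submodule ℤ V) :
    Module (AddMonoidAlgebra ℤ (localLattice p L)) (PMeasure p L) :=
  Module.compHom (PMeasure p L) (convolution L).toRingHom

theorem single_smul {L : Submodule ℤ V} (u : localLattice p L) (n : ℤ) (μ : PMeasure p L) :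
    AddMonoidAlgebra.single u n • μ = n • pushForward (translation u) μ := by
  change convolution L (AddMonoidAlgebra.single u n) μ = _
  simp [convolution, AddMonoidAlgebra.lift_single]

/-! ### Pseudo-measures -/

variable (p) in
/-- The multiplicative set generated by the `δ_0 - δ_v` with `0 ≠ v ∈ L_p`. -/
def denominators (L : Submodule ℤ V) : Submonoid (AddMonoidAlgebra ℤ (localLattice p L)) :=
  Submonoid.closure {s | ∃ v : localLattice p L, v ≠ 0 ∧ s = 1 - AddMonoidAlgebra.single v 1}

variable (p) in
/-- The space of pseudo-measures: the localization of `ℳ(L_p)` at the set generated by the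
`δ_0 - δ_v`, which acts by convolution. -/
abbrev PseudoMeasure (L : Submodule ℤ V) : Type _ :=
  LocalizedModule (denominators p L) (PMeasure p L)

/-- The natural map from measures to pseudo-measures. -/
def ofMeasure {L : Submodule ℤ V} (μ : PMeasure p L) : PseudoMeasure p L :=
  LocalizedModule.mk μ 1

variable (p) in
/-- Pseudo-measures modulo `ℤ δ_0`. -/
abbrev PseudoMeasureModDirac (L : Submodule ℤ V) : Type _ :=
  PseudoMeasure p L ⧸ AddSubgroup.zmultiples (ofMeasure (dirac (0 : localLattice p L)))

/-- A class modulo `ℤ δ_0` is a measure if it comes from `ℳ(L_p)`. -/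
def IsMeasure {L : Submodule ℤ V} (x : PseudoMeasureModDirac p L) : Prop :=
  ∃ μ : PMeasure p L, x = QuotientAddGroup.mk (ofMeasure μ)

/-! ### The action of linear automorphisms -/

/-- The automorphism of `V_p` induced by an automorphism of `V`. -/
def localMap (p : ℕ) [Fact p.Prime] (γ : V ≃ₗ[ℚ] V) : LocalSpace p V →ₗ[ℚ_[p]] LocalSpace p V :=
  (γ : V →ₗ[ℚ] V).baseChange ℚ_[p]

variable (p) in
/-- `γ` maps `L_p` to itself. -/
def PreservesLattice (L : Submodule ℤ V) (γ : V ≃ₗ[ℚ] V) : Prop :=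
  ∀ x ∈ localLattice p L, localMap p γ x ∈ localLattice p L

theorem localMap_injective (γ : V ≃ₗ[ℚ] V) : Function.Injective (localMap p γ) :=
  Module.Flat.lTensor_preserves_injective_linearMap (M := ℚ_[p]) (γ : V →ₗ[ℚ] V) γ.injective

/-- The map `L_p → L_p` induced by `γ`. -/
def latticeMap {L : Submodule ℤ V} (γ : V ≃ₗ[ℚ] V) (h : PreservesLattice p L γ) :
    localLattice p L →+ localLattice p L where
  toFun x := ⟨localMap p γ x, h x x.2⟩
  map_zero' := by ext; simp
  map_add' x y := by ext; simp

theorem latticeMap_injective {L : Submodule ℤ V} (γ : V ≃ₗ[ℚ] V) (h : PreservesLattice p L γ) :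
    Function.Injective (latticeMap γ h) := fun _ _ hxy =>
  Subtype.ext (localMap_injective γ (congrArg Subtype.val hxy))

/-- The action `(γ μ)(f) = μ(f ∘ γ)` on measures. -/
def actMeasure {L : Submodule ℤ V} (γ : V ≃ₗ[ℚ] V) (h : PreservesLattice p L γ) :
    PMeasure p L →+ PMeasure p L :=
  pushForward ⟨latticeMap γ h, by
    refine Continuous.subtype_mk ?_ _
    exact (IsModuleTopology.continuous_of_linearMap (localMap p γ)).comp continuous_subtype_val⟩

/-- The action on the group ring `ℤ[L_p]`. -/
def actRing {L : Submodule ℤ V} (γ : V ≃ₗ[ℚ] V) (h : PreservesLattice p L γ) :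
    AddMonoidAlgebra ℤ (localLattice p L) →+* AddMonoidAlgebra ℤ (localLattice p L) :=
  AddMonoidAlgebra.mapDomainRingHom ℤ (latticeMap γ h)

theorem actMeasure_smul {L : Submodule ℤ V} (γ : V ≃ₗ[ℚ] V) (h : PreservesLattice p L γ)
    (s : AddMonoidAlgebra ℤ (localLattice p L)) (μ : PMeasure p L) :
    actMeasure γ h (s • μ) = actRing γ h s • actMeasure γ h μ := by
  induction s using AddMonoidAlgebra.induction_linear with
  | zero => simp
  | add a b ha hb => simp [add_smul, ha, hb]
  | single u n =>
    rw [actRing, AddMonoidAlgebra.mapDomainRingHom_apply, AddMonoidAlgebra.mapDomain_single,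
      single_smul, single_smul, map_zsmul]
    congr 1
    refine PMeasure.ext fun f => ?_
    simp only [actMeasure, pushForward_integral]
    congr 1
    ext x
    exact congrArg f (map_add (latticeMap γ h) x u)

theorem actRing_mem {L : Submodule ℤ V} (γ : V ≃ₗ[ℚ] V) (h : PreservesLattice p L γ)
    {s : AddMonoidAlgebra ℤ (localLattice p L)} (hs : s ∈ denominators p L) :
    actRing γ h s ∈ denominators p L := by
  induction hs using Submonoid.closure_induction with
  | mem s hs =>
    obtain ⟨v, hv, rfl⟩ := hs
    refine Submonoid.subset_closure ⟨latticeMap γ h v, ?_, ?_⟩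
    · rwa [Ne, map_eq_zero_iff _ (latticeMap_injective γ h)]
    · rw [map_sub, map_one, actRing, AddMonoidAlgebra.mapDomainRingHom_apply,
        AddMonoidAlgebra.mapDomain_single]
  | one => rw [map_one]; exact one_mem _
  | mul a b _ _ ha hb => rw [map_mul]; exact mul_mem ha hb

/-- The action of `γ` on denominators. -/
def actDenominator {L : Submodule ℤ V} (γ : V ≃ₗ[ℚ] V) (h : PreservesLattice p L γ) :
    denominators p L →* denominators p L :=
  ((actRing γ h : _ →* _).comp (denominators p L).subtype).codRestrict _
    fun s => actRing_mem γ h s.2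

theorem actMeasure_smul' {L : Submodule ℤ V} (γ : V ≃ₗ[ℚ] V) (h : PreservesLattice p L γ)
    (s : denominators p L) (μ : PMeasure p L) :
    actMeasure γ h (s • μ) = actDenominator γ h s • actMeasure γ h μ :=
  actMeasure_smul γ h s μ

/-- The underlying function of `actPseudo`. -/
def actPseudoFun {L : Submodule ℤ V} (γ : V ≃ₗ[ℚ] V) (h : PreservesLattice p L γ)
    (x : PseudoMeasure p L) : PseudoMeasure p L :=
  x.liftOn (fun a => LocalizedModule.mk (actMeasure γ h a.1) (actDenominator γ h a.2)) (by
    rintro ⟨m, s⟩ ⟨m', s'⟩ ⟨u, hu⟩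
    refine LocalizedModule.mk_eq.mpr ⟨actDenominator γ h u, ?_⟩
    have := congrArg (actMeasure γ h) hu
    simpa only [actMeasure_smul'] using this)

theorem actPseudoFun_mk {L : Submodule ℤ V} (γ : V ≃ₗ[ℚ] V) (h : PreservesLattice p L γ)
    (μ : PMeasure p L) (s : denominators p L) :
    actPseudoFun γ h (LocalizedModule.mk μ s) =
      LocalizedModule.mk (actMeasure γ h μ) (actDenominator γ h s) := rfl

/-- The action `γ (μ / s) = (γ μ) / (γ s)` on pseudo-measures. -/
def actPseudo {L : Submodule ℤ V} (γ : V ≃ₗ[ℚ] V) (h : PreservesLattice p L γ) :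
    PseudoMeasure p L →+ PseudoMeasure p L :=
  AddMonoidHom.mk' (actPseudoFun γ h) fun x y => by
    induction x, y using LocalizedModule.induction_on₂ with
    | _ m m' s s' =>
      rw [LocalizedModule.mk_add_mk, actPseudoFun_mk, actPseudoFun_mk, actPseudoFun_mk,
        LocalizedModule.mk_add_mk, map_add, actMeasure_smul', actMeasure_smul', map_mul]

theorem actPseudo_mk {L : Submodule ℤ V} (γ : V ≃ₗ[ℚ] V) (h : PreservesLattice p L γ)
    (μ : PMeasure p L) (s : denominators p L) :
    actPseudo γ h (LocalizedModule.mk μ s) =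
      LocalizedModule.mk (actMeasure γ h μ) (actDenominator γ h s) := rfl

/-- The induced action modulo `ℤ δ_0`. -/
def actModDirac {L : Submodule ℤ V} (γ : V ≃ₗ[ℚ] V) (h : PreservesLattice p L γ) :
    PseudoMeasureModDirac p L →+ PseudoMeasureModDirac p L :=
  QuotientAddGroup.map _ _ (actPseudo γ h) (by
    rw [AddSubgroup.zmultiples_le]
    have h0 : actMeasure γ h (dirac (0 : localLattice p L)) = dirac 0 :=
      PMeasure.ext fun f => congrArg f (map_zero (latticeMap γ h))
    have h1 : actPseudo γ h (ofMeasure (dirac (0 : localLattice p L))) = ofMeasure (dirac 0) := by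
      rw [ofMeasure, actPseudo_mk, h0, map_one]
    rw [AddSubgroup.mem_comap, h1]
    exact AddSubgroup.mem_zmultiples _)

/-! ### Pseudo-measures attached to formal sums -/

/-- Multiplication by `1 - δ_u` of a formal sum `∑ g(v) δ_v`. -/
def difference {A : Type*} [AddGroup A] (u : A) (g : A → ℤ) : A → ℤ := fun v => g v - g (v - u)

/-- The measure `∑ G(v) δ_v` attached to a finite formal sum. -/
def finiteMeasure {L : Submodule ℤ V} (G : ratPoints p L →₀ ℤ) : PMeasure p L :=
  G.sum fun v n => n • dirac (toLattice p L v)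

/-- The element `∏ (1 - δ_u)` of `ℤ[L_p]`. -/
def differenceProd {L : Submodule ℤ V} (us : List (ratPoints p L)) :
    AddMonoidAlgebra ℤ (localLattice p L) :=
  (us.map fun u => 1 - AddMonoidAlgebra.single (toLattice p L u) 1).prod

/-- `x` is the pseudo-measure represented by the formal sum `∑ g(v) δ_v` over `v ∈ V ∩ L_p`:
after multiplication with finitely many factors `1 - δ_u`, where `0 ≠ u ∈ V ∩ L_p`, the formal sum
becomes a finite sum of Dirac measures, and the same multiple of `x` is equal to that measure.
Equivalently, the Amice transform of `x` is the rational function which expands to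
`∑ g(v) q^v`. -/
def Represents {L : Submodule ℤ V} (g : V → ℤ) (x : PseudoMeasure p L) : Prop :=
  ∃ (us : List (ratPoints p L)) (G : ratPoints p L →₀ ℤ),
    (∀ u ∈ us, u ≠ 0) ∧
    (⇑G = us.foldr difference (fun v : ratPoints p L => g (v : V))) ∧
    differenceProd us • x = ofMeasure (finiteMeasure G)

theorem difference_comm {A : Type*} [AddCommGroup A] (u u' : A) (g : A → ℤ) :
    difference u (difference u' g) = difference u' (difference u g) := by
  ext v
  simp only [difference, sub_right_comm v u u']
  ring

theorem foldr_difference_comm {A : Type*} [AddCommGroup A] (us us' : List A) (g : A → ℤ) :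
    us.foldr difference (us'.foldr difference g) = us'.foldr difference (us.foldr difference g) := by
  have h1 : ∀ (u : A) (us : List A) (g : A → ℤ),
      difference u (us.foldr difference g) = us.foldr difference (difference u g) := by
    intro u us g
    induction us with
    | nil => rfl
    | cons a us ih => rw [List.foldr_cons, List.foldr_cons, difference_comm, ih]
  induction us with
  | nil => rfl
  | cons a us ih => rw [List.foldr_cons, List.foldr_cons, ih, h1]

theorem foldr_difference_finite {L : Submodule ℤ V} (us : List (ratPoints p L))
    (G : ratPoints p L →₀ ℤ) :
    ∃ G' : ratPoints p L →₀ ℤ, ⇑G' = us.foldr difference ⇑G ∧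
      finiteMeasure G' = differenceProd us • finiteMeasure G := by
  classical
  induction us with
  | nil => exact ⟨G, rfl, by simp [differenceProd]⟩
  | cons u us ih =>
    obtain ⟨G', hG', hm⟩ := ih
    refine ⟨G' - G'.mapDomain (fun v => v + u), ?_, ?_⟩
    · ext v
      rw [List.foldr_cons, ← hG', difference, Finsupp.sub_apply]
      congr 1
      conv_lhs => rw [← sub_add_cancel v u]
      exact Finsupp.mapDomain_apply (add_left_injective u) _ _
    · have hsub : ∀ A B : ratPoints p L →₀ ℤ,
          finiteMeasure (A - B) = finiteMeasure A - finiteMeasure B := fun A B =>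
        Finsupp.sum_sub_index fun _ _ _ => sub_smul _ _ _
      have hshift : finiteMeasure (G'.mapDomain (fun v => v + u)) =
          pushForward (translation (toLattice p L u)) (finiteMeasure G') := by
        rw [finiteMeasure, Finsupp.sum_mapDomain_index (by simp) (fun _ _ _ => add_smul _ _ _),
          finiteMeasure, Finsupp.sum, Finsupp.sum, map_sum]
        refine Finset.sum_congr rfl fun v _ => ?_
        rw [map_zsmul]
        congr 1
        refine PMeasure.ext fun f => congrArg f (Subtype.ext ?_)
        simp [toLattice, translation, TensorProduct.tmul_add]
      rw [hsub, hshift, differenceProd, List.map_cons, List.prod_cons, mul_smul, sub_smul, one_smul,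
        single_smul, one_smul, ← differenceProd, ← hm]

theorem toLattice_ne_zero {L : Submodule ℤ V} {u : ratPoints p L} (hu : u ≠ 0) :
    toLattice p L u ≠ 0 := by
  intro h
  have h' : (1 : ℚ_[p]) ⊗ₜ[ℚ] (u : V) = (1 : ℚ_[p]) ⊗ₜ[ℚ] (0 : V) := by
    rw [TensorProduct.tmul_zero]; exact congrArg Subtype.val h
  have hinj : Function.Injective (fun v : V => (1 : ℚ_[p]) ⊗ₜ[ℚ] v) :=
    Module.FaithfullyFlat.tensorProduct_mk_injective (A := ℚ) (B := ℚ_[p]) V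
  exact hu (Subtype.ext (hinj h'))

theorem differenceProd_mem {L : Submodule ℤ V} {us : List (ratPoints p L)}
    (hus : ∀ u ∈ us, u ≠ 0) : differenceProd us ∈ denominators p L := by
  refine Submonoid.list_prod_mem _ fun s hs => ?_
  obtain ⟨u, hu, rfl⟩ := List.mem_map.mp hs
  exact Submonoid.subset_closure ⟨_, toLattice_ne_zero (hus u hu), rfl⟩

/-- A formal sum represents at most one pseudo-measure. -/
theorem Represents.unique {L : Submodule ℤ V} {g : V → ℤ} {x y : PseudoMeasure p L}
    (hx : Represents g x) (hy : Represents g y) : x = y := by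
  obtain ⟨us, G, hus, hG, hx⟩ := hx
  obtain ⟨us', G', hus', hG', hy⟩ := hy
  obtain ⟨H, hH, hHm⟩ := foldr_difference_finite us' G
  obtain ⟨H', hH', hHm'⟩ := foldr_difference_finite us G'
  have hHH : H = H' := by
    apply DFunLike.coe_injective
    rw [hH, hH', hG, hG', foldr_difference_comm]
  have hmk : ∀ (s : AddMonoidAlgebra ℤ (localLattice p L)) (μ : PMeasure p L),
      s • ofMeasure μ = ofMeasure (s • μ) := fun s μ => by
    simp only [ofMeasure, LocalizedModule.smul'_mk]
  have hxy : differenceProd us' • differenceProd us • x =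
      differenceProd us' • differenceProd us • y := by
    rw [hx, smul_comm, hy, hmk, hmk, ← hHm, ← hHm', hHH]
  have hinj := fun s : denominators p L =>
    IsLocalizedModule.smul_injective
      (LocalizedModule.mkLinearMap (denominators p L) (PMeasure p L)) s
  exact hinj ⟨_, differenceProd_mem hus⟩ (hinj ⟨_, differenceProd_mem hus'⟩ hxy)

variable (p) in
open Classical in
/-- The pseudo-measure represented by a formal sum (which is unique if it exists), and `0` if
there is none. -/
def pseudoMeasure (L : Submodule ℤ V) (g : V → ℤ) : PseudoMeasure p L :=
  if h : ∃ x, Represents g x then h.choose else 0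

end Local

/-! ### Cones and Hill's cocycle in dimension two -/

section Cones

variable {V : Type*} [AddCommGroup V] [Module ℚ V]

/-- The set of rational points of the open cone `C^o(v_1, …, v_r)`. -/
def openCone {r : ℕ} (v : Fin r → V) : Set V :=
  {x | ∃ a : Fin r → ℚ, (∀ i, 0 < a i) ∧ x = ∑ i, a i • v i}

variable (V) in
/-- The group `𝒦_V` of rational cone functions, as functions on `V`: generated by the
characteristic functions of the open cones on linearly independent vectors of `V`. (The cone
`{0}` on the empty family makes the value at `0` arbitrary.) -/
def coneFunctions : AddSubgroup (V → ℤ) :=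
  AddSubgroup.closure {g | ∃ (r : ℕ) (v : Fin r → V), LinearIndependent ℚ v ∧
    g = Set.indicator (openCone v) 1}

/-- The field `𝔽 = ℚ((ε₁))((ε₂))`. -/
def HillField : Type := LaurentSeries (LaurentSeries ℚ)

instance : Field HillField := inferInstanceAs (Field (LaurentSeries (LaurentSeries ℚ)))

/-- The inclusion of the constants. -/
instance : Algebra ℚ HillField :=
  ((HahnSeries.C : LaurentSeries ℚ →+* LaurentSeries (LaurentSeries ℚ)).comp
    (HahnSeries.C : ℚ →+* LaurentSeries ℚ)).toAlgebra

/-- The sign of an element of `𝔽`, i.e. of its leading coefficient. This is the ordering in which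
`ε₁` is a positive infinitesimal, and `ε₂` is positive and smaller than all positive elements of
`ℚ((ε₁))`. -/
def hillSign (x : HillField) : ℤ :=
  SignType.sign
    (HahnSeries.leadingCoeff (show LaurentSeries (LaurentSeries ℚ) from x)).leadingCoeff

/-- The infinitesimals `ε₁` and `ε₂`. -/
def eps : Fin 2 → HillField :=
  ![(HahnSeries.C (HahnSeries.single 1 1 : LaurentSeries ℚ) : LaurentSeries (LaurentSeries ℚ)),
    (HahnSeries.single 1 1 : LaurentSeries (LaurentSeries ℚ))]

/-- The vector `α b_i = α w_1 + ε_i α w_2` of `𝔽 ⊗ V`. -/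
def deformed (w : Module.Basis (Fin 2) ℚ V) (α : V ≃ₗ[ℚ] V) (i : Fin 2) : HillField ⊗[ℚ] V :=
  (α : V →ₗ[ℚ] V).baseChange HillField ((1 : HillField) ⊗ₜ[ℚ] w 0 + eps i ⊗ₜ[ℚ] w 1)

/-- The set of vectors of `V` that lie in the open cone `C^o(x_1, x_2)` of `𝔽 ⊗ V`. -/
def hillCone (x : Fin 2 → HillField ⊗[ℚ] V) : Set V :=
  {v | ∃ a : Fin 2 → HillField, (∀ i, hillSign (a i) = 1) ∧
    (1 : HillField) ⊗ₜ[ℚ] v = ∑ i, a i • x i}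

/-- Hill's cocycle `σ(α₁, α₂) = sign det(α₁ b₁, α₂ b₂) [C^o(α₁ b₁, α₂ b₂)]`, restricted
to `V`; the determinant is taken in the coordinates given by `w`. -/
def hillCocycle (w : Module.Basis (Fin 2) ℚ V) (α₁ α₂ : V ≃ₗ[ℚ] V) : V → ℤ := fun v =>
  hillSign ((w.baseChange HillField).det ![deformed w α₁ 0, deformed w α₂ 1]) *
    Set.indicator (hillCone ![deformed w α₁ 0, deformed w α₂ 1]) 1 v

end Cones

/-! ### The Shintani cocycle -/

section Shintani

variable (p : ℕ) [Fact p.Prime] {V : Type*} [AddCommGroup V] [Module ℚ V]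

/-- The formal sum `∑ κ(v) (f' ⊗ [L_p])(v) δ_v` attached to a function `κ` on `V`. -/
def formalSum (L : Submodule ℤ V) (f' : V → ℤ) (κ : V → ℤ) : V → ℤ :=
  fun v => κ v * globalTest p L f' v

/-- The pseudo-measure `μ_{σ(α₁, α₂), f'}`. -/
def shintaniPseudoMeasure (L : Submodule ℤ V) (w : Module.Basis (Fin 2) ℚ V) (f' : V → ℤ)
    (α₁ α₂ : stabilizer p L f') : PseudoMeasure p L :=
  pseudoMeasure p L (formalSum p L f' (hillCocycle w α₁ α₂))

/-- The `p`-adic Shintani cocycle `Φ_{f'}`. -/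
def shintani (L : Submodule ℤ V) (w : Module.Basis (Fin 2) ℚ V) (f' : V → ℤ)
    (α₁ α₂ : stabilizer p L f') : PseudoMeasureModDirac p L :=
  QuotientAddGroup.mk (shintaniPseudoMeasure p L w f' α₁ α₂)

/-- The sign of the determinant of an automorphism of `V`. -/
def detSign (γ : V ≃ₗ[ℚ] V) : ℤ := SignType.sign (LinearMap.det (γ : V →ₗ[ℚ] V))

end Shintani

end PadicShintani

end

open PadicShintani

/-! ### Sums of translates of continuous functions on `ℤ_p` -/

/-! Write `f = f' ⊗ [L_p]`. The Vanishing Hypothesis amounts to a cancellation along arithmetic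
progressions: for some `y = c w₁` in `L_p` with `c > 0` and some `M` prime to `p`, `∑_{i < M} f(v -
i y) = 0` for every `v` (`IsLevel.exists_sum_eq_zero`). Since `Γ` fixes `f`, the same holds with `α
y` in place of `y`, for every `α ∈ Γ`.

By Cramer's rule, membership in Hill's cone is a condition on signs of determinants
(`mem_hillCone_iff`), so `σ(α₁, α₂)` is a combination of the rational cone on `α₁ w₁, α₂ w₁` and of
rays or, when these vectors are dependent, of rays and half planes (`hillCocycle_mem`). Let `A_j =
∑_{i < M} δ_{i α_j y}`. In `A₁ A₂ * σ f` everything cancels wherever the progressions do not cross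
the boundary of the cone; as `f` has discrete support, a finite sum remains
(`hillCocycle_mem_averageFinite`). Dependent pairs need no separate argument.

The element `A_j` has augmentation `M`, a `p`-adic unit, and convolution with it is surjective on
measures (`exists_averageElement_smul_eq`): a preimage is the limit of `∑_{i < x_n} δ_{i M u} * ν`
with `x_n → 1/M` in `ℤ_p`. Dividing the finite sum by `A₁ A₂` gives a measure, and `(1 - δ_{α_j y})
A_j = 1 - δ_{M α_j y}` shows that the formal sum represents it.

Equivariance holds because `γ` multiplies all determinants by `det γ`. For the cocycle relation, the
Plücker identity between four vectors of a plane excludes the sign patterns that would violate it,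
so the alternating sum of the `σ` is a constant `k` away from `0` (`hillCocycle_relation`). The
formal sum `k f` has a nonzero period, hence represents `0`, and the origin contributes a multiple
of `δ_0`. -/

theorem PadicInt.exists_norm_sum_range_le {p : ℕ} [Fact p.Prime] {E : Type*}
    [NormedAddCommGroup E] [NormedSpace ℚ_[p] E] [IsUltrametricDist E]
    {F : ℤ_[p] → E} (hF : Continuous F) {ε : ℝ} (hε : 0 < ε) :
    ∃ n : ℕ, ∀ a k : ℕ, ‖∑ i ∈ Finset.range (p ^ n * k), F (a + i : ℕ)‖ ≤ ε := by
  have hp : (1 : ℝ) < p := by exact_mod_cast (Fact.out : p.Prime).one_lt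
  obtain ⟨C, hC⟩ := (isCompact_range hF).isBounded.exists_norm_le
  have hC' : ∀ a, ‖F a‖ ≤ max C 1 := fun a => (hC _ ⟨a, rfl⟩).trans (le_max_left _ _)
  obtain ⟨δ, hδ, hδF⟩ := Metric.uniformContinuous_iff.mp
    (CompactSpace.uniformContinuous_of_continuous hF) ε hε
  obtain ⟨K, hK⟩ := exists_pow_lt_of_lt_one hδ (inv_lt_one_of_one_lt₀ hp)
  have hC1 : (0 : ℝ) < max C 1 := lt_max_of_lt_right one_pos
  obtain ⟨m, hm⟩ := exists_pow_lt_of_lt_one (div_pos hε hC1) (inv_lt_one_of_one_lt₀ hp)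
  refine ⟨K + m, fun a k => ?_⟩
  have hmul : ∀ (g : ℕ → E) (r s : ℕ), ∑ i ∈ Finset.range (r * s), g i =
      ∑ i ∈ Finset.range r, ∑ j ∈ Finset.range s, g (i + r * j) := by
    intro g r s
    rw [Finset.sum_comm]
    induction s with
    | zero => simp
    | succ s ih =>
      rw [Nat.mul_succ, Finset.sum_range_add, ih, Finset.sum_range_succ]
      congr 1
      exact Finset.sum_congr rfl fun i _ => by rw [add_comm]
  -- The indices are grouped by their residue `r` modulo `p ^ K`. Within a class all values of `F`
  -- are within `ε` of `F (a + r)`, and what remains is `p ^ m * k` copies of `F (a + r)`, small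
  -- because of the factor `p ^ m`. The ultrametric inequality makes the number of classes
  -- irrelevant.
  rw [pow_add, mul_assoc, hmul]
  refine IsUltrametricDist.norm_sum_le_of_forall_le_of_nonneg hε.le fun r _ => ?_
  have hsplit : ∑ j ∈ Finset.range (p ^ m * k), F (a + (r + p ^ K * j) : ℕ) =
      (∑ j ∈ Finset.range (p ^ m * k), (F (a + (r + p ^ K * j) : ℕ) - F (a + r : ℕ))) +
        ((p ^ m * k : ℕ) : ℚ_[p]) • F (a + r : ℕ) := by
    rw [Finset.sum_sub_distrib, Finset.sum_const, Finset.card_range, Nat.cast_smul_eq_nsmul,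
      sub_add_cancel]
  rw [hsplit]
  refine (IsUltrametricDist.norm_add_le_max _ _).trans (max_le ?_ ?_)
  · refine IsUltrametricDist.norm_sum_le_of_forall_le_of_nonneg hε.le fun j _ => ?_
    rw [← dist_eq_norm]
    refine (hδF ?_).le
    rw [dist_eq_norm]
    push_cast
    rw [show (a : ℤ_[p]) + (r + p ^ K * j) - (a + r) = p ^ K * j by ring, norm_mul, norm_pow,
      PadicInt.norm_p]
    exact (mul_le_of_le_one_right (by positivity) (PadicInt.norm_le_one _)).trans_lt hK
  · rw [norm_smul, Nat.cast_mul, norm_mul, Nat.cast_pow, norm_pow, Padic.norm_p]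
    calc (p : ℝ)⁻¹ ^ m * ‖(k : ℚ_[p])‖ * ‖F (a + r : ℕ)‖
        ≤ (p : ℝ)⁻¹ ^ m * 1 * max C 1 := by
          gcongr
          · exact_mod_cast Padic.norm_int_le_one (p := p) (k : ℤ)
          · exact hC' _
      _ ≤ ε := by
          rw [mul_one]
          exact ((lt_div_iff₀ hC1).mp hm).le

/-- The sums `∑_{i < m} F(i)` converge as `m` tends `p`-adically to an element of `ℤ_p`. -/
theorem PadicInt.exists_tendsto_sum_range_appr {p : ℕ} [Fact p.Prime] {E : Type*}
    [NormedAddCommGroup E] [NormedSpace ℚ_[p] E] [IsUltrametricDist E] [CompleteSpace E]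
    {F : ℤ_[p] → E} (hF : Continuous F) (x : ℤ_[p]) :
    ∃ s : E, Filter.Tendsto (fun n => ∑ i ∈ Finset.range (x.appr n), F (i : ℕ)) Filter.atTop
      (nhds s) := by
  refine cauchySeq_tendsto_of_complete (Metric.cauchySeq_iff'.mpr fun ε hε => ?_)
  obtain ⟨N, hN⟩ := PadicInt.exists_norm_sum_range_le hF (half_pos hε)
  refine ⟨N, fun n hn => ?_⟩
  obtain ⟨k, hk⟩ := x.dvd_appr_sub_appr N n hn
  have hle := x.appr_mono hn
  rw [dist_eq_norm, show x.appr n = x.appr N + p ^ N * k by omega, Finset.sum_range_add,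
    add_sub_cancel_left]
  exact (hN _ k).trans_lt (half_lt_self hε)

/-- The truncations of `x = 1/M` are inverses of `M` modulo high powers of `p`. -/
theorem PadicInt.exists_appr_mul_eq {p : ℕ} [Fact p.Prime] {M : ℕ} {x : ℤ_[p]}
    (hx : (M : ℤ_[p]) * x = 1) {N n : ℕ} (hn : N + 1 ≤ n) :
    ∃ k, x.appr n * M = 1 + p ^ N * k := by
  have hp := (Fact.out : p.Prime)
  have hdvd : (p ^ (N + 1) : ℤ) ∣ x.appr n * M - 1 := by
    obtain ⟨c, hc⟩ := Ideal.mem_span_singleton.mp (PadicInt.appr_spec n x)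
    refine (PadicInt.pow_p_dvd_int_iff (N + 1) _).mp ((pow_dvd_pow _ hn).trans ⟨-(c * M), ?_⟩)
    push_cast
    linear_combination (-(M : ℤ_[p])) * hc + hx
  -- A natural number `k` needs a nonzero product. Working modulo `p ^ (N + 1)` ensures this even
  -- for `N = 0`: a zero product would give `p ∣ 1`.
  have hpos : 1 ≤ x.appr n * M := by
    refine Nat.one_le_iff_ne_zero.mpr fun h0 => hp.one_lt.ne' ?_
    have h0' : (x.appr n : ℤ) * M = 0 := by exact_mod_cast h0
    rw [h0', zero_sub, dvd_neg] at hdvd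
    have := (dvd_pow_self (p : ℤ) N.succ_ne_zero).trans hdvd
    exact Nat.dvd_one.mp (by exact_mod_cast this)
  obtain ⟨k, hk⟩ : p ^ (N + 1) ∣ x.appr n * M - 1 := by
    have h6 : ((x.appr n * M - 1 : ℕ) : ℤ) = x.appr n * M - 1 := by push_cast [hpos]; rfl
    rw [← h6] at hdvd
    exact_mod_cast hdvd
  refine ⟨p * k, ?_⟩
  rw [pow_succ, mul_assoc] at hk
  omega

/-! ### Measures on `L_p` and division by averages -/

namespace PadicShintani

section Measures

variable {p : ℕ} [Fact p.Prime] {V : Type*} [AddCommGroup V] [Module ℚ V]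

theorem smul_integral_single {L : Submodule ℤ V} (u : localLattice p L) (μ : PMeasure p L)
    (f : C(localLattice p L, ℚ_[p])) :
    (AddMonoidAlgebra.single u (1 : ℤ) • μ).integral f = μ.integral (f.comp (translation u)) := by
  rw [single_smul, one_smul, pushForward_integral]

theorem integral_map_sum {L : Submodule ℤ V} (μ : PMeasure p L) {ι : Type*} (s : Finset ι)
    (f : ι → C(localLattice p L, ℚ_[p])) :
    μ.integral (∑ i ∈ s, f i) = ∑ i ∈ s, μ.integral (f i) :=
  map_sum (show C(localLattice p L, ℚ_[p]) →L[ℚ_[p]] ℚ_[p] from μ) f s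

theorem integral_sum {L : Submodule ℤ V} {ι : Type*} (s : Finset ι) (μ : ι → PMeasure p L)
    (f : C(localLattice p L, ℚ_[p])) :
    (∑ i ∈ s, μ i).integral f = ∑ i ∈ s, (μ i).integral f :=
  map_sum (AddMonoidHom.mk' (fun ν : PMeasure p L => ν.integral f) fun _ _ => rfl) μ s

theorem integral_continuous {L : Submodule ℤ V} (μ : PMeasure p L) :
    Continuous (μ.integral : C(localLattice p L, ℚ_[p]) → ℚ_[p]) :=
  ContinuousLinearMap.continuous (show C(localLattice p L, ℚ_[p]) →L[ℚ_[p]] ℚ_[p] from μ)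

/-- The element `∑_{i < M} δ_{i u}` of `ℤ[L_p]`. -/
noncomputable def averageElement {L : Submodule ℤ V} (M : ℕ) (u : localLattice p L) :
    AddMonoidAlgebra ℤ (localLattice p L) :=
  ∑ i ∈ Finset.range M, AddMonoidAlgebra.single (i • u) 1

/-- A geometric series. It converts averages into the factors `1 - δ_v` allowed in `Represents`. -/
theorem one_sub_single_mul_averageElement {L : Submodule ℤ V} (M : ℕ) (u : localLattice p L) :
    (1 - AddMonoidAlgebra.single u 1) * averageElement M u =
      1 - AddMonoidAlgebra.single (M • u) (1 : ℤ) := by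
  have hs : ∀ i : ℕ, AddMonoidAlgebra.single (i • u) (1 : ℤ) =
      AddMonoidAlgebra.single u (1 : ℤ) ^ i := fun i => by
    rw [AddMonoidAlgebra.single_pow, one_pow]
  simp only [averageElement, hs]
  rw [mul_comm, ← neg_sub, mul_neg, geom_sum_mul, neg_sub]

theorem averageElement_smul_integral {L : Submodule ℤ V} (M : ℕ) (u : localLattice p L)
    (μ : PMeasure p L) (f : C(localLattice p L, ℚ_[p])) :
    (averageElement M u • μ).integral f =
      ∑ i ∈ Finset.range M, μ.integral (f.comp (translation (i • u))) := by
  rw [averageElement, Finset.sum_smul, integral_sum]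
  exact Finset.sum_congr rfl fun i _ => smul_integral_single _ _ _

instance (L : Submodule ℤ V) : ContinuousSMul ℤ_[p] (localLattice p L) := by
  refine ⟨continuous_induced_rng.mpr ?_⟩
  have h : ∀ z : ℤ_[p] × localLattice p L,
      ((z.1 • z.2 : localLattice p L) : LocalSpace p V) = (z.1 : ℚ_[p]) • (z.2 : LocalSpace p V) :=
    fun z => by
      rw [Submodule.coe_smul, ← algebraMap_smul ℚ_[p] z.1 (z.2 : LocalSpace p V)]
      rfl
  have h1 : Continuous fun z : ℤ_[p] × localLattice p L => (z.1 : ℚ_[p]) := by fun_prop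
  have h2 : Continuous fun z : ℤ_[p] × localLattice p L => (z.2 : LocalSpace p V) := by fun_prop
  have : ContinuousSMul ℚ_[p] (LocalSpace p V) :=
    IsModuleTopology.toContinuousSMul ℚ_[p] (LocalSpace p V)
  exact (h1.smul h2).congr fun z => (h z).symm

/-- The orbit of `f` under translation by multiples of `y` extends continuously to `ℤ_p`. -/
theorem translationOrbit_continuous {L : Submodule ℤ V} (f : C(localLattice p L, ℚ_[p]))
    (y : localLattice p L) :
    ∃ F : ℤ_[p] → C(localLattice p L, ℚ_[p]), Continuous F ∧
      ∀ i : ℕ, F i = f.comp (translation (i • y)) := by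
  -- Currying a jointly continuous function gives a map continuous for the compact-open topology.
  let G : C(ℤ_[p] × localLattice p L, ℚ_[p]) := ⟨fun z => f (z.2 + z.1 • y), by fun_prop⟩
  refine ⟨fun a => G.curry a, G.curry.continuous, fun i => ?_⟩
  ext z
  simp [G, translation, Nat.cast_smul_eq_nsmul]

theorem comp_translation_comp {L : Submodule ℤ V} (f : C(localLattice p L, ℚ_[p]))
    (u v : localLattice p L) :
    (f.comp (translation u)).comp (translation v) = f.comp (translation (v + u)) :=
  ContinuousMap.ext fun z => congrArg f (add_assoc z v u)

/-- Division with remainder by `M`: the product of the averages of length `M` along `u` and of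
length `m` along `M u` is the average of length `m M` along `u`. -/
theorem sum_translation_mul {L : Submodule ℤ V} (f : C(localLattice p L, ℚ_[p]))
    (u : localLattice p L) (M m : ℕ) :
    ∑ j ∈ Finset.range M, ∑ i ∈ Finset.range m,
      (f.comp (translation (j • u))).comp (translation (i • M • u)) =
      ∑ i ∈ Finset.range (m * M), f.comp (translation (i • u)) := by
  have h : ∀ i j : ℕ, i • M • u + j • u = (i * M + j) • u := fun i j => by
    rw [add_nsmul, mul_nsmul']
  simp only [comp_translation_comp, h]
  rw [Finset.sum_comm]
  induction m with
  | zero => rw [Finset.sum_range_zero, Nat.zero_mul, Finset.sum_range_zero]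
  | succ m ih => rw [Finset.sum_range_succ, ih, Nat.succ_mul, Finset.sum_range_add]

/-- A pointwise limit of measures is a measure (Banach–Steinhaus). -/
theorem PMeasure.exists_of_tendsto {L : Submodule ℤ V} [CompactSpace (localLattice p L)]
    (μn : ℕ → PMeasure p L) (g : C(localLattice p L, ℚ_[p]) → ℚ_[p])
    (h : ∀ f, Filter.Tendsto (fun n => (μn n).integral f) Filter.atTop (nhds (g f))) :
    ∃ μ : PMeasure p L, ∀ f, μ.integral f = g f := by
  let μn' : ℕ → (C(localLattice p L, ℚ_[p]) →L[ℚ_[p]] ℚ_[p]) := μn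
  have h' : Filter.Tendsto (fun n f => μn' n f) Filter.atTop (nhds g) :=
    tendsto_pi_nhds.mpr h
  exact ⟨continuousLinearMapOfTendsto μn' h', fun _ => rfl⟩

/-- If `M` is prime to `p` then convolution with `∑_{i < M} δ_{i u}` is surjective
on measures. -/
theorem exists_averageElement_smul_eq {L : Submodule ℤ V} [CompactSpace (localLattice p L)]
    {M : ℕ} (hM : M.Coprime p) (u : localLattice p L) (ν : PMeasure p L) :
    ∃ μ : PMeasure p L, averageElement M u • μ = ν := by
  have hMu : IsUnit (M : ℤ_[p]) := by
    rw [PadicInt.isUnit_iff, PadicInt.norm_def, PadicInt.coe_natCast]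
    exact (Padic.norm_natCast_eq_one_iff).mpr hM.symm
  obtain ⟨x, hx⟩ := hMu.exists_right_inv
  have horb := translationOrbit_continuous (p := p) (L := L)
  have hlim : ∀ f : C(localLattice p L, ℚ_[p]), ∃ s, Filter.Tendsto
      (fun n => ∑ i ∈ Finset.range (x.appr n), f.comp (translation (i • M • u)))
      Filter.atTop (nhds s) := by
    intro f
    obtain ⟨F, hF, hFf⟩ := horb f (M • u)
    obtain ⟨s, hs⟩ := PadicInt.exists_tendsto_sum_range_appr hF x
    exact ⟨s, by simpa only [hFf] using hs⟩
  choose s hs using hlim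
  -- Formally the inverse of the average is `(1 - δ_u) / (1 - δ_{M u})`, a geometric sum along `M u`
  -- of "length" `x = 1/M`. It is realised as the limit over the natural numbers `x.appr n`.
  obtain ⟨μ, hμ⟩ := PMeasure.exists_of_tendsto
    (fun n => averageElement (x.appr n) (M • u) • ν) (fun f => ν.integral (s f)) (fun f => by
      simp only [averageElement_smul_integral, ← integral_map_sum]
      exact ((integral_continuous ν).tendsto _).comp (hs f))
  refine ⟨μ, PMeasure.ext fun f => ?_⟩
  rw [averageElement_smul_integral]
  simp only [hμ]
  rw [← integral_map_sum]
  congr 1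
  have h1 : Filter.Tendsto (fun n => ∑ j ∈ Finset.range M, ∑ i ∈ Finset.range (x.appr n),
      (f.comp (translation (j • u))).comp (translation (i • M • u))) Filter.atTop
      (nhds (∑ j ∈ Finset.range M, s (f.comp (translation (j • u))))) :=
    tendsto_finsetSum _ fun j _ => hs _
  simp only [sum_translation_mul] at h1
  refine tendsto_nhds_unique h1 (Metric.tendsto_atTop.mpr fun ε hε => ?_)
  obtain ⟨F, hF, hFf⟩ := horb f u
  obtain ⟨N, hN⟩ := PadicInt.exists_norm_sum_range_le hF (half_pos hε)
  refine ⟨N + 1, fun n hn => ?_⟩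
  -- The combined progression has length `1 + p ^ N * k`: its first term is `f`, and the other `p ^
  -- N * k` terms form a block of small norm.
  obtain ⟨k, hk⟩ := PadicInt.exists_appr_mul_eq hx hn
  rw [show x.appr n * M = 1 + p ^ N * k from hk, Finset.sum_range_add, dist_eq_norm]
  have h5 : ∑ i ∈ Finset.range 1, f.comp (translation (i • u)) = f := by
    ext z; simp [translation]
  rw [h5, add_sub_cancel_left]
  simp only [← hFf]
  exact (hN 1 k).trans_lt (half_lt_self hε)

end Measures

end PadicShintani

namespace PadicShintani

/-! ### Calculus of formal sums -/

section FormalSums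

/-- Multiplication by `∑_{i < M} δ_{i u}` of a formal sum. -/
def average {A : Type*} [AddGroup A] (M : ℕ) (u : A) (g : A → ℤ) : A → ℤ :=
  fun v => ∑ i ∈ Finset.range M, g (v - i • u)

/-- The telescoping of `one_sub_single_mul_averageElement`, for formal sums that may be infinite. -/
theorem difference_average {A : Type*} [AddCommGroup A] (M : ℕ) (u : A) (g : A → ℤ) :
    difference u (average M u g) = difference (M • u) g := by
  ext v
  simp only [difference, average]
  induction M with
  | zero => simp
  | succ M ih =>
    rw [Finset.sum_range_succ, Finset.sum_range_succ, add_sub_add_comm, ih, sub_sub v u (M • u),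
      ← succ_nsmul']
    ring

theorem difference_average_comm {A : Type*} [AddCommGroup A] (M : ℕ) (u u' : A) (g : A → ℤ) :
    difference u (average M u' g) = average M u' (difference u g) := by
  ext v
  simp only [difference, average, ← Finset.sum_sub_distrib]
  exact Finset.sum_congr rfl fun i _ => by rw [sub_right_comm]

theorem foldr_difference_add {A : Type*} [AddGroup A] (us : List A) (g g' : A → ℤ) :
    us.foldr difference (g + g') = us.foldr difference g + us.foldr difference g' := by
  induction us with
  | nil => rfl
  | cons u us ih =>
    ext v
    simp only [List.foldr_cons, ih, difference, Pi.add_apply]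
    ring

theorem foldr_difference_smul {A : Type*} [AddGroup A] (us : List A) (n : ℤ) (g : A → ℤ) :
    us.foldr difference (n • g) = n • us.foldr difference g := by
  induction us with
  | nil => rfl
  | cons u us ih =>
    ext v
    simp only [List.foldr_cons, ih, difference, Pi.smul_apply, smul_eq_mul]
    ring

theorem foldr_difference_equiv {A : Type*} [AddGroup A] (ρ : A ≃+ A) (us : List A) (g : A → ℤ) :
    (us.map ρ).foldr difference (g ∘ ρ.symm) = us.foldr difference g ∘ ρ.symm := by
  induction us with
  | nil => rfl
  | cons u us ih =>
    ext v
    simp [ih, difference]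

variable {p : ℕ} [Fact p.Prime] {V : Type*} [AddCommGroup V] [Module ℚ V] {L : Submodule ℤ V}

theorem toLattice_nsmul (M : ℕ) (u : ratPoints p L) :
    toLattice p L (M • u) = M • toLattice p L u := by
  refine Subtype.ext ?_
  simp only [toLattice, AddSubgroup.coe_nsmul, TensorProduct.tmul_smul, Submodule.coe_smul_of_tower]

theorem ofMeasure_add (μ ν : PMeasure p L) : ofMeasure (μ + ν) = ofMeasure μ + ofMeasure ν :=
  map_add (LocalizedModule.mkLinearMap (denominators p L) (PMeasure p L)) μ ν

theorem ofMeasure_zsmul (n : ℤ) (μ : PMeasure p L) : ofMeasure (n • μ) = n • ofMeasure μ :=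
  map_zsmul (LocalizedModule.mkLinearMap (denominators p L) (PMeasure p L)) n μ

theorem smul_ofMeasure (s : AddMonoidAlgebra ℤ (localLattice p L)) (μ : PMeasure p L) :
    s • ofMeasure μ = ofMeasure (s • μ) :=
  (map_smul (LocalizedModule.mkLinearMap (denominators p L) (PMeasure p L)) s μ).symm

theorem finiteMeasure_add (G H : ratPoints p L →₀ ℤ) :
    finiteMeasure (G + H) = finiteMeasure G + finiteMeasure H :=
  Finsupp.sum_add_index' (fun _ => zero_smul _ _) fun _ _ _ => add_smul _ _ _

theorem finiteMeasure_zsmul (n : ℤ) (G : ratPoints p L →₀ ℤ) :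
    finiteMeasure (n • G) = n • finiteMeasure G :=
  by exact map_zsmul (AddMonoidHom.mk' (finiteMeasure (p := p) (L := L)) finiteMeasure_add) n G

theorem differenceProd_append (us us' : List (ratPoints p L)) :
    differenceProd (us ++ us') = differenceProd us * differenceProd us' := by
  simp [differenceProd]

/-- The concatenated list of factors is a common denominator. -/
theorem Represents.add {g g' : V → ℤ} {x x' : PseudoMeasure p L} (h : Represents g x)
    (h' : Represents g' x') : Represents (g + g') (x + x') := by
  obtain ⟨us, G, hus, hG, hx⟩ := h
  obtain ⟨us', G', hus', hG', hx'⟩ := h'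
  obtain ⟨H, hH, hHm⟩ := foldr_difference_finite us' G
  obtain ⟨H', hH', hHm'⟩ := foldr_difference_finite us G'
  refine ⟨us' ++ us, H + H', ?_, ?_, ?_⟩
  · intro u hu
    rcases List.mem_append.mp hu with hu | hu
    exacts [hus' u hu, hus u hu]
  · have : (fun v : ratPoints p L => (g + g') v) =
        (fun v : ratPoints p L => g v) + fun v : ratPoints p L => g' v := rfl
    rw [Finsupp.coe_add, hH, hH', hG, hG', this, foldr_difference_add, List.foldr_append,
      List.foldr_append, foldr_difference_comm us us']
  · rw [differenceProd_append, smul_add, mul_smul, hx, mul_comm, mul_smul, hx', smul_ofMeasure,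
      smul_ofMeasure, finiteMeasure_add, ofMeasure_add, hHm, hHm']

theorem Represents.zsmul {g : V → ℤ} {x : PseudoMeasure p L} (h : Represents g x) (n : ℤ) :
    Represents (n • g) (n • x) := by
  obtain ⟨us, G, hus, hG, hx⟩ := h
  refine ⟨us, n • G, hus, ?_, ?_⟩
  · have : (fun v : ratPoints p L => (n • g) v) = n • fun v : ratPoints p L => g v := rfl
    rw [Finsupp.coe_smul, hG, this, foldr_difference_smul]
  · rw [smul_comm, hx, finiteMeasure_zsmul, ofMeasure_zsmul]

theorem Represents.sub {g g' : V → ℤ} {x x' : PseudoMeasure p L} (h : Represents g x)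
    (h' : Represents g' x') : Represents (g - g') (x - x') := by
  simpa [sub_eq_add_neg] using h.add (h'.zsmul (-1))

/-- A periodic formal sum is annihilated by `1 - δ_u`, which is a denominator. This disposes of the
constant in the cocycle relation. -/
theorem represents_of_difference_eq_zero {g : V → ℤ} {u : ratPoints p L} (hu : u ≠ 0)
    (h : ∀ v : ratPoints p L, g ((v - u : ratPoints p L) : V) = g v) :
    Represents g (0 : PseudoMeasure p L) := by
  refine ⟨[u], 0, by simpa using hu, ?_, ?_⟩
  · ext v
    simp [difference, ← h v]
  · rw [smul_zero]
    exact (map_zero (LocalizedModule.mkLinearMap (denominators p L) (PMeasure p L))).symm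

/-- The contribution of the origin, which is why the cocycle relation is taken modulo `ℤ δ_0`. -/
theorem represents_of_support_subset {g : V → ℤ} (h : ∀ v, v ≠ 0 → g v = 0) :
    Represents g (g 0 • ofMeasure (dirac (0 : localLattice p L))) := by
  refine ⟨[], Finsupp.single 0 (g 0), by simp, ?_, ?_⟩
  · ext v
    by_cases hv : v = 0
    · simp [hv]
    · rw [Finsupp.single_eq_of_ne hv, List.foldr_nil, h v (by simpa using hv)]
  · have h0 : toLattice p L 0 = 0 := Subtype.ext (by simp [toLattice])
    simp [differenceProd, finiteMeasure, Finsupp.sum_single_index, h0, ofMeasure_zsmul]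

/-- A formal sum which becomes finite after convolution with two averages of length prime to `p`
represents a measure. -/
theorem represents_ofMeasure_of_average [CompactSpace (localLattice p L)] {M : ℕ} (hM0 : M ≠ 0)
    (hM : M.Coprime p) {y₁ y₂ : ratPoints p L} (hy₁ : y₁ ≠ 0) (hy₂ : y₂ ≠ 0) {g : V → ℤ}
    (hfin : (Function.support
      (average M y₁ (average M y₂ fun v : ratPoints p L => g v))).Finite) :
    ∃ μ : PMeasure p L, Represents g (ofMeasure μ) := by
  let H : ratPoints p L →₀ ℤ := Finsupp.ofSupportFinite _ hfin
  obtain ⟨μ₁, hμ₁⟩ := exists_averageElement_smul_eq hM (toLattice p L y₁) (finiteMeasure H)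
  obtain ⟨μ, hμ⟩ := exists_averageElement_smul_eq hM (toLattice p L y₂) μ₁
  obtain ⟨H', hH', hHm⟩ := foldr_difference_finite [y₁, y₂] H
  have hne : ∀ y : ratPoints p L, y ≠ 0 → M • y ≠ 0 := fun y hy h0 => by
    have h1 : M • (y : V) = 0 := by exact_mod_cast congrArg Subtype.val h0
    rw [← Nat.cast_smul_eq_nsmul ℚ] at h1
    rcases smul_eq_zero.mp h1 with h2 | h2
    · exact hM0 (by exact_mod_cast h2)
    · exact hy (Subtype.ext h2)
  -- `1 - δ_{M y}` is `1 - δ_y` times the average along `y`. So these two factors first make the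
  -- formal sum equal to the finite `H`, then apply `1 - δ_{y₁}` and `1 - δ_{y₂}` to it.
  refine ⟨μ, [M • y₁, M • y₂], H', ?_, ?_, ?_⟩
  · simpa using ⟨hne y₁ hy₁, hne y₂ hy₂⟩
  · rw [hH']
    simp only [List.foldr_cons, List.foldr_nil, ← difference_average]
    rw [← difference_average_comm]
    rfl
  · rw [smul_ofMeasure, hHm]
    congr 1
    simp only [differenceProd, List.map_cons, List.map_nil, List.prod_cons, List.prod_nil, mul_one,
      toLattice_nsmul, ← one_sub_single_mul_averageElement]
    rw [mul_mul_mul_comm, ← hμ₁, ← hμ]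
    simp only [smul_smul, mul_assoc]

theorem actPseudo_smul (γ : V ≃ₗ[ℚ] V) (h : PreservesLattice p L γ)
    (s : AddMonoidAlgebra ℤ (localLattice p L)) (x : PseudoMeasure p L) :
    actPseudo γ h (s • x) = actRing γ h s • actPseudo γ h x := by
  induction x using LocalizedModule.induction_on with
  | _ m t => rw [LocalizedModule.smul'_mk, actPseudo_mk, actPseudo_mk, LocalizedModule.smul'_mk,
      actMeasure_smul]

theorem latticeMap_toLattice (γ : V ≃ₗ[ℚ] V) (h : PreservesLattice p L γ)
    (ρ : ratPoints p L ≃+ ratPoints p L) (hρ : ∀ v, (ρ v : V) = γ v) (v : ratPoints p L) :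
    latticeMap γ h (toLattice p L v) = toLattice p L (ρ v) := by
  refine Subtype.ext ?_
  simp [latticeMap, toLattice, localMap, hρ]

/-- Transport of a represented pseudo-measure by an automorphism. -/
theorem Represents.map {g : V → ℤ} {x : PseudoMeasure p L} (hx : Represents g x) (γ : V ≃ₗ[ℚ] V)
    (h : PreservesLattice p L γ) (ρ : ratPoints p L ≃+ ratPoints p L)
    (hρ : ∀ v, (ρ v : V) = γ v) :
    Represents (fun v => g (γ.symm v)) (actPseudo γ h x) := by
  obtain ⟨us, G, hus, hG, hx⟩ := hx
  refine ⟨us.map ρ, G.equivMapDomain ρ.toEquiv, ?_, ?_, ?_⟩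
  · intro u hu
    obtain ⟨u', hu', rfl⟩ := List.mem_map.mp hu
    simpa using hus u' hu'
  · have h1 : (fun v : ratPoints p L => g (γ.symm v)) =
        (fun v : ratPoints p L => g v) ∘ ρ.symm := by
      ext v
      have := hρ (ρ.symm v)
      rw [AddEquiv.apply_symm_apply] at this
      simp [this]
    rw [h1, foldr_difference_equiv, ← hG]
    rfl
  · have h1 : differenceProd (us.map ρ) = actRing γ h (differenceProd us) := by
      rw [differenceProd, differenceProd, map_list_prod, List.map_map, List.map_map]
      congr 2
      ext1 u
      simp only [Function.comp_apply, map_sub, map_one, actRing,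
        AddMonoidAlgebra.mapDomainRingHom_apply, AddMonoidAlgebra.mapDomain_single]
      rw [← latticeMap_toLattice γ h ρ hρ]
    have h2 : actMeasure γ h (finiteMeasure G) = finiteMeasure (G.equivMapDomain ρ.toEquiv) := by
      rw [finiteMeasure, finiteMeasure, Finsupp.equivMapDomain_eq_mapDomain,
        Finsupp.sum_mapDomain_index_inj ρ.toEquiv.injective, Finsupp.sum, Finsupp.sum, map_sum]
      refine Finset.sum_congr rfl fun v _ => ?_
      rw [map_zsmul]
      congr 1
      rw [show ρ.toEquiv v = ρ v from rfl, ← latticeMap_toLattice γ h ρ hρ]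
      rfl
    rw [h1, ← actPseudo_smul, hx, ← h2, ofMeasure, actPseudo_mk, map_one]
    rfl

end FormalSums

end PadicShintani

namespace PadicShintani

/-! ### Lattices in coordinates -/

section Lattices

theorem padic_norm_rat_le_one_iff {q : ℕ} [Fact q.Prime] {x : ℚ} :
    ‖(x : ℚ_[q])‖ ≤ 1 ↔ ¬ q ∣ x.den :=
  (Padic.norm_rat_le_one_iff_padicValuation_le_one q).trans Rat.padicValuation_le_one_iff

theorem exists_int_eq_of_padic_norm_le_one {x : ℚ}
    (h : ∀ (q : ℕ) [Fact q.Prime], ‖(x : ℚ_[q])‖ ≤ 1) : ∃ n : ℤ, x = n := by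
  refine ⟨x.num, ?_⟩
  have hden : x.den = 1 := by
    by_contra hne
    obtain ⟨q, hq, hqd⟩ := Nat.exists_prime_and_dvd hne
    have : Fact q.Prime := ⟨hq⟩
    have h1 := h q
    rw [padic_norm_rat_le_one_iff] at h1
    exact h1 hqd
  exact (Rat.den_eq_one_iff x).mp hden |>.symm

variable {V : Type*} [AddCommGroup V] [Module ℚ V] {L : Submodule ℤ V}

/-- A lattice in a plane has a basis. -/
theorem exists_lattice_basis (hLfg : L.FG) (hLspan : Submodule.span ℚ (L : Set V) = ⊤)
    (w : Module.Basis (Fin 2) ℚ V) :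
    ∃ e : Module.Basis (Fin 2) ℚ V, L = Submodule.span ℤ (Set.range e) := by
  have : Module.Finite ℤ L := Module.Finite.iff_fg.mpr hLfg
  have : IsAddTorsionFree V := IsAddTorsionFree.of_module_rat V
  have : Module.IsTorsionFree ℤ L := inferInstance
  have : Module.Free ℤ L := Module.free_of_finite_type_torsion_free'
  let b := Module.Free.chooseBasis ℤ L
  have hli : LinearIndependent ℤ fun i => (b i : V) :=
    b.linearIndependent.map' L.subtype (Submodule.ker_subtype L)
  have hli' : LinearIndependent ℚ fun i => (b i : V) :=
    (LinearIndependent.iff_fractionRing ℤ ℚ).mp hli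
  have hspan : Submodule.span ℤ (Set.range fun i => (b i : V)) = L := by
    have h1 : (Set.range fun i => (b i : V)) = L.subtype '' Set.range b := by
      rw [← Set.range_comp]; rfl
    rw [h1, Submodule.span_image, b.span_eq, Submodule.map_top, Submodule.range_subtype]
  have hspan' : ⊤ ≤ Submodule.span ℚ (Set.range fun i => (b i : V)) := by
    rw [← hLspan, Submodule.span_le]
    exact (SetLike.coe_subset_coe.mpr hspan.symm.le).trans (Submodule.span_subset_span ℤ ℚ _)
  let e₀ := Module.Basis.mk hli' hspan'
  let e := e₀.reindex (e₀.indexEquiv w)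
  refine ⟨e, ?_⟩
  rw [Module.Basis.range_reindex, Module.Basis.coe_mk, hspan]

variable {e : Module.Basis (Fin 2) ℚ V} {q : ℕ} [Fact q.Prime]

theorem exists_int_repr_of_mem (he : L = Submodule.span ℤ (Set.range e)) {l : V} (hl : l ∈ L)
    (i : Fin 2) : ∃ n : ℤ, e.repr l i = n := by
  rw [he] at hl
  induction hl using Submodule.span_induction with
  | mem x hx =>
    obtain ⟨j, rfl⟩ := hx
    by_cases hij : j = i
    · exact ⟨1, by simp [hij]⟩
    · exact ⟨0, by simp [hij]⟩
  | zero => exact ⟨0, by simp⟩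
  | add x y _ _ hx hy =>
    obtain ⟨m, hm⟩ := hx
    obtain ⟨n, hn⟩ := hy
    exact ⟨m + n, by simp [hm, hn]⟩
  | smul a x _ hx =>
    obtain ⟨n, hn⟩ := hx
    exact ⟨a * n, by simp [hn]⟩

theorem baseChange_repr_one_tmul (v : V) (i : Fin 2) :
    (e.baseChange ℚ_[q]).repr ((1 : ℚ_[q]) ⊗ₜ[ℚ] v) i = (e.repr v i : ℚ_[q]) := by
  rw [Module.Basis.baseChange_repr_tmul, Rat.smul_def, mul_one]

theorem mem_localLattice_iff (he : L = Submodule.span ℤ (Set.range e)) (x : LocalSpace q V) :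
    x ∈ localLattice q L ↔ ∀ i, ‖(e.baseChange ℚ_[q]).repr x i‖ ≤ 1 := by
  constructor
  · intro hx i
    induction hx using Submodule.span_induction with
    | mem x hx =>
      obtain ⟨l, hl, rfl⟩ := hx
      obtain ⟨n, hn⟩ := exists_int_repr_of_mem he hl i
      rw [baseChange_repr_one_tmul, hn, Rat.cast_intCast]
      exact Padic.norm_int_le_one n
    | zero => simp
    | add x y _ _ hx hy =>
      rw [map_add, Finsupp.add_apply]
      exact (Padic.nonarchimedean _ _).trans (max_le hx hy)
    | smul a x _ hx =>
      rw [← algebraMap_smul ℚ_[q] a x, map_smul, Finsupp.smul_apply, smul_eq_mul, norm_mul]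
      exact mul_le_one₀ a.2 (norm_nonneg _) hx
  · intro hx
    rw [← (e.baseChange ℚ_[q]).sum_repr x]
    refine Submodule.sum_mem _ fun i _ => ?_
    have h1 : (e.baseChange ℚ_[q]).repr x i • (e.baseChange ℚ_[q]) i =
        (show ℤ_[q] from ⟨_, hx i⟩) • (e.baseChange ℚ_[q]) i := by
      rw [← algebraMap_smul ℚ_[q] (show ℤ_[q] from ⟨_, hx i⟩) ((e.baseChange ℚ_[q]) i)]
      rfl
    rw [h1]
    refine Submodule.smul_mem _ _ (Submodule.subset_span ⟨e i, ?_, ?_⟩)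
    · rw [he]; exact Submodule.subset_span ⟨i, rfl⟩
    · rw [Module.Basis.baseChange_apply]

theorem mem_ratPoints_iff (he : L = Submodule.span ℤ (Set.range e)) (v : V) :
    v ∈ ratPoints q L ↔ ∀ i, ‖(e.repr v i : ℚ_[q])‖ ≤ 1 := by
  change (1 : ℚ_[q]) ⊗ₜ[ℚ] v ∈ localLattice q L ↔ _
  simp only [mem_localLattice_iff he, baseChange_repr_one_tmul]

/-- Coordinates on `V_q`. -/
noncomputable def localCoordinates (q : ℕ) [Fact q.Prime] (e : Module.Basis (Fin 2) ℚ V) :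
    LocalSpace q V ≃ₜ (Fin 2 → ℚ_[q]) where
  toEquiv := (e.baseChange ℚ_[q]).equivFun.toEquiv
  continuous_toFun := IsModuleTopology.continuous_of_linearMap
    ((e.baseChange ℚ_[q]).equivFun : LocalSpace q V →ₗ[ℚ_[q]] Fin 2 → ℚ_[q])
  continuous_invFun := IsModuleTopology.continuous_of_linearMap
    ((e.baseChange ℚ_[q]).equivFun.symm : (Fin 2 → ℚ_[q]) →ₗ[ℚ_[q]] LocalSpace q V)

theorem localCoordinates_add (x y : LocalSpace q V) :
    localCoordinates q e (x + y) = localCoordinates q e x + localCoordinates q e y :=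
  map_add (e.baseChange ℚ_[q]).equivFun x y

theorem compactSpace_localLattice (he : L = Submodule.span ℤ (Set.range e)) :
    CompactSpace (localLattice q L) := by
  refine isCompact_iff_compactSpace.mp ?_
  have h : (localLattice q L : Set (LocalSpace q V)) =
      localCoordinates q e ⁻¹' Metric.closedBall 0 1 := by
    ext x
    rw [SetLike.mem_coe, mem_localLattice_iff he, Set.mem_preimage, mem_closedBall_zero_iff,
      pi_norm_le_iff_of_nonneg zero_le_one]
    rfl
  rw [h]
  exact (localCoordinates q e).isClosedEmbedding.isCompact_preimage
    (isCompact_closedBall 0 1)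

/-! ### Test functions -/

/-- Compact support gives uniform continuity, and integers at distance less than `1` are equal, so
`φ` is periodic under a small lattice; boundedness of the support gives the second bound. The
exponent is the sum of those needed for the two conditions. -/
theorem IsStep.exists_pow (e : Module.Basis (Fin 2) ℚ V) {φ : LocalSpace q V → ℤ}
    (hφ : IsStep q φ) : ∃ n : ℕ,
      (∀ x l, (∀ i, ‖(e.baseChange ℚ_[q]).repr l i‖ ≤ ‖((q ^ n : ℕ) : ℚ_[q])‖) →
        φ (x + l) = φ x) ∧
      ∀ x, φ x ≠ 0 → ∀ i, ‖((q ^ n : ℕ) : ℚ_[q]) * (e.baseChange ℚ_[q]).repr x i‖ ≤ 1 := by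
  obtain ⟨hlc, hcs⟩ := hφ
  have hq : (1 : ℝ) < q := by exact_mod_cast (Fact.out : q.Prime).one_lt
  have hinv := inv_lt_one_of_one_lt₀ hq
  let ψ : (Fin 2 → ℚ_[q]) → ℤ := φ ∘ (localCoordinates q e).symm
  have hψc : Continuous ψ := hlc.continuous.comp (localCoordinates q e).symm.continuous
  have hψs : HasCompactSupport ψ := hcs.comp_homeomorph (localCoordinates q e).symm
  have hψ : ∀ x, φ x = ψ (localCoordinates q e x) := fun x => by simp [ψ]
  obtain ⟨δ, hδ, hδψ⟩ := Metric.uniformContinuous_iff.mp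
    (hψs.uniformContinuous_of_continuous hψc) 1 one_pos
  obtain ⟨m, hm⟩ := exists_pow_lt_of_lt_one hδ hinv
  obtain ⟨C, hC⟩ := hψs.isCompact.isBounded.exists_norm_le
  obtain ⟨k, hk⟩ := exists_pow_lt_of_lt_one (inv_pos.mpr (lt_max_of_lt_right one_pos :
    (0 : ℝ) < max C 1)) hinv
  have hnorm : ‖((q ^ (m + k) : ℕ) : ℚ_[q])‖ = (q : ℝ)⁻¹ ^ m * (q : ℝ)⁻¹ ^ k := by
    rw [Nat.cast_pow, norm_pow, Padic.norm_p, pow_add]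
  have hinv0 : (0 : ℝ) ≤ (q : ℝ)⁻¹ := by positivity
  refine ⟨m + k, fun x l hl => ?_, fun x hx i => ?_⟩
  · have hd : dist (localCoordinates q e (x + l)) (localCoordinates q e x) < δ := by
      rw [localCoordinates_add, dist_eq_norm, add_sub_cancel_left]
      refine lt_of_le_of_lt ((pi_norm_le_iff_of_nonneg (by positivity)).mpr fun i => ?_) hm
      refine (hl i).trans (hnorm.trans_le ?_)
      exact mul_le_of_le_one_right (by positivity) (pow_le_one₀ hinv0 hinv.le)
    have h1 := hδψ hd
    rw [← hψ, ← hψ, Int.dist_eq, ← Int.cast_sub, ← Int.cast_abs] at h1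
    have h2 : |φ (x + l) - φ x| < 1 := by exact_mod_cast h1
    exact sub_eq_zero.mp (Int.abs_lt_one_iff.mp h2)
  · have h1 : ‖localCoordinates q e x‖ ≤ max C 1 :=
      (hC _ (subset_tsupport _ (by rwa [Function.mem_support, ← hψ]))).trans (le_max_left _ _)
    have h2 : ‖(e.baseChange ℚ_[q]).repr x i‖ ≤ max C 1 :=
      (norm_le_pi_norm (localCoordinates q e x) i).trans h1
    rw [norm_mul, hnorm]
    calc (q : ℝ)⁻¹ ^ m * (q : ℝ)⁻¹ ^ k * ‖(e.baseChange ℚ_[q]).repr x i‖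
        ≤ 1 * (max C 1)⁻¹ * max C 1 := by
          gcongr
          exact pow_le_one₀ hinv0 hinv.le
      _ = 1 := by
          rw [one_mul, inv_mul_cancel₀]
          exact (lt_max_of_lt_right one_pos).ne'

/-- A test function away from `p` is periodic with respect to a lattice and supported in
a lattice. -/
theorem exists_level {p : ℕ} [Fact p.Prime] (he : L = Submodule.span ℤ (Set.range e)) {f' : V → ℤ}
    (hf' : f' ∈ testFunctionsAway p L) : ∃ N : ℕ, N ≠ 0 ∧
      (∀ v l, (∀ (q : PrimesAway p) i, ‖(e.repr l i : ℚ_[(q : ℕ)])‖ ≤ ‖(N : ℚ_[(q : ℕ)])‖) →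
        f' (v + l) = f' v) ∧
      ∀ v, f' v ≠ 0 →
        ∀ (q : PrimesAway p) i, ‖(N : ℚ_[(q : ℕ)]) * (e.repr v i : ℚ_[(q : ℕ)])‖ ≤ 1 := by
  have hle : ∀ (q : PrimesAway p) (a b : ℕ), ‖((a * b : ℕ) : ℚ_[(q : ℕ)])‖ ≤ ‖(a : ℚ_[(q : ℕ)])‖ :=
    fun q a b => by
      rw [Nat.cast_mul, norm_mul]
      exact mul_le_of_le_one_right (norm_nonneg _) (by exact_mod_cast Padic.norm_int_le_one (b : ℤ))
  induction hf' using AddSubgroup.closure_induction with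
  | mem g hg =>
    obtain ⟨φ, hφ, hfin, rfl⟩ := hg
    choose n hn hns using fun q => (hφ q).exists_pow e
    -- Outside `S` the local factor is the indicator of the lattice, so only the primes of `S` enter
    -- the level.
    let S : Finset (PrimesAway p) := Set.Finite.toFinset (Filter.eventually_cofinite.mp hfin)
    have hS : ∀ q, q ∉ S →
        φ q = Set.indicator (localLattice (q : ℕ) L : Set (LocalSpace (q : ℕ) V)) 1 := by
      intro q hq
      by_contra h
      exact hq ((Set.Finite.mem_toFinset _).mpr h)
    let N := ∏ q ∈ S, (q : ℕ) ^ n q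
    have hN : ∀ q ∈ S, ∃ b, N = (q : ℕ) ^ n q * b := fun q hq =>
      Finset.dvd_prod_of_mem (fun q : PrimesAway p => (q : ℕ) ^ n q) hq
    have hφS : ∀ (q : PrimesAway p) (v : V), φ q ((1 : ℚ_[(q : ℕ)]) ⊗ₜ[ℚ] v) ≠ 0 →
        ∀ i, ‖(N : ℚ_[(q : ℕ)]) * (e.repr v i : ℚ_[(q : ℕ)])‖ ≤ 1 := by
      intro q v hv i
      by_cases hq : q ∈ S
      · obtain ⟨b, hb⟩ := hN q hq
        have h1 := hns q _ hv i
        rw [baseChange_repr_one_tmul] at h1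
        rw [norm_mul] at h1 ⊢
        exact (mul_le_mul_of_nonneg_right (hb ▸ hle q _ b) (norm_nonneg _)).trans h1
      · rw [hS q hq, Set.indicator_apply_ne_zero] at hv
        have h1 := (mem_localLattice_iff he _).mp hv.1 i
        rw [baseChange_repr_one_tmul] at h1
        rw [norm_mul]
        exact mul_le_one₀ (by exact_mod_cast Padic.norm_int_le_one (N : ℤ)) (norm_nonneg _) h1
    refine ⟨N, Finset.prod_ne_zero_iff.mpr fun q _ => pow_ne_zero _ q.2.1.ne_zero, ?_, ?_⟩
    · intro v l hl
      refine finprod_congr fun q => ?_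
      rw [TensorProduct.tmul_add]
      by_cases hq : q ∈ S
      · obtain ⟨b, hb⟩ := hN q hq
        refine hn q _ _ fun i => ?_
        rw [baseChange_repr_one_tmul]
        exact (hl q i).trans (hb ▸ hle q _ b)
      · have hl' : (1 : ℚ_[(q : ℕ)]) ⊗ₜ[ℚ] l ∈ localLattice (q : ℕ) L := by
          rw [mem_localLattice_iff he]
          intro i
          rw [baseChange_repr_one_tmul]
          exact (hl q i).trans (by exact_mod_cast Padic.norm_int_le_one (N : ℤ))
        rw [hS q hq]
        by_cases hv : (1 : ℚ_[(q : ℕ)]) ⊗ₜ[ℚ] v ∈ localLattice (q : ℕ) L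
        · rw [Set.indicator_of_mem (SetLike.mem_coe.mpr hv),
            Set.indicator_of_mem (SetLike.mem_coe.mpr (add_mem hv hl'))]
          rfl
        · rw [Set.indicator_of_notMem (SetLike.mem_coe.not.mpr hv), Set.indicator_of_notMem]
          exact fun h => hv ((Submodule.add_mem_iff_left _ hl').mp h)
    · intro v hv q
      -- A vanishing factor forces `∏ᶠ` to vanish only if almost all factors are `1`, since `∏ᶠ` is
      -- `1` otherwise. Here a factor can differ from `1` only in `S` or at a prime dividing a
      -- denominator of a coordinate of `v`.
      refine hφS q v fun h0 => hv (finprod_eq_zero _ q h0 ?_)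
      have hden : (⋃ i : Fin 2, {r : PrimesAway p | (r : ℕ) ∣ (e.repr v i).den}).Finite := by
        refine Set.finite_iUnion fun i => ?_
        refine Set.Finite.of_finite_image (f := Subtype.val)
          ((Nat.divisors (e.repr v i).den).finite_toSet.subset ?_) Subtype.val_injective.injOn
        rintro _ ⟨r, hr, rfl⟩
        exact Nat.mem_divisors.mpr ⟨hr, (e.repr v i).den_ne_zero⟩
      refine (S.finite_toSet.union hden).subset fun r hr => ?_
      by_contra hr'
      rw [Set.mem_union, not_or] at hr'
      refine hr ?_
      change φ r ((1 : ℚ_[(r : ℕ)]) ⊗ₜ[ℚ] v) = 1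
      rw [hS r hr'.1, Set.indicator_of_mem]
      · rfl
      · rw [SetLike.mem_coe, mem_localLattice_iff he]
        intro i
        rw [baseChange_repr_one_tmul, padic_norm_rat_le_one_iff]
        exact fun h => hr'.2 (Set.mem_iUnion.mpr ⟨i, h⟩)
  | zero => exact ⟨1, one_ne_zero, fun _ _ _ => rfl, fun _ h => absurd rfl h⟩
  | add g g' _ _ hg hg' =>
    obtain ⟨N, hN, hper, hsupp⟩ := hg
    obtain ⟨N', hN', hper', hsupp'⟩ := hg'
    refine ⟨N * N', mul_ne_zero hN hN', fun v l hl => ?_, fun v hv q i => ?_⟩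
    · rw [Pi.add_apply, Pi.add_apply, hper v l fun q i => (hl q i).trans (hle q _ _),
        hper' v l fun q i => (hl q i).trans (mul_comm N N' ▸ hle q _ _)]
    · rw [norm_mul]
      have h1 : g v ≠ 0 ∨ g' v ≠ 0 := by
        by_contra! h
        exact hv (by rw [Pi.add_apply, h.1, h.2, add_zero])
      rcases h1 with h1 | h1
      · refine (mul_le_mul_of_nonneg_right (hle q N N') (norm_nonneg _)).trans ?_
        rw [← norm_mul]
        exact hsupp v h1 q i
      · rw [mul_comm N N']
        refine (mul_le_mul_of_nonneg_right (hle q N' N) (norm_nonneg _)).trans ?_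
        rw [← norm_mul]
        exact hsupp' v h1 q i
  | neg g _ hg =>
    obtain ⟨N, hN, hper, hsupp⟩ := hg
    exact ⟨N, hN, fun v l hl => congrArg Neg.neg (hper v l hl),
      fun v hv => hsupp v fun h => hv (by rw [Pi.neg_apply, h, neg_zero])⟩

end Lattices

end PadicShintani

/-! ### Levels of test functions and the action of the stabiliser -/

namespace PadicShintani

section Levels

/-- Euler's theorem. Multiplication by such a power of `p` moves a vector into `L_p` without being
visible modulo `D`. -/
theorem exists_pow_modEq_one {p D : ℕ} (hD : D.Coprime p) (hD0 : D ≠ 0) (a : ℕ) :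
    ∃ k, a ≤ k ∧ p ^ k ≡ 1 [MOD D] := by
  refine ⟨D.totient * a, Nat.le_mul_of_pos_left a (Nat.totient_pos.mpr hD0.bot_lt), ?_⟩
  rw [pow_mul]
  simpa using (Nat.ModEq.pow_totient hD.symm).pow a

variable {p : ℕ} [Fact p.Prime] {V : Type*} [AddCommGroup V] [Module ℚ V] {L : Submodule ℤ V}
  {e : Module.Basis (Fin 2) ℚ V} {f' : V → ℤ}

theorem padic_norm_natCast_le_one (q : ℕ) [Fact q.Prime] (n : ℕ) : ‖(n : ℚ_[q])‖ ≤ 1 := by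
  exact_mod_cast Padic.norm_int_le_one (p := q) (n : ℤ)

theorem padic_norm_natCast_eq_one {n : ℕ} (hn : n.Coprime p) : ‖(n : ℚ_[p])‖ = 1 :=
  Padic.norm_natCast_eq_one_iff.mpr hn.symm

theorem padic_norm_pow_eq_one (q : PrimesAway p) (k : ℕ) :
    ‖((p ^ k : ℕ) : ℚ_[(q : ℕ)])‖ = 1 :=
  Padic.norm_natCast_eq_one_iff.mpr
    (Nat.Coprime.pow_right k ((Nat.coprime_primes q.2.1 Fact.out).mpr q.2.2))

variable (p) in
/-- The decomposition of a positive integer into its `p`-part and its part prime to `p`. -/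
theorem exists_eq_pow_mul_coprime {n : ℕ} (hn : n ≠ 0) :
    ∃ k m : ℕ, n = p ^ k * m ∧ m.Coprime p ∧ m ≠ 0 := by
  have hp := (Fact.out : p.Prime)
  obtain ⟨k, m, hm, rfl⟩ := Nat.exists_eq_pow_mul_and_not_dvd hn p hp.ne_one
  exact ⟨k, m, rfl, ((Nat.Prime.coprime_iff_not_dvd hp).mpr hm).symm, by rintro rfl; simp at hm⟩

/-- A level of a test function away from `p`: it is periodic with respect to `N L[1/p]` and
supported in `N⁻¹ L[1/p]`. -/
structure IsLevel (p : ℕ) [Fact p.Prime] (e : Module.Basis (Fin 2) ℚ V) (f' : V → ℤ) (N : ℕ) :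
    Prop where
  ne_zero : N ≠ 0
  coprime : N.Coprime p
  periodic : ∀ v l, (∀ (q : PrimesAway p) i,
    ‖(e.repr l i : ℚ_[(q : ℕ)])‖ ≤ ‖(N : ℚ_[(q : ℕ)])‖) → f' (v + l) = f' v
  support : ∀ v, f' v ≠ 0 →
    ∀ (q : PrimesAway p) i, ‖(N : ℚ_[(q : ℕ)]) * (e.repr v i : ℚ_[(q : ℕ)])‖ ≤ 1

/-- The `p`-part of a level can be discarded, since `p` is a unit at all other primes. -/
theorem exists_isLevel (he : L = Submodule.span ℤ (Set.range e))
    (hf' : f' ∈ testFunctionsAway p L) : ∃ N, IsLevel p e f' N := by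
  obtain ⟨N, hN, hper, hsupp⟩ := exists_level he hf'
  obtain ⟨k, m, rfl, hm, hm0⟩ := exists_eq_pow_mul_coprime p hN
  have h : ∀ q : PrimesAway p, ‖((p ^ k * m : ℕ) : ℚ_[(q : ℕ)])‖ = ‖(m : ℚ_[(q : ℕ)])‖ :=
    fun q => by rw [Nat.cast_mul, norm_mul, padic_norm_pow_eq_one, one_mul]
  refine ⟨m, hm0, hm, fun v l hl => hper v l fun q i => (h q).symm ▸ hl q i, fun v hv q i => ?_⟩
  have h1 := hsupp v hv q i
  rwa [norm_mul, h, ← norm_mul] at h1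

variable (p e) in
theorem exists_denominator (v : V) : ∃ B a : ℕ, B ≠ 0 ∧ B.Coprime p ∧
    (∀ (q : PrimesAway p) i, ‖(B : ℚ_[(q : ℕ)]) * (e.repr v i : ℚ_[(q : ℕ)])‖ ≤ 1) ∧
    ∀ i, ‖((p ^ a : ℕ) : ℚ_[p]) * (e.repr v i : ℚ_[p])‖ ≤ 1 := by
  obtain ⟨a, B, hB, hBp, hB0⟩ := exists_eq_pow_mul_coprime p
    (mul_ne_zero (e.repr v 0).den_ne_zero (e.repr v 1).den_ne_zero)
  have hint : ∀ i, ∃ n : ℤ, ((p ^ a * B : ℕ) : ℚ) * e.repr v i = n := by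
    intro i
    rw [← hB, Nat.cast_mul]
    fin_cases i
    · refine ⟨(e.repr v 1).den * (e.repr v 0).num, ?_⟩
      have := Rat.mul_den_eq_num (e.repr v 0)
      push_cast
      change _ * e.repr v 0 = _
      rw [← this]
      ring
    · refine ⟨(e.repr v 0).den * (e.repr v 1).num, ?_⟩
      have := Rat.mul_den_eq_num (e.repr v 1)
      push_cast
      change _ * e.repr v 1 = _
      rw [← this]
      ring
  have hnorm : ∀ (q : ℕ) [Fact q.Prime] i,
      ‖((p ^ a : ℕ) : ℚ_[q])‖ * ‖(B : ℚ_[q])‖ * ‖(e.repr v i : ℚ_[q])‖ ≤ 1 := by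
    intro q _ i
    obtain ⟨n, hn⟩ := hint i
    rw [← norm_mul, ← norm_mul, ← Nat.cast_mul, ← Rat.cast_natCast, ← Rat.cast_mul, hn,
      Rat.cast_intCast]
    exact Padic.norm_int_le_one n
  refine ⟨B, a, hB0, hBp, fun q i => ?_, fun i => ?_⟩
  · have := hnorm q i
    rwa [padic_norm_pow_eq_one, one_mul, ← norm_mul] at this
  · have := hnorm p i
    rwa [padic_norm_natCast_eq_one hBp, mul_one, ← norm_mul] at this

theorem globalTest_of_mem {v : V} (hv : v ∈ ratPoints p L) : globalTest p L f' v = f' v :=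
  Set.indicator_of_mem (SetLike.mem_coe.mpr hv) f'

theorem mem_ratPoints_of_globalTest_ne_zero {v : V} (hv : globalTest p L f' v ≠ 0) :
    v ∈ ratPoints p L := Set.mem_of_indicator_ne_zero hv

theorem ne_zero_of_globalTest_ne_zero {v : V} (hv : globalTest p L f' v ≠ 0) : f' v ≠ 0 := by
  rwa [globalTest_of_mem (mem_ratPoints_of_globalTest_ne_zero hv)] at hv

theorem globalTest_add_of_mem {v l : V} (hl : l ∈ ratPoints p L)
    (h : f' (v + l) = f' v) : globalTest p L f' (v + l) = globalTest p L f' v := by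
  by_cases hv : v ∈ ratPoints p L
  · rw [globalTest_of_mem hv, globalTest_of_mem (add_mem hv hl), h]
  · rw [globalTest, Set.indicator_of_notMem (SetLike.mem_coe.not.mpr hv),
      Set.indicator_of_notMem]
    exact fun h' => hv ((add_mem_cancel_right hl).mp h')

theorem nsmul_mem_ratPoints_iff (he : L = Submodule.span ℤ (Set.range e)) {n : ℕ}
    (hn : n.Coprime p) (v : V) : (n : ℚ) • v ∈ ratPoints p L ↔ v ∈ ratPoints p L := by
  simp only [mem_ratPoints_iff he, map_smul, Finsupp.smul_apply, smul_eq_mul, Rat.cast_mul,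
    Rat.cast_natCast, norm_mul, padic_norm_natCast_eq_one hn, one_mul]

/-- A point `v` with `f' v ≠ 0` may lie outside `L_p`. It is replaced by `p ^ k v` with `k` large
and `p ^ k ≡ 1` modulo `N B`, where `B` clears the denominators of `v` away from `p`: this lies in
`L_p` and differs from `v` by a period of `f'`. -/
theorem IsLevel.exists_globalTest_ne_zero {N : ℕ} (hN : IsLevel p e f' N)
    (he : L = Submodule.span ℤ (Set.range e)) (hf'0 : f' ≠ 0) :
    ∃ v, globalTest p L f' v ≠ 0 := by
  obtain ⟨v, hv⟩ := Function.ne_iff.mp hf'0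
  obtain ⟨B, a, hB0, hBp, hB, ha⟩ := exists_denominator p e v
  obtain ⟨k, hak, hk⟩ := exists_pow_modEq_one (hN.coprime.mul_left hBp)
    (mul_ne_zero hN.ne_zero hB0) a
  have hpos : 1 ≤ p ^ k := Nat.one_le_pow _ _ (Fact.out : p.Prime).pos
  obtain ⟨t, ht⟩ : N * B ∣ p ^ k - 1 := (Nat.modEq_iff_dvd' hpos).mp hk.symm
  have ht' : ((p ^ k : ℕ) : ℚ) = 1 + N * (B * t) := by
    have : p ^ k = 1 + N * (B * t) := by rw [← mul_assoc, ← ht]; omega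
    exact_mod_cast this
  have hper : f' (v + ((N * (B * t) : ℕ) : ℚ) • v) = f' v := by
    refine hN.periodic _ _ fun q i => ?_
    rw [map_smul, Finsupp.smul_apply, smul_eq_mul, Rat.cast_mul, Rat.cast_natCast, Nat.cast_mul,
      mul_assoc, norm_mul, Nat.cast_mul, mul_right_comm, norm_mul]
    exact mul_le_of_le_one_right (norm_nonneg _)
      (mul_le_one₀ (hB q i) (norm_nonneg _) (padic_norm_natCast_le_one _ t))
  have hmem : v + ((N * (B * t) : ℕ) : ℚ) • v ∈ ratPoints p L := by
    have h1 : v + ((N * (B * t) : ℕ) : ℚ) • v = ((p ^ k : ℕ) : ℚ) • v := by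
      rw [ht', add_smul, one_smul]
      push_cast
      rfl
    rw [h1, mem_ratPoints_iff he]
    intro i
    rw [map_smul, Finsupp.smul_apply, smul_eq_mul, Rat.cast_mul, Rat.cast_natCast,
      ← Nat.sub_add_cancel hak, pow_add, Nat.cast_mul, mul_assoc, norm_mul]
    exact mul_le_one₀ (padic_norm_natCast_le_one _ _) (norm_nonneg _) (ha i)
  exact ⟨v + ((N * (B * t) : ℕ) : ℚ) • v, by rwa [globalTest_of_mem hmem, hper]⟩

/-- For `v ∈ L_p` a multiple `N B v`, with `N B` prime to `p`, is a period of `f' ⊗ [L_p]`. So `v₀`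
and `v₀ + N B v` both lie in its support, and so do their images under `γ`. The difference `N B γ v`
of the images is then in `L_p`, and `N B` is a unit at `p`. -/
theorem IsLevel.map_mem_ratPoints {N : ℕ} (hN : IsLevel p e f' N)
    (he : L = Submodule.span ℤ (Set.range e)) (hf'0 : f' ≠ 0) (γ : stabilizer p L f') {v : V}
    (hv : v ∈ ratPoints p L) : (γ : V ≃ₗ[ℚ] V) v ∈ ratPoints p L := by
  obtain ⟨v₀, hv₀⟩ := hN.exists_globalTest_ne_zero he hf'0
  obtain ⟨B, -, hB0, hBp, hB, -⟩ := exists_denominator p e v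
  have hγ : ∀ v, globalTest p L f' ((γ : V ≃ₗ[ℚ] V) v) = globalTest p L f' v := γ.2
  have hmem : ((N * B : ℕ) : ℚ) • v ∈ ratPoints p L :=
    (nsmul_mem_ratPoints_iff he (hN.coprime.mul_left hBp) v).mpr hv
  have hper : globalTest p L f' (v₀ + ((N * B : ℕ) : ℚ) • v) = globalTest p L f' v₀ := by
    refine globalTest_add_of_mem hmem (hN.periodic _ _ fun q i => ?_)
    rw [map_smul, Finsupp.smul_apply, smul_eq_mul, Rat.cast_mul, Rat.cast_natCast, Nat.cast_mul,
      mul_assoc, norm_mul]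
    exact mul_le_of_le_one_right (norm_nonneg _) (hB q i)
  have h1 : (γ : V ≃ₗ[ℚ] V) v₀ ∈ ratPoints p L :=
    mem_ratPoints_of_globalTest_ne_zero (f' := f') (by rwa [hγ])
  have h2 : (γ : V ≃ₗ[ℚ] V) (v₀ + ((N * B : ℕ) : ℚ) • v) ∈ ratPoints p L :=
    mem_ratPoints_of_globalTest_ne_zero (f' := f') (by rwa [hγ, hper])
  rw [map_add, map_smul, add_mem_cancel_left h1] at h2
  exact (nsmul_mem_ratPoints_iff he (hN.coprime.mul_left hBp) _).mp h2

/-- Every element of the stabiliser preserves `L_p`. -/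
theorem IsLevel.preservesLattice {N : ℕ} (hN : IsLevel p e f' N)
    (he : L = Submodule.span ℤ (Set.range e)) (hf'0 : f' ≠ 0) (γ : stabilizer p L f') :
    PreservesLattice p L (γ : V ≃ₗ[ℚ] V) := by
  intro x hx
  induction hx using Submodule.span_induction with
  | mem x hx =>
    obtain ⟨l, hl, rfl⟩ := hx
    have h1 : l ∈ ratPoints p L := Submodule.subset_span ⟨l, hl, rfl⟩
    have h2 : (1 : ℚ_[p]) ⊗ₜ[ℚ] (γ : V ≃ₗ[ℚ] V) l ∈ localLattice p L :=
      hN.map_mem_ratPoints he hf'0 γ h1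
    simpa [localMap] using h2
  | zero => rw [map_zero]; exact zero_mem _
  | add x y _ _ hx hy => rw [map_add]; exact add_mem hx hy
  | smul a x _ hx =>
    rw [← algebraMap_smul ℚ_[p] a x, map_smul, algebraMap_smul]
    exact Submodule.smul_mem _ _ hx

/-- The automorphism of `V ∩ L_p` induced by an element of the stabiliser. -/
def IsLevel.ratPointsEquiv {N : ℕ} (hN : IsLevel p e f' N)
    (he : L = Submodule.span ℤ (Set.range e)) (hf'0 : f' ≠ 0) (γ : stabilizer p L f') :
    ratPoints p L ≃+ ratPoints p L where
  toFun v := ⟨(γ : V ≃ₗ[ℚ] V) v, hN.map_mem_ratPoints he hf'0 γ v.2⟩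
  invFun v := ⟨((γ⁻¹ : stabilizer p L f') : V ≃ₗ[ℚ] V) v,
    hN.map_mem_ratPoints he hf'0 γ⁻¹ v.2⟩
  left_inv v := Subtype.ext ((γ : V ≃ₗ[ℚ] V).symm_apply_apply v)
  right_inv v := Subtype.ext ((γ : V ≃ₗ[ℚ] V).apply_symm_apply v)
  map_add' v v' := Subtype.ext (map_add (γ : V ≃ₗ[ℚ] V) (v : V) v')

/-- Integrality is checked prime by prime: at `p` it comes from `L_p`, elsewhere from the level. -/
theorem IsLevel.exists_int {N : ℕ} (hN : IsLevel p e f' N)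
    (he : L = Submodule.span ℤ (Set.range e)) {v : V} (hv : globalTest p L f' v ≠ 0)
    (i : Fin 2) : ∃ n : ℤ, (N : ℚ) * e.repr v i = n := by
  refine exists_int_eq_of_padic_norm_le_one fun q hq => ?_
  rw [Rat.cast_mul, Rat.cast_natCast]
  by_cases hqp : q = p
  · subst hqp
    rw [norm_mul]
    exact mul_le_one₀ (padic_norm_natCast_le_one _ _) (norm_nonneg _)
      ((mem_ratPoints_iff he v).mp (mem_ratPoints_of_globalTest_ne_zero hv) i)
  · exact hN.support v (ne_zero_of_globalTest_ne_zero hv) ⟨q, hq.out, hqp⟩ i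

/-- The support of a test function is discrete. -/
theorem IsLevel.finite_support_inter {N : ℕ} (hN : IsLevel p e f' N)
    (he : L = Submodule.span ℤ (Set.range e)) (v₁ v₂ : V) (C : ℚ) :
    {v | globalTest p L f' v ≠ 0 ∧
      ∃ t₁ t₂ : ℚ, |t₁| ≤ C ∧ |t₂| ≤ C ∧ v = t₁ • v₁ + t₂ • v₂}.Finite := by
  let B : Fin 2 → ℚ := fun i => N * (C * |e.repr v₁ i| + C * |e.repr v₂ i|)
  -- On the support the numbers `N * e.repr v i` are already integers, so taking floors loses
  -- nothing and embeds the set into a box of `ℤ²`.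
  refine Set.Finite.of_injOn (f := fun v i => ⌊(N : ℚ) * e.repr v i⌋)
    (t := Set.Icc (fun i => -⌈B i⌉) fun i => ⌈B i⌉) ?_ ?_ (Set.finite_Icc _ _)
  · rintro v ⟨hv, t₁, t₂, ht₁, ht₂, rfl⟩
    have h : ∀ i, |⌊(N : ℚ) * e.repr (t₁ • v₁ + t₂ • v₂) i⌋| ≤ ⌈B i⌉ := by
      intro i
      obtain ⟨n, hn⟩ := hN.exists_int he hv i
      rw [hn, Int.floor_intCast]
      have h1 : ((|n| : ℤ) : ℚ) ≤ B i := by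
        rw [Int.cast_abs, ← hn, map_add, map_smul, map_smul, Finsupp.add_apply,
          Finsupp.smul_apply, Finsupp.smul_apply, smul_eq_mul, smul_eq_mul, abs_mul, Nat.abs_cast]
        refine mul_le_mul_of_nonneg_left ((abs_add_le _ _).trans ?_) (Nat.cast_nonneg _)
        rw [abs_mul, abs_mul]
        gcongr
      exact_mod_cast h1.trans (Int.le_ceil _)
    exact ⟨fun i => (abs_le.mp (h i)).1, fun i => (abs_le.mp (h i)).2⟩
  · rintro v ⟨hv, -⟩ v' ⟨hv', -⟩ hvv
    refine e.repr.injective (Finsupp.ext fun i => ?_)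
    obtain ⟨n, hn⟩ := hN.exists_int he hv i
    obtain ⟨n', hn'⟩ := hN.exists_int he hv' i
    have h1 := congrFun hvv i
    simp only [hn, hn', Int.floor_intCast] at h1
    rw [h1, ← hn'] at hn
    exact mul_left_cancel₀ (Nat.cast_ne_zero.mpr hN.ne_zero) hn

/-! ### Consequences of the Vanishing Hypothesis -/

theorem sum_range_mul_of_periodic {F : ℕ → ℤ} {m : ℕ} (hF : Function.Periodic F m) (n : ℕ) :
    ∑ i ∈ Finset.range (m * n), F i = n * ∑ i ∈ Finset.range m, F i := by
  induction n with
  | zero => simp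
  | succ n ih =>
    rw [Nat.mul_succ, Finset.sum_range_add, ih]
    have : ∀ i, F (m * n + i) = F i := fun i => by
      rw [add_comm, mul_comm]
      exact hF.nat_mul n i
    simp only [this]
    push_cast
    ring

theorem sum_range_add_of_periodic {F : ℕ → ℤ} {m : ℕ} (hF : Function.Periodic F m) (a : ℕ) :
    ∑ i ∈ Finset.range m, F (a + i) = ∑ i ∈ Finset.range m, F i := by
  induction a with
  | zero => simp
  | succ a ih =>
    rw [← ih]
    have h1 := Finset.sum_range_succ (fun i => F (a + i)) m
    have h2 := Finset.sum_range_succ' (fun i => F (a + i)) m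
    have h3 : ∀ i, F (a + 1 + i) = F (a + (i + 1)) := fun i => by ring_nf
    simp only [h3]
    rw [h1, add_zero, hF a] at h2
    exact (add_right_cancel h2).symm

/-- A test function on `ℚ` of Haar measure zero which is supported in `Q⁻¹ ℤ` sums to zero over
any period. -/
theorem sum_eq_zero_of_haarRat_eq_zero {G : ℚ → ℤ} {P Q : ℕ} (hP : P ≠ 0) (hQ : Q ≠ 0)
    (hper : ∀ x, G (x + P) = G x) (hsupp : ∀ x, G x ≠ 0 → ∃ n : ℤ, (Q : ℚ) * x = n)
    (h : haarRat G = 0) : ∑ i ∈ Finset.range (P * Q), G (i / Q) = 0 := by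
  have hQ' : (Q : ℚ) ≠ 0 := Nat.cast_ne_zero.mpr hQ
  have hex : ∃ N : ℕ, 0 < N ∧ ∀ x, G (x + N) = G x := ⟨P, Nat.pos_of_ne_zero hP, hper⟩
  rw [haarRat, dif_pos hex] at h
  obtain ⟨hK, hKper⟩ := hex.choose_spec
  -- The period `K` in the definition of `haarRat` is an arbitrary choice, to be compared with the
  -- given period `P`.
  generalize hex.choose = K at h hK hKper
  have hK' : (0 : ℚ) < K := by exact_mod_cast hK
  have h0 : ∑ᶠ x ∈ Set.Ico (0 : ℚ) K, G x = 0 := by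
    rcases mul_eq_zero.mp h with h | h
    · exact absurd h (by positivity)
    · exact_mod_cast h
  have h1 : ∑ i ∈ Finset.range (K * Q), G (i / Q) = 0 := by
    rw [← h0, ← finsum_mem_coe_finset,
      ← finsum_mem_image (f := G) (g := fun i : ℕ => (i / Q : ℚ))
        (fun i _ j _ hij => by
          have := (div_left_inj' hQ').mp hij
          exact_mod_cast this)]
    refine finsum_mem_inter_support_eq' G _ _ fun x hx => ?_
    obtain ⟨n, hn⟩ := hsupp x hx
    have hx' : x = n / Q := by rw [← hn, mul_div_cancel_left₀ _ hQ']
    constructor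
    · rintro ⟨i, hi, rfl⟩
      have hi' : i < K * Q := by simpa using hi
      refine ⟨by positivity, ?_⟩
      rw [div_lt_iff₀ (by positivity)]
      exact_mod_cast hi'
    · rintro ⟨hx0, hxK⟩
      have hQp : (0 : ℚ) < Q := by positivity
      have hn0 : 0 ≤ n := by
        have : (0 : ℚ) ≤ n := by rw [← hn]; positivity
        exact_mod_cast this
      lift n to ℕ using hn0
      refine ⟨n, ?_, by simpa using hx'.symm⟩
      rw [hx', div_lt_iff₀ hQp] at hxK
      have : n < K * Q := by exact_mod_cast hxK
      simpa using this
  have hFP : Function.Periodic (fun i : ℕ => G (i / Q)) (P * Q) := fun i => by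
    change G (((i + P * Q : ℕ) : ℚ) / Q) = G (i / Q)
    rw [← hper (i / Q)]
    congr 1
    push_cast
    field_simp
  have hFK : Function.Periodic (fun i : ℕ => G (i / Q)) (K * Q) := fun i => by
    change G (((i + K * Q : ℕ) : ℚ) / Q) = G (i / Q)
    rw [← hKper (i / Q)]
    congr 1
    push_cast
    field_simp
  -- The sum over `K * Q * P` terms is evaluated through both periods: `P` copies of a vanishing
  -- sum, and `K` copies of the wanted one.
  have h2 := sum_range_mul_of_periodic hFK P
  have h3 := sum_range_mul_of_periodic hFP K
  rw [h1, mul_zero, show K * Q * P = P * Q * K by ring, h3] at h2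
  exact (mul_eq_zero.mp h2).resolve_left (by exact_mod_cast hK.ne')

end Levels

end PadicShintani

/-! ### The Vanishing Hypothesis along arithmetic progressions -/

namespace PadicShintani

section Vanishing

variable {p : ℕ} [Fact p.Prime] {V : Type*} [AddCommGroup V] [Module ℚ V] {L : Submodule ℤ V}
  {e : Module.Basis (Fin 2) ℚ V} {f' : V → ℤ}

/-- The points at which a line in the direction `w` meets the support of `f'`. -/
theorem IsLevel.exists_line_level {N : ℕ} (hN : IsLevel p e f' N) {w : V} (hw : w ≠ 0) :
    ∃ Q : ℕ, Q ≠ 0 ∧ Q.Coprime p ∧ ∀ (v : V) (x : ℚ), f' v ≠ 0 → f' (v + x • w) ≠ 0 →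
      ‖(x : ℚ_[p])‖ ≤ 1 → ∃ n : ℤ, (Q : ℚ) * x = n := by
  obtain ⟨j, hj⟩ : ∃ j, e.repr w j ≠ 0 := by
    by_contra! h
    exact hw (e.repr.map_eq_zero_iff.mp (Finsupp.ext h))
  obtain ⟨c, A, hA, hAp, hA0⟩ := exists_eq_pow_mul_coprime p
    (Int.natAbs_ne_zero.mpr (Rat.num_ne_zero.mpr hj))
  -- `A` is the prime-to-`p` part of the numerator of a nonzero coordinate of `w`. At `q ≠ p` the
  -- level bounds `N x w_j`, and `A` has the same norm as `w_j` times its denominator.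
  refine ⟨N * A, mul_ne_zero hN.ne_zero hA0, hN.coprime.mul_left hAp, fun v x hv hvx hx => ?_⟩
  refine exists_int_eq_of_padic_norm_le_one fun q hq => ?_
  by_cases hqp : q = p
  · subst hqp
    rw [Rat.cast_mul, Rat.cast_natCast, norm_mul]
    exact mul_le_one₀ (padic_norm_natCast_le_one _ _) (norm_nonneg _) hx
  let r : PrimesAway p := ⟨q, hq.out, hqp⟩
  have h1 : ‖(N : ℚ_[q]) * (e.repr v j : ℚ_[q])‖ ≤ 1 := hN.support v hv r j
  have h2 : ‖(N : ℚ_[q]) * (e.repr (v + x • w) j : ℚ_[q])‖ ≤ 1 := hN.support _ hvx r j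
  have h3 : ‖(N : ℚ_[q]) * ((x : ℚ_[q]) * (e.repr w j : ℚ_[q]))‖ ≤ 1 := by
    have h4 : (N : ℚ_[q]) * ((x : ℚ_[q]) * (e.repr w j : ℚ_[q])) =
        (N : ℚ_[q]) * (e.repr (v + x • w) j : ℚ_[q]) + -((N : ℚ_[q]) * (e.repr v j : ℚ_[q])) := by
      rw [map_add, map_smul, Finsupp.add_apply, Finsupp.smul_apply, smul_eq_mul, Rat.cast_add,
        Rat.cast_mul]
      ring
    rw [h4]
    exact (Padic.nonarchimedean _ _).trans (max_le h2 (by rwa [norm_neg]))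
  have hnum : ‖(A : ℚ_[q])‖ = ‖((e.repr w j).num : ℚ_[q])‖ := by
    have h5 : ‖(((e.repr w j).num.natAbs : ℕ) : ℚ_[q])‖ = ‖((e.repr w j).num : ℚ_[q])‖ := by
      rcases Int.natAbs_eq (e.repr w j).num with h | h
      · conv_rhs => rw [h]
        rw [Int.cast_natCast]
      · conv_rhs => rw [h]
        rw [Int.cast_neg, Int.cast_natCast, norm_neg]
    rw [← h5, hA, Nat.cast_mul, norm_mul]
    have := padic_norm_pow_eq_one r c
    rw [show ‖((p ^ c : ℕ) : ℚ_[q])‖ = 1 from this, one_mul]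
  have hnum' : ((e.repr w j).num : ℚ_[q]) = (e.repr w j : ℚ_[q]) * ((e.repr w j).den : ℚ_[q]) := by
    rw [← Rat.cast_natCast, ← Rat.cast_mul, Rat.mul_den_eq_num, Rat.cast_intCast]
  calc ‖(((N * A : ℕ) : ℚ) * x : ℚ_[q])‖
      = ‖(N : ℚ_[q]) * ((x : ℚ_[q]) * (e.repr w j : ℚ_[q]))‖ * ‖((e.repr w j).den : ℚ_[q])‖ := by
        push_cast
        rw [norm_mul, norm_mul, hnum, hnum']
        simp only [norm_mul]
        ring
    _ ≤ 1 := mul_le_one₀ h3 (norm_nonneg _) (padic_norm_natCast_le_one _ _)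

/-- The Vanishing Hypothesis for `w` in terms of a positive multiple of `w` in `L_p`. -/
theorem IsLevel.exists_sum_eq_zero {N : ℕ} (hN : IsLevel p e f' N)
    (he : L = Submodule.span ℤ (Set.range e)) {w : V} (hw : w ≠ 0)
    (hvan : VanishingHypothesis p f' w) :
    ∃ (c : ℚ) (M : ℕ), 0 < c ∧ M ≠ 0 ∧ M.Coprime p ∧ c • w ∈ ratPoints p L ∧
      ∀ v, ∑ i ∈ Finset.range M, globalTest p L f' (v - i • c • w) = 0 := by
  obtain ⟨Q, hQ0, hQp, hQ⟩ := hN.exists_line_level hw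
  obtain ⟨B, a, hB0, hBp, hB, ha⟩ := exists_denominator p e w
  have hQ' : (Q : ℚ) ≠ 0 := Nat.cast_ne_zero.mpr hQ0
  let P := N * B
  have hP0 : P ≠ 0 := mul_ne_zero hN.ne_zero hB0
  have hPp : P.Coprime p := hN.coprime.mul_left hBp
  have hper : ∀ v, f' (v + (P : ℚ) • w) = f' v := fun v => by
    refine hN.periodic _ _ fun q i => ?_
    rw [map_smul, Finsupp.smul_apply, smul_eq_mul, Rat.cast_mul, Rat.cast_natCast, Nat.cast_mul,
      mul_assoc, norm_mul]
    exact mul_le_of_le_one_right (norm_nonneg _) (hB q i)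
  have hF : ∀ v, Function.Periodic (fun i : ℕ => f' (v + ((i : ℚ) / Q) • w)) (P * Q) := fun v i => by
    change f' _ = f' _
    rw [← hper (v + ((i : ℚ) / Q) • w), add_assoc, ← add_smul]
    congr 3
    push_cast
    field_simp
  have hnorm : ∀ i : ℕ, ‖(((i : ℚ) / Q : ℚ) : ℚ_[p])‖ ≤ 1 := fun i => by
    rw [Rat.cast_div, Rat.cast_natCast, Rat.cast_natCast, norm_div,
      padic_norm_natCast_eq_one hQp, div_one]
    exact padic_norm_natCast_le_one _ _
  -- With base point in the support of `f'`, the restriction to the line is supported in `Q⁻¹ ℤ`, so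
  -- its Haar measure is a finite sum over `(1/Q)ℤ` modulo `P`.
  have hsum₀ : ∀ v, f' v ≠ 0 →
      ∑ i ∈ Finset.range (P * Q), f' (v + ((i : ℚ) / Q) • w) = 0 := by
    intro v hv
    have h1 := sum_eq_zero_of_haarRat_eq_zero (P := P) (Q := Q) hP0 hQ0 (fun x => ?_)
      (fun x hx => ?_) (hvan v)
    · rw [← h1]
      exact Finset.sum_congr rfl fun i _ => (Set.indicator_of_mem
        (s := {x : ℚ | ‖(x : ℚ_[p])‖ ≤ 1}) (hnorm i) fun x => f' (v + x • w)).symm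
    · have hPn : ‖((P : ℚ) : ℚ_[p])‖ ≤ 1 := by
        rw [Rat.cast_natCast]; exact padic_norm_natCast_le_one _ _
      have hx : ‖((x + P : ℚ) : ℚ_[p])‖ ≤ 1 ↔ ‖(x : ℚ_[p])‖ ≤ 1 := by
        constructor
        · intro h
          have h2 : (x : ℚ_[p]) = ((x + P : ℚ) : ℚ_[p]) + -((P : ℚ) : ℚ_[p]) := by push_cast; ring
          rw [h2]
          exact (Padic.nonarchimedean _ _).trans (max_le h (by rwa [norm_neg]))
        · intro h
          rw [Rat.cast_add]
          exact (Padic.nonarchimedean _ _).trans (max_le h hPn)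
      by_cases h : ‖(x : ℚ_[p])‖ ≤ 1
      · rw [Set.indicator_of_mem (s := {x : ℚ | ‖(x : ℚ_[p])‖ ≤ 1}) (hx.mpr h),
          Set.indicator_of_mem (s := {x : ℚ | ‖(x : ℚ_[p])‖ ≤ 1}) h, add_smul, ← add_assoc, hper]
      · rw [Set.indicator_of_notMem (s := {x : ℚ | ‖(x : ℚ_[p])‖ ≤ 1}) fun h' => h (hx.mp h'),
          Set.indicator_of_notMem (s := {x : ℚ | ‖(x : ℚ_[p])‖ ≤ 1}) h]
    · rw [Set.indicator_apply_ne_zero] at hx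
      exact hQ v x hv hx.2 hx.1
  -- If the progression meets the support it is recentred there, which does not change a sum over a
  -- full period.
  have hsum : ∀ v, ∑ i ∈ Finset.range (P * Q), f' (v + ((i : ℚ) / Q) • w) = 0 := by
    intro v
    by_cases h : ∀ i : ℕ, f' (v + ((i : ℚ) / Q) • w) = 0
    · exact Finset.sum_eq_zero fun i _ => h i
    · push Not at h
      obtain ⟨a, ha⟩ := h
      rw [← sum_range_add_of_periodic (hF v) a, ← hsum₀ _ ha]
      refine Finset.sum_congr rfl fun i _ => ?_
      rw [add_assoc, ← add_smul]
      push_cast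
      rw [add_div]
  have hM0 : P * Q ≠ 0 := mul_ne_zero hP0 hQ0
  have hMp : (P * Q).Coprime p := hPp.mul_left hQp
  obtain ⟨k, hak, hk⟩ := exists_pow_modEq_one hMp hM0 a
  -- The step `1 / Q` is multiplied by a power of `p` to bring `c • w` into `L_p`. As `p ^ k ≡ 1`
  -- modulo the period `P * Q`, each term of the sum keeps its value.
  let c : ℚ := ((p ^ k : ℕ) : ℚ) / Q
  have hcw : c • w ∈ ratPoints p L := by
    rw [← nsmul_mem_ratPoints_iff he hQp, smul_smul, mul_div_cancel₀ _ hQ', mem_ratPoints_iff he]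
    intro i
    rw [map_smul, Finsupp.smul_apply, smul_eq_mul, Rat.cast_mul, Rat.cast_natCast,
      ← Nat.sub_add_cancel hak, pow_add, Nat.cast_mul, mul_assoc, norm_mul]
    exact mul_le_one₀ (padic_norm_natCast_le_one _ _) (norm_nonneg _) (ha i)
  have hsum' : ∀ v, ∑ i ∈ Finset.range (P * Q), globalTest p L f' (v + i • c • w) = 0 := by
    intro v
    by_cases hv : v ∈ ratPoints p L
    · rw [← hsum v]
      refine Finset.sum_congr rfl fun i _ => ?_
      rw [globalTest_of_mem (add_mem hv (nsmul_mem hcw i))]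
      have h1 := (hF v).map_mod_nat (i * p ^ k)
      have h2 := (hF v).map_mod_nat i
      have h3 : i * p ^ k % (P * Q) = i % (P * Q) := by
        have h4 := hk.mul_left i
        rwa [mul_one] at h4
      rw [h3, h2] at h1
      rw [h1, ← Nat.cast_smul_eq_nsmul ℚ, smul_smul]
      congr 3
      simp only [c]
      push_cast
      ring
    · refine Finset.sum_eq_zero fun i _ => Set.indicator_of_notMem (fun h => hv ?_) _
      exact (add_mem_cancel_right (nsmul_mem hcw i)).mp h
  refine ⟨c, P * Q, ?_, hM0, hMp, hcw, fun v => ?_⟩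
  · have := (Fact.out : p.Prime).pos
    positivity
  -- Reversing the order of summation turns steps `+c w` from `v - (P Q - 1) c w` into steps `-c w`
  -- from `v`.
  · rw [← Finset.sum_range_reflect, ← hsum' (v - (P * Q - 1) • c • w)]
    refine Finset.sum_congr rfl fun i hi => ?_
    have hi' := Finset.mem_range.mp hi
    have h1 : (P * Q - 1) • c • w = (P * Q - 1 - i) • c • w + i • c • w := by
      rw [← add_nsmul]
      congr 1
      omega
    rw [h1]
    congr 1
    abel

end Vanishing

end PadicShintani

/-! ### Signs in Hill's field and Hill's cone as a sign condition -/

theorem HahnSeries.leadingCoeff_C_add_single_one {R : Type*} [Semiring R] (a b : R)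
    [Decidable (a = 0)] :
    (HahnSeries.C a + HahnSeries.single 1 b : LaurentSeries R).leadingCoeff =
      if a = 0 then b else a := by
  split_ifs with ha
  · rw [ha, map_zero, zero_add, HahnSeries.leadingCoeff_of_single]
  · rw [HahnSeries.leadingCoeff_add_eq_left, HahnSeries.C_apply, HahnSeries.leadingCoeff_of_single]
    rw [HahnSeries.C_apply, HahnSeries.orderTop_single ha]
    by_cases hb : b = 0
    · rw [hb, map_zero, HahnSeries.orderTop_zero]
      exact WithTop.coe_lt_top 0
    · rw [HahnSeries.orderTop_single hb]
      exact_mod_cast zero_lt_one (α := ℤ)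

namespace PadicShintani

section Hill

/-- The sign of `a + ε b` for an infinitesimal `ε > 0`. -/
def lexSign (a b : ℚ) : SignType := if a = 0 then SignType.sign b else SignType.sign a

theorem lexSign_mul (c a b : ℚ) : lexSign (c * a) (c * b) = SignType.sign c * lexSign a b := by
  by_cases hc : c = 0
  · simp [hc, lexSign]
  · by_cases ha : a = 0 <;> simp [lexSign, ha, hc, sign_mul]

theorem lexSign_ne_zero {a b : ℚ} (h : ¬ (a = 0 ∧ b = 0)) : lexSign a b ≠ 0 := by
  rw [lexSign]
  split_ifs with ha
  · exact sign_ne_zero.mpr fun hb => h ⟨ha, hb⟩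
  · exact sign_ne_zero.mpr ha

theorem signType_cast_injective {s t : SignType} (h : (s : ℤ) = t) : s = t := by
  revert s t; decide

/-- `hillSign` as a sign. -/
noncomputable def hillSignType (x : HillField) : SignType :=
  SignType.sign
    (HahnSeries.leadingCoeff (show LaurentSeries (LaurentSeries ℚ) from x)).leadingCoeff

theorem hillSign_eq (x : HillField) : hillSign x = hillSignType x := rfl

theorem hillSignType_mul (x y : HillField) :
    hillSignType (x * y) = hillSignType x * hillSignType y := by
  have h : HahnSeries.leadingCoeff (show LaurentSeries (LaurentSeries ℚ) from x * y) =
      HahnSeries.leadingCoeff (show LaurentSeries (LaurentSeries ℚ) from x) *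
        HahnSeries.leadingCoeff (show LaurentSeries (LaurentSeries ℚ) from y) :=
    HahnSeries.leadingCoeff_mul (Γ := ℤ) (R := LaurentSeries ℚ) x y
  rw [hillSignType, h, HahnSeries.leadingCoeff_mul, sign_mul]
  rfl

theorem hillSignType_eq_zero {x : HillField} : hillSignType x = 0 ↔ x = 0 := by
  rw [hillSignType, sign_eq_zero_iff, HahnSeries.leadingCoeff_eq_zero,
    HahnSeries.leadingCoeff_eq_zero]
  rfl

/-- The field `𝔽` as a field of iterated Laurent series. -/
noncomputable def ofLaurentSeries : LaurentSeries (LaurentSeries ℚ) →+* HillField :=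
  RingHom.id (LaurentSeries (LaurentSeries ℚ))

theorem algebraMap_hillField (a : ℚ) :
    algebraMap ℚ HillField a = ofLaurentSeries (HahnSeries.C (HahnSeries.C a)) := rfl

theorem eps_zero : eps 0 = ofLaurentSeries (HahnSeries.C (HahnSeries.single 1 1)) := rfl

theorem eps_one : eps 1 = ofLaurentSeries (HahnSeries.single 1 1) := rfl

theorem hillSignType_ofLaurentSeries (P Q : LaurentSeries ℚ) :
    hillSignType (ofLaurentSeries (HahnSeries.C P + HahnSeries.single 1 1 * HahnSeries.C Q)) =
      SignType.sign (if P.leadingCoeff = 0 then Q.leadingCoeff else P.leadingCoeff) := by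
  classical
  have h1 : HahnSeries.single 1 1 * HahnSeries.C Q =
      (HahnSeries.single 1 Q : LaurentSeries (LaurentSeries ℚ)) := by
    rw [HahnSeries.C_apply, HahnSeries.single_mul_single, add_zero, one_mul]
  have h2 := HahnSeries.leadingCoeff_C_add_single_one P Q
  rw [h1]
  refine congrArg SignType.sign ((congrArg HahnSeries.leadingCoeff h2).trans ?_)
  simp only [HahnSeries.leadingCoeff_eq_zero]
  split_ifs <;> rfl

theorem leadingCoeff_C_add (a b : ℚ) :
    (HahnSeries.C a + HahnSeries.single 1 1 * HahnSeries.C b : LaurentSeries ℚ).leadingCoeff =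
      if a = 0 then b else a := by
  rw [← HahnSeries.leadingCoeff_C_add_single_one, HahnSeries.C_apply b,
    HahnSeries.single_mul_single, add_zero, one_mul]

/-- The determinant of `α₁ b₁, α₂ b₂` has this shape. Since `a + ε₁ b` is nonzero, it dominates
every term divisible by `ε₂`, and `c, d` play no role. -/
theorem hillSignType_bilinear {a b : ℚ} (c d : ℚ) (h : ¬ (a = 0 ∧ b = 0)) :
    hillSignType (algebraMap ℚ HillField a + eps 0 * algebraMap ℚ HillField b +
      eps 1 * (algebraMap ℚ HillField c + eps 0 * algebraMap ℚ HillField d)) = lexSign a b := by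
  simp only [algebraMap_hillField, eps_zero, eps_one, ← map_mul, ← map_add]
  rw [hillSignType_ofLaurentSeries, leadingCoeff_C_add, leadingCoeff_C_add, lexSign]
  by_cases ha : a = 0
  · have hb : b ≠ 0 := fun hb => h ⟨ha, hb⟩
    simp [ha, hb]
  · simp [ha]

theorem hillSignType_zero (a b : ℚ) :
    hillSignType (algebraMap ℚ HillField a + eps 0 * algebraMap ℚ HillField b) = lexSign a b := by
  by_cases h : a = 0 ∧ b = 0
  · rw [h.1, h.2, map_zero, mul_zero, add_zero, hillSignType_eq_zero.mpr rfl]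
    simp [lexSign]
  · have := hillSignType_bilinear 0 0 h
    rwa [map_zero, mul_zero, add_zero, mul_zero, add_zero] at this

theorem hillSignType_one (a b : ℚ) :
    hillSignType (algebraMap ℚ HillField a + eps 1 * algebraMap ℚ HillField b) = lexSign a b := by
  simp only [algebraMap_hillField, eps_one, ← map_mul, ← map_add]
  rw [hillSignType_ofLaurentSeries, HahnSeries.C_apply, HahnSeries.C_apply,
    HahnSeries.leadingCoeff_of_single, HahnSeries.leadingCoeff_of_single, lexSign]
  split_ifs <;> rfl

theorem hillSignType_eps (i : Fin 2) (a b : ℚ) :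
    hillSignType (algebraMap ℚ HillField a + eps i * algebraMap ℚ HillField b) = lexSign a b := by
  fin_cases i
  exacts [hillSignType_zero a b, hillSignType_one a b]

/-! ### Determinants in the plane -/

theorem Basis.det_fin_two {K W : Type*} [Field K] [AddCommGroup W] [Module K W]
    (b : Module.Basis (Fin 2) K W) (x y : W) :
    b.det ![x, y] = b.repr x 0 * b.repr y 1 - b.repr x 1 * b.repr y 0 := by
  rw [Module.Basis.det_apply, Matrix.det_fin_two]
  simp only [Module.Basis.toMatrix_apply, Matrix.cons_val_zero, Matrix.cons_val_one]
  ring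

/-- Cramer's rule, the source of all coordinates with respect to a pair of vectors. -/
theorem Basis.det_smul_eq {K W : Type*} [Field K] [AddCommGroup W] [Module K W]
    (b : Module.Basis (Fin 2) K W) (x y v : W) :
    b.det ![x, y] • v = b.det ![v, y] • x + b.det ![x, v] • y := by
  refine b.repr.injective (Finsupp.ext fun i => ?_)
  simp only [Basis.det_fin_two, map_add, map_smul, Finsupp.add_apply, Finsupp.smul_apply,
    smul_eq_mul]
  fin_cases i <;> simp <;> ring

theorem Basis.det_add_smul {K W : Type*} [Field K] [AddCommGroup W] [Module K W]
    (b : Module.Basis (Fin 2) K W) (x y z : W) (s t : K) :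
    b.det ![s • x + t • y, z] = s * b.det ![x, z] + t * b.det ![y, z] := by
  simp only [Basis.det_fin_two, map_add, map_smul, Finsupp.add_apply, Finsupp.smul_apply,
    smul_eq_mul]
  ring

theorem Basis.det_smul_left {K W : Type*} [Field K] [AddCommGroup W] [Module K W]
    (b : Module.Basis (Fin 2) K W) (x z : W) (s : K) : b.det ![s • x, z] = s * b.det ![x, z] := by
  simp only [Basis.det_fin_two, map_smul, Finsupp.smul_apply, smul_eq_mul]
  ring

theorem Basis.det_neg_left {K W : Type*} [Field K] [AddCommGroup W] [Module K W]
    (b : Module.Basis (Fin 2) K W) (x z : W) : b.det ![-x, z] = -b.det ![x, z] := by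
  rw [← neg_one_smul K x, Basis.det_smul_left, neg_one_mul]

theorem Basis.det_swap {K W : Type*} [Field K] [AddCommGroup W] [Module K W]
    (b : Module.Basis (Fin 2) K W) (x y : W) : b.det ![x, y] = -b.det ![y, x] := by
  simp only [Basis.det_fin_two]
  ring

theorem Basis.det_self {K W : Type*} [Field K] [AddCommGroup W] [Module K W]
    (b : Module.Basis (Fin 2) K W) (x : W) : b.det ![x, x] = 0 := by
  simp only [Basis.det_fin_two]
  ring

theorem Basis.det_map {K W : Type*} [Field K] [AddCommGroup W] [Module K W]
    (b : Module.Basis (Fin 2) K W) (α : W →ₗ[K] W) (x y : W) :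
    b.det ![α x, α y] = LinearMap.det α * b.det ![x, y] := by
  rw [← Module.Basis.det_comp]
  congr 1
  ext i
  fin_cases i <;> rfl

variable {V : Type*} [AddCommGroup V] [Module ℚ V] (w : Module.Basis (Fin 2) ℚ V)

theorem repr_deformed (α : V ≃ₗ[ℚ] V) (i j : Fin 2) :
    (w.baseChange HillField).repr (deformed w α i) j =
      algebraMap ℚ HillField (w.repr (α (w 0)) j) +
        eps i * algebraMap ℚ HillField (w.repr (α (w 1)) j) := by
  rw [deformed, map_add, map_add, LinearMap.baseChange_tmul, LinearMap.baseChange_tmul,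
    Finsupp.add_apply, Module.Basis.baseChange_repr_tmul, Module.Basis.baseChange_repr_tmul,
    Algebra.smul_def, Algebra.smul_def, mul_one, mul_comm (eps i)]
  rfl

theorem repr_one_tmul (v : V) (j : Fin 2) :
    (w.baseChange HillField).repr ((1 : HillField) ⊗ₜ[ℚ] v) j =
      algebraMap ℚ HillField (w.repr v j) := by
  rw [Module.Basis.baseChange_repr_tmul, Algebra.smul_def, mul_one]

theorem det_deformed (α₁ α₂ : V ≃ₗ[ℚ] V) :
    (w.baseChange HillField).det ![deformed w α₁ 0, deformed w α₂ 1] =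
      algebraMap ℚ HillField (w.det ![α₁ (w 0), α₂ (w 0)]) +
        eps 0 * algebraMap ℚ HillField (w.det ![α₁ (w 1), α₂ (w 0)]) +
      eps 1 * (algebraMap ℚ HillField (w.det ![α₁ (w 0), α₂ (w 1)]) +
        eps 0 * algebraMap ℚ HillField (w.det ![α₁ (w 1), α₂ (w 1)])) := by
  simp only [Basis.det_fin_two, repr_deformed, map_sub, map_mul]
  ring

theorem det_tmul_deformed (v : V) (α : V ≃ₗ[ℚ] V) (i : Fin 2) :
    (w.baseChange HillField).det ![(1 : HillField) ⊗ₜ[ℚ] v, deformed w α i] =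
      algebraMap ℚ HillField (w.det ![v, α (w 0)]) +
        eps i * algebraMap ℚ HillField (w.det ![v, α (w 1)]) := by
  simp only [Basis.det_fin_two, repr_deformed, repr_one_tmul, map_sub, map_mul]
  ring

/-- The side of `α(w₁ + ε w₂)` on which the vector `v` lies. -/
noncomputable def side (α : V ≃ₗ[ℚ] V) (v : V) : SignType :=
  lexSign (w.det ![v, α (w 0)]) (w.det ![v, α (w 1)])

/-- The orientation of the pair `α₁ b₁, α₂ b₂`. -/
noncomputable def orientation (α₁ α₂ : V ≃ₗ[ℚ] V) : SignType :=
  lexSign (w.det ![α₁ (w 0), α₂ (w 0)]) (w.det ![α₁ (w 1), α₂ (w 0)])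

theorem det_map_basis_ne_zero (α : V ≃ₗ[ℚ] V) : w.det ![α (w 0), α (w 1)] ≠ 0 := by
  have h := Basis.det_map w (α : V →ₗ[ℚ] V) (w 0) (w 1)
  simp only [LinearEquiv.coe_coe] at h
  rw [h]
  refine mul_ne_zero α.isUnit_det'.ne_zero ?_
  rw [Basis.det_fin_two]
  simp

/-- A vector which is parallel to both `α w₁` and `α w₂` is zero. -/
theorem eq_zero_of_det_eq_zero (α : V ≃ₗ[ℚ] V) {v : V} (h0 : w.det ![v, α (w 0)] = 0)
    (h1 : w.det ![v, α (w 1)] = 0) : v = 0 := by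
  have h := Basis.det_smul_eq w (α (w 0)) (α (w 1)) v
  rw [h1, Basis.det_swap w (α (w 0)) v, h0, neg_zero, zero_smul, zero_smul, add_zero] at h
  exact (smul_eq_zero.mp h).resolve_left (det_map_basis_ne_zero w α)

theorem side_ne_zero (α : V ≃ₗ[ℚ] V) {v : V} (hv : v ≠ 0) : side w α v ≠ 0 :=
  lexSign_ne_zero fun h => hv (eq_zero_of_det_eq_zero w α h.1 h.2)

theorem side_zero (α : V ≃ₗ[ℚ] V) : side w α 0 = 0 := by
  simp [side, lexSign, Basis.det_fin_two]

/-- Otherwise `α₂ w₁` would be parallel to both `α₁ w₁` and `α₁ w₂`. Hence the orientation is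
already decided by `ε₁`, even for dependent `α₁ w₁, α₂ w₁`. -/
theorem orientation_aux (α₁ α₂ : V ≃ₗ[ℚ] V) :
    ¬ (w.det ![α₁ (w 0), α₂ (w 0)] = 0 ∧ w.det ![α₁ (w 1), α₂ (w 0)] = 0) := by
  rintro ⟨h0, h1⟩
  rw [Basis.det_swap, neg_eq_zero] at h0 h1
  exact w.ne_zero 0 (α₂.map_eq_zero_iff.mp (eq_zero_of_det_eq_zero w α₁ h0 h1))

theorem orientation_ne_zero (α₁ α₂ : V ≃ₗ[ℚ] V) : orientation w α₁ α₂ ≠ 0 :=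
  lexSign_ne_zero (orientation_aux w α₁ α₂)

theorem hillSignType_det_deformed (α₁ α₂ : V ≃ₗ[ℚ] V) :
    hillSignType ((w.baseChange HillField).det ![deformed w α₁ 0, deformed w α₂ 1]) =
      orientation w α₁ α₂ := by
  rw [det_deformed, hillSignType_bilinear _ _ (orientation_aux w α₁ α₂), orientation]

theorem hillSignType_det_tmul_deformed (v : V) (α : V ≃ₗ[ℚ] V) (i : Fin 2) :
    hillSignType ((w.baseChange HillField).det ![(1 : HillField) ⊗ₜ[ℚ] v, deformed w α i]) =
      side w α v := by
  rw [det_tmul_deformed, hillSignType_eps, side]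

theorem hillSignType_neg (x : HillField) : hillSignType (-x) = -hillSignType x := by
  have h1 : hillSignType (-1) = -1 := by
    have h := hillSignType_zero (-1) 0
    rw [map_neg, map_one, map_zero, mul_zero, add_zero] at h
    rw [h]
    simp [lexSign]
  rw [← neg_one_mul, hillSignType_mul, h1, neg_one_mul]

/-- With `x = α₁ b₁`, `y = α₂ b₂`, the coordinates of `v` are `det(v, y) / det(x, y)` and `det(x, v)
/ det(x, y)`; they are positive exactly when numerators and denominator have equal signs. -/
theorem mem_hillCone_iff (α₁ α₂ : V ≃ₗ[ℚ] V) (v : V) :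
    v ∈ hillCone ![deformed w α₁ 0, deformed w α₂ 1] ↔
      side w α₂ v = orientation w α₁ α₂ ∧ side w α₁ v = -orientation w α₁ α₂ := by
  set x := deformed w α₁ 0 with hx
  set y := deformed w α₂ 1 with hy
  set b := w.baseChange HillField
  set d := b.det ![x, y] with hd
  have hdo : hillSignType d = orientation w α₁ α₂ := hillSignType_det_deformed w α₁ α₂
  have hd0 : d ≠ 0 := fun h =>
    orientation_ne_zero w α₁ α₂ (hdo ▸ hillSignType_eq_zero.mpr h)
  have hoo : orientation w α₁ α₂ * orientation w α₁ α₂ = 1 := by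
    have := orientation_ne_zero w α₁ α₂
    revert this
    generalize orientation w α₁ α₂ = o
    revert o
    decide
  have hs₂ : hillSignType (b.det ![(1 : HillField) ⊗ₜ[ℚ] v, y]) = side w α₂ v :=
    hillSignType_det_tmul_deformed w v α₂ 1
  have hs₁ : hillSignType (b.det ![x, (1 : HillField) ⊗ₜ[ℚ] v]) = -side w α₁ v := by
    rw [Basis.det_swap, hillSignType_neg, hx, hillSignType_det_tmul_deformed]
  have hsign : ∀ z : HillField, hillSign z = 1 ↔ hillSignType z = 1 := fun z =>
    ⟨fun h => signType_cast_injective (by rw [← hillSign_eq, h]; rfl),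
      fun h => by rw [hillSign_eq, h]; rfl⟩
  constructor
  · rintro ⟨a, ha, hv⟩
    rw [Fin.sum_univ_two] at hv
    simp only [Matrix.cons_val_zero, Matrix.cons_val_one] at hv
    have h0 := (hsign _).mp (ha 0)
    have h1 := (hsign _).mp (ha 1)
    rw [hv] at hs₁ hs₂
    rw [Basis.det_add_smul, Basis.det_self, mul_zero, add_zero, hillSignType_mul, h0, one_mul, ← hd,
      hdo] at hs₂
    rw [Basis.det_swap, Basis.det_add_smul, Basis.det_self, mul_zero, zero_add, Basis.det_swap b y,
      mul_neg, neg_neg, hillSignType_mul, h1, one_mul, ← hd, hdo] at hs₁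
    exact ⟨hs₂.symm, by rw [hs₁, neg_neg]⟩
  · rintro ⟨h2, h1⟩
    refine ⟨![d⁻¹ * b.det ![(1 : HillField) ⊗ₜ[ℚ] v, y], d⁻¹ * b.det ![x, (1 : HillField) ⊗ₜ[ℚ] v]],
      ?_, ?_⟩
    · have hinv : hillSignType d⁻¹ * orientation w α₁ α₂ = 1 := by
        rw [← hdo, ← hillSignType_mul, inv_mul_cancel₀ hd0]
        have h := hillSignType_zero 1 0
        rw [map_one, map_zero, mul_zero, add_zero] at h
        rw [h]
        simp [lexSign]
      intro i
      rw [hsign]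
      fin_cases i
      · change hillSignType (_ * _) = 1
        rw [hillSignType_mul, hs₂, h2, hinv]
      · change hillSignType (_ * _) = 1
        rw [hillSignType_mul, hs₁, h1, neg_neg, hinv]
    · rw [Fin.sum_univ_two]
      simp only [Matrix.cons_val_zero, Matrix.cons_val_one, mul_smul, ← smul_add]
      rw [← Basis.det_smul_eq, smul_smul, inv_mul_cancel₀ hd0, one_smul]

theorem hillCocycle_apply (α₁ α₂ : V ≃ₗ[ℚ] V) (v : V) :
    hillCocycle w α₁ α₂ v =
      if side w α₂ v = orientation w α₁ α₂ ∧ side w α₁ v = -orientation w α₁ α₂ then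
        (orientation w α₁ α₂ : ℤ) else 0 := by
  rw [hillCocycle, hillSign_eq, hillSignType_det_deformed]
  split_ifs with h
  · rw [Set.indicator_of_mem ((mem_hillCone_iff w α₁ α₂ v).mpr h), Pi.one_apply, mul_one]
  · rw [Set.indicator_of_notMem fun h' => h ((mem_hillCone_iff w α₁ α₂ v).mp h'), mul_zero]

end Hill

end PadicShintani

/-! ### Rational rays, cones and half planes -/

namespace PadicShintani

section Decomposition

variable {V : Type*} [AddCommGroup V] [Module ℚ V]

/-- The open ray spanned by `u`. -/
def posRay (u : V) : Set V := {x | ∃ a : ℚ, 0 < a ∧ x = a • u}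

/-- The open cone spanned by `u₁` and `u₂`. -/
def posCone (u₁ u₂ : V) : Set V := {x | ∃ a b : ℚ, 0 < a ∧ 0 < b ∧ x = a • u₁ + b • u₂}

variable (w : Module.Basis (Fin 2) ℚ V)

/-- The open half planes on both sides of the line spanned by `u`. -/
def halfPlane (u : V) (s : SignType) : Set V := {x | SignType.sign (w.det ![x, u]) = s}

variable {w}

theorem exists_eq_smul_add_smul {u₁ u₂ : V} (h : w.det ![u₁, u₂] ≠ 0) (v : V) :
    ∃ a b : ℚ, v = a • u₁ + b • u₂ := by
  refine ⟨(w.det ![u₁, u₂])⁻¹ * w.det ![v, u₂], (w.det ![u₁, u₂])⁻¹ * w.det ![u₁, v], ?_⟩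
  rw [mul_smul, mul_smul, ← smul_add, ← Basis.det_smul_eq, smul_smul, inv_mul_cancel₀ h, one_smul]

theorem smul_add_smul_inj {u₁ u₂ : V} (h : w.det ![u₁, u₂] ≠ 0) {a b a' b' : ℚ}
    (hab : a • u₁ + b • u₂ = a' • u₁ + b' • u₂) : a = a' ∧ b = b' := by
  have h1 := congrArg (fun x => w.det ![x, u₂]) hab
  have h2 := congrArg (fun x => w.det ![x, u₁]) hab
  simp only [Basis.det_add_smul, Basis.det_self, mul_zero, add_zero, zero_add] at h1 h2
  rw [Basis.det_swap w u₂] at h2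
  exact ⟨mul_right_cancel₀ h h1, mul_right_cancel₀ (neg_ne_zero.mpr h) h2⟩

theorem mem_posCone_iff {u₁ u₂ : V} (h : w.det ![u₁, u₂] ≠ 0) (a b : ℚ) :
    a • u₁ + b • u₂ ∈ posCone u₁ u₂ ↔ 0 < a ∧ 0 < b := by
  constructor
  · rintro ⟨a', b', ha, hb, hab⟩
    obtain ⟨rfl, rfl⟩ := smul_add_smul_inj h hab
    exact ⟨ha, hb⟩
  · rintro ⟨ha, hb⟩
    exact ⟨a, b, ha, hb, rfl⟩

theorem mem_posRay_left_iff {u₁ u₂ : V} (h : w.det ![u₁, u₂] ≠ 0) (a b : ℚ) :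
    a • u₁ + b • u₂ ∈ posRay u₁ ↔ 0 < a ∧ b = 0 := by
  constructor
  · rintro ⟨a', ha, hab⟩
    rw [← add_zero (a' • u₁), ← zero_smul ℚ u₂] at hab
    obtain ⟨rfl, rfl⟩ := smul_add_smul_inj h hab
    exact ⟨ha, rfl⟩
  · rintro ⟨ha, rfl⟩
    exact ⟨a, ha, by rw [zero_smul, add_zero]⟩

theorem mem_posRay_right_iff {u₁ u₂ : V} (h : w.det ![u₁, u₂] ≠ 0) (a b : ℚ) :
    a • u₁ + b • u₂ ∈ posRay u₂ ↔ a = 0 ∧ 0 < b := by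
  constructor
  · rintro ⟨b', hb, hab⟩
    rw [← zero_add (b' • u₂), ← zero_smul ℚ u₁] at hab
    obtain ⟨rfl, rfl⟩ := smul_add_smul_inj h hab
    exact ⟨rfl, hb⟩
  · rintro ⟨rfl, hb⟩
    exact ⟨b, hb, by rw [zero_smul, zero_add]⟩

/-! ### Rational cones -/

theorem posCone_mem_coneFunctions {u₁ u₂ : V} (h : w.det ![u₁, u₂] ≠ 0) :
    Set.indicator (posCone u₁ u₂) 1 ∈ coneFunctions V := by
  refine AddSubgroup.subset_closure ⟨2, ![u₁, u₂], ?_, ?_⟩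
  · rw [LinearIndependent.pair_iff]
    intro s t hst
    refine smul_add_smul_inj h (a' := 0) (b' := 0) ?_
    rw [hst, zero_smul, zero_smul, add_zero]
  · congr 1
    ext x
    constructor
    · rintro ⟨a, b, ha, hb, rfl⟩
      exact ⟨![a, b], by simp [Fin.forall_fin_two, ha, hb], by simp [Fin.sum_univ_two]⟩
    · rintro ⟨a, ha, rfl⟩
      exact ⟨a 0, a 1, ha 0, ha 1, by simp [Fin.sum_univ_two]⟩

theorem posRay_mem_coneFunctions {u : V} (h : u ≠ 0) :
    Set.indicator (posRay u) 1 ∈ coneFunctions V := by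
  refine AddSubgroup.subset_closure ⟨1, ![u], ?_, ?_⟩
  · exact linearIndependent_unique_iff.mpr (by simpa using h)
  · congr 1
    ext x
    constructor
    · rintro ⟨a, ha, rfl⟩
      exact ⟨![a], by simpa using ha, by simp⟩
    · rintro ⟨a, ha, rfl⟩
      exact ⟨a 0, ha 0, by simp⟩

/-- The ray through `z` cuts the half plane containing it into two open cones, which shows that half
planes are rational cone functions. -/
theorem indicator_halfPlane_eq {u z : V} (h : w.det ![u, z] ≠ 0) :
    Set.indicator (halfPlane w u (SignType.sign (w.det ![z, u]))) (1 : V → ℤ) =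
      Set.indicator (posCone u z) 1 + Set.indicator (posCone (-u) z) 1 +
        Set.indicator (posRay z) 1 := by
  have h' : w.det ![-u, z] ≠ 0 := by
    rw [Basis.det_neg_left]
    exact neg_ne_zero.mpr h
  have hz : w.det ![z, u] ≠ 0 := by rw [Basis.det_swap]; exact neg_ne_zero.mpr h
  ext v
  obtain ⟨a, b, rfl⟩ := exists_eq_smul_add_smul h v
  have h1 : a • u + b • z ∈ halfPlane w u (SignType.sign (w.det ![z, u])) ↔ 0 < b := by
    change SignType.sign (w.det ![a • u + b • z, u]) = _ ↔ _
    rw [Basis.det_add_smul, Basis.det_self, mul_zero, zero_add, sign_mul]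
    rw [← sign_eq_one_iff]
    have : SignType.sign (w.det ![z, u]) ≠ 0 := sign_ne_zero.mpr hz
    revert this
    generalize SignType.sign (w.det ![z, u]) = s
    generalize SignType.sign b = t
    revert s t
    decide
  have h2 := mem_posCone_iff h a b
  have h3 : a • u + b • z ∈ posCone (-u) z ↔ a < 0 ∧ 0 < b := by
    have := mem_posCone_iff h' (-a) b
    rw [neg_smul_neg, neg_pos] at this
    exact this
  have h4 := mem_posRay_right_iff h a b
  classical
  simp only [Pi.add_apply, Set.indicator_apply, h1, h2, h3, h4, Pi.one_apply]
  rcases lt_trichotomy a 0 with ha | rfl | ha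
  · simp [ha, ha.ne, ha.not_gt]
  · simp
  · simp [ha, ha.ne', ha.not_gt]

theorem halfPlane_mem_coneFunctions {u z : V} (h : w.det ![u, z] ≠ 0) {s : SignType}
    (hs : s ≠ 0) : Set.indicator (halfPlane w u s) (1 : V → ℤ) ∈ coneFunctions V := by
  have key : ∀ z, w.det ![u, z] ≠ 0 →
      Set.indicator (halfPlane w u (SignType.sign (w.det ![z, u]))) (1 : V → ℤ) ∈
        coneFunctions V := by
    intro z hz
    rw [indicator_halfPlane_eq hz]
    refine add_mem (add_mem (posCone_mem_coneFunctions hz) (posCone_mem_coneFunctions (w := w) ?_))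
      (posRay_mem_coneFunctions ?_)
    · rw [Basis.det_neg_left]
      exact neg_ne_zero.mpr hz
    · rintro rfl
      simp [Basis.det_fin_two] at hz
  have h1 := key z h
  have h2 := key (-z) (by rwa [Basis.det_swap, Basis.det_neg_left, neg_neg, Basis.det_swap,
    neg_ne_zero])
  rw [Basis.det_neg_left, Left.sign_neg] at h2
  have h4 : SignType.sign (w.det ![z, u]) ≠ 0 := by
    rw [sign_ne_zero, Basis.det_swap]
    exact neg_ne_zero.mpr h
  have h5 : s = SignType.sign (w.det ![z, u]) ∨ s = -SignType.sign (w.det ![z, u]) := by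
    revert h4 hs
    generalize SignType.sign (w.det ![z, u]) = t
    clear h1 h2
    revert s t
    decide
  rcases h5 with h5 | h5 <;> rw [h5] <;> assumption

/-! ### Decomposition of Hill's cocycle into cones -/

/-- Here `s, t` are the signs of the coordinates of `v` with respect to `α₁ w₁, α₂ w₁`, and `e_i` is
the sign of `det(α_i w₁, α_i w₂)`. A boundary ray belongs to the cone exactly when the perturbation
moves the cone outwards across it. -/
theorem cone_decomposition_aux : ∀ o e₁ e₂ s t : SignType, o ≠ 0 →
    (if (if s = 0 then t * e₂ else s * o) = o ∧ (if t = 0 then s * e₁ else -(t * o)) = -o then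
      (o : ℤ) else 0) =
    (o : ℤ) * (if s = 1 ∧ t = 1 then 1 else 0) +
      (if e₁ = -o then (o : ℤ) else 0) * (if s = 1 ∧ t = 0 then 1 else 0) +
      (if e₂ = o then (o : ℤ) else 0) * (if s = 0 ∧ t = 1 then 1 else 0) := by
  decide

theorem hillCocycle_eq_of_det_ne_zero {α₁ α₂ : V ≃ₗ[ℚ] V}
    (h : w.det ![α₁ (w 0), α₂ (w 0)] ≠ 0) : ∃ c c₁ c₂ : ℤ,
    hillCocycle w α₁ α₂ = c • Set.indicator (posCone (α₁ (w 0)) (α₂ (w 0))) (1 : V → ℤ) +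
      c₁ • Set.indicator (posRay (α₁ (w 0))) (1 : V → ℤ) +
      c₂ • Set.indicator (posRay (α₂ (w 0))) (1 : V → ℤ) := by
  have ho : orientation w α₁ α₂ = SignType.sign (w.det ![α₁ (w 0), α₂ (w 0)]) := by
    rw [orientation, lexSign, if_neg h]
  set o := orientation w α₁ α₂ with hodef
  let e₁ := SignType.sign (w.det ![α₁ (w 0), α₁ (w 1)])
  let e₂ := SignType.sign (w.det ![α₂ (w 0), α₂ (w 1)])
  refine ⟨o, if e₁ = -o then (o : ℤ) else 0, if e₂ = o then (o : ℤ) else 0, ?_⟩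
  ext v
  obtain ⟨a, b, rfl⟩ := exists_eq_smul_add_smul h v
  have hs₂ : side w α₂ (a • α₁ (w 0) + b • α₂ (w 0)) =
      if SignType.sign a = 0 then SignType.sign b * e₂ else SignType.sign a * o := by
    rw [side, Basis.det_add_smul, Basis.det_self, mul_zero, add_zero, Basis.det_add_smul, lexSign]
    by_cases ha : a = 0
    · simp [ha, sign_mul, e₂]
    · simp [ha, h, sign_mul, ho]
  have hs₁ : side w α₁ (a • α₁ (w 0) + b • α₂ (w 0)) =
      if SignType.sign b = 0 then SignType.sign a * e₁ else -(SignType.sign b * o) := by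
    rw [side, Basis.det_add_smul, Basis.det_self, mul_zero, zero_add, Basis.det_add_smul, lexSign,
      Basis.det_swap w (α₂ (w 0)) (α₁ (w 0))]
    by_cases hb : b = 0
    · simp [hb, sign_mul, e₁]
    · simp [hb, h, sign_mul, ho, Left.sign_neg]
  classical
  rw [hillCocycle_apply, hs₁, hs₂, ← hodef]
  simp only [Pi.add_apply, Pi.smul_apply, Set.indicator_apply, mem_posCone_iff h,
    mem_posRay_left_iff h, mem_posRay_right_iff h, Pi.one_apply, smul_eq_mul]
  simp only [← sign_eq_one_iff (a := a), ← sign_eq_one_iff (a := b), ← sign_eq_zero_iff (a := a),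
    ← sign_eq_zero_iff (a := b)]
  exact cone_decomposition_aux o e₁ e₂ _ _ (orientation_ne_zero w α₁ α₂)

/-- Put `α₂ w₁ = c α₁ w₁`. For `c > 0` the perturbed cone contains at most a ray of rational points;
for `c < 0` it is an open half plane, possibly with a boundary ray. -/
theorem hillCocycle_eq_of_det_eq_zero {α₁ α₂ : V ≃ₗ[ℚ] V}
    (h : w.det ![α₁ (w 0), α₂ (w 0)] = 0) : ∃ c₁ c₂ c₃ c₄ : ℤ,
    hillCocycle w α₁ α₂ = c₁ • Set.indicator (posRay (α₁ (w 0))) (1 : V → ℤ) +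
      c₂ • Set.indicator (posRay (-α₁ (w 0))) (1 : V → ℤ) +
      c₃ • Set.indicator (halfPlane w (α₁ (w 0)) 1) (1 : V → ℤ) +
      c₄ • Set.indicator (halfPlane w (α₁ (w 0)) (-1)) (1 : V → ℤ) := by
  have hE := det_map_basis_ne_zero w α₁
  obtain ⟨c, hc⟩ : ∃ c : ℚ, α₂ (w 0) = c • α₁ (w 0) := by
    obtain ⟨c, d, hcd⟩ := exists_eq_smul_add_smul hE (α₂ (w 0))
    rw [hcd, Basis.det_swap, Basis.det_add_smul, Basis.det_self, mul_zero, zero_add, neg_eq_zero,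
      Basis.det_swap, mul_neg, neg_eq_zero] at h
    refine ⟨c, ?_⟩
    rw [hcd, (mul_eq_zero.mp h).resolve_right hE, zero_smul, add_zero]
  have hc0 : c ≠ 0 := by
    rintro rfl
    rw [zero_smul] at hc
    exact w.ne_zero 0 (α₂.map_eq_zero_iff.mp hc)
  set o := orientation w α₁ α₂ with hodef
  let e := SignType.sign (w.det ![α₁ (w 0), α₁ (w 1)])
  let e₂ := SignType.sign (w.det ![α₁ (w 0), α₂ (w 1)])
  -- `t` tells on which side of the line through `α₁ w₁` the vector lies; `s` is the sign of its
  -- coordinate along the line and matters only for `t = 0`.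
  let F : SignType → SignType → ℤ := fun t s =>
    if (if t = 0 then s * e₂ else SignType.sign c * t) = o ∧
      (if t = 0 then s * e else t) = -o then (o : ℤ) else 0
  refine ⟨F 0 1, F 0 (-1), F 1 0, F (-1) 0, ?_⟩
  ext v
  obtain ⟨a, b, hab⟩ := exists_eq_smul_add_smul hE v
  have ht : w.det ![v, α₁ (w 0)] = -b * w.det ![α₁ (w 0), α₁ (w 1)] := by
    rw [hab, Basis.det_add_smul, Basis.det_self, Basis.det_swap w (α₁ (w 1))]
    ring
  have ht0 : SignType.sign (w.det ![v, α₁ (w 0)]) = 0 ↔ b = 0 := by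
    rw [sign_eq_zero_iff, ht, mul_eq_zero, neg_eq_zero, or_iff_left hE]
  have hdet₂ : w.det ![v, α₂ (w 0)] = c * w.det ![v, α₁ (w 0)] := by
    rw [hc, Basis.det_swap, Basis.det_smul_left, Basis.det_swap w (α₁ (w 0)) v]
    ring
  have hside : hillCocycle w α₁ α₂ v = F (SignType.sign (w.det ![v, α₁ (w 0)]))
      (SignType.sign a) := by
    rw [hillCocycle_apply, side, side, lexSign, lexSign, hdet₂]
    simp only [F, sign_eq_zero_iff]
    by_cases hb : w.det ![v, α₁ (w 0)] = 0
    · have hb' : b = 0 := ht0.mp (sign_eq_zero_iff.mpr hb)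
      rw [hb', zero_smul, add_zero] at hab
      have h1 : ∀ z, w.det ![v, z] = a * w.det ![α₁ (w 0), z] := fun z => by
        rw [hab, Basis.det_smul_left]
      simp only [hb, mul_zero, if_true, h1, sign_mul]
      rfl
    · simp only [hb, mul_eq_zero, hc0, or_self, if_false, sign_mul]
      rfl
  have hray₁ : v ∈ posRay (α₁ (w 0)) ↔ 0 < a ∧ b = 0 := hab ▸ mem_posRay_left_iff hE a b
  have hray₂ : v ∈ posRay (-α₁ (w 0)) ↔ a < 0 ∧ b = 0 := by
    have hE' : w.det ![-α₁ (w 0), α₁ (w 1)] ≠ 0 := by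
      rw [Basis.det_neg_left]
      exact neg_ne_zero.mpr hE
    have h1 := mem_posRay_left_iff hE' (-a) b
    rwa [neg_smul_neg, neg_pos, ← hab] at h1
  classical
  rw [hside]
  simp only [Pi.add_apply, Pi.smul_apply, Set.indicator_apply, hray₁, hray₂, halfPlane,
    Set.mem_ofPred_eq, Pi.one_apply, smul_eq_mul, ← ht0]
  simp only [← sign_eq_one_iff (a := a), ← sign_eq_neg_one_iff (a := a)]
  have hF1 : ∀ s, F 1 s = F 1 0 := fun s => rfl
  have hF2 : ∀ s, F (-1) s = F (-1) 0 := fun s => rfl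
  have hF0 : F 0 0 = 0 := if_neg fun h => by
    have h1 := h.1
    rw [if_pos rfl, zero_mul] at h1
    exact orientation_ne_zero w α₁ α₂ h1.symm
  generalize SignType.sign (w.det ![v, α₁ (w 0)]) = t
  generalize SignType.sign a = s
  clear_value F
  rcases t with _ | _ | _ <;> rcases s with _ | _ | _ <;>
    simp_all [SignType.zero_eq_zero, SignType.neg_eq_neg_one, SignType.pos_eq_one]

/-- Hill's cocycle lies in every group of functions which contains the relevant cones. -/
theorem hillCocycle_mem (K : AddSubgroup (V → ℤ)) (α₁ α₂ : V ≃ₗ[ℚ] V)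
    (hcone : w.det ![α₁ (w 0), α₂ (w 0)] ≠ 0 →
      Set.indicator (posCone (α₁ (w 0)) (α₂ (w 0))) 1 ∈ K)
    (hray₁ : Set.indicator (posRay (α₁ (w 0))) 1 ∈ K)
    (hray₂ : Set.indicator (posRay (α₂ (w 0))) 1 ∈ K)
    (hray₃ : Set.indicator (posRay (-α₁ (w 0))) 1 ∈ K)
    (hhalf : ∀ s, s ≠ 0 → Set.indicator (halfPlane w (α₁ (w 0)) s) 1 ∈ K) :
    hillCocycle w α₁ α₂ ∈ K := by
  by_cases h : w.det ![α₁ (w 0), α₂ (w 0)] = 0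
  · obtain ⟨c₁, c₂, c₃, c₄, hσ⟩ := hillCocycle_eq_of_det_eq_zero h
    rw [hσ]
    exact add_mem (add_mem (add_mem (zsmul_mem hray₁ _) (zsmul_mem hray₃ _))
      (zsmul_mem (hhalf 1 (by decide)) _)) (zsmul_mem (hhalf (-1) (by decide)) _)
  · obtain ⟨c, c₁, c₂, hσ⟩ := hillCocycle_eq_of_det_ne_zero h
    rw [hσ]
    exact add_mem (add_mem (zsmul_mem (hcone h) _) (zsmul_mem hray₁ _)) (zsmul_mem hray₂ _)

theorem hillCocycle_mem_coneFunctions (α₁ α₂ : V ≃ₗ[ℚ] V) :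
    hillCocycle w α₁ α₂ ∈ coneFunctions V := by
  have h0 : ∀ α : V ≃ₗ[ℚ] V, α (w 0) ≠ 0 := fun α h => w.ne_zero 0 (α.map_eq_zero_iff.mp h)
  exact hillCocycle_mem _ α₁ α₂ posCone_mem_coneFunctions (posRay_mem_coneFunctions (h0 _))
    (posRay_mem_coneFunctions (h0 _)) (posRay_mem_coneFunctions (neg_ne_zero.mpr (h0 _)))
    fun _ => halfPlane_mem_coneFunctions (det_map_basis_ne_zero w α₁)

/-! ### The cocycle relation -/

/-- Small positive rationals can stand for the infinitesimals, so sign relations can be proved by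
arithmetic in `ℚ`. -/
theorem eventually_sign_eq_lexSign (a b : ℚ) :
    ∀ᶠ ε in nhdsWithin (0 : ℚ) (Set.Ioi 0), SignType.sign (a + ε * b) = lexSign a b := by
  have hlim : Filter.Tendsto (fun ε : ℚ => a + ε * b) (nhdsWithin 0 (Set.Ioi 0)) (nhds a) := by
    have h : Continuous fun ε : ℚ => a + ε * b := by fun_prop
    have h1 := h.tendsto 0
    simp only [zero_mul, add_zero] at h1
    exact h1.mono_left nhdsWithin_le_nhds
  rw [lexSign]
  rcases lt_trichotomy a 0 with ha | rfl | ha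
  · filter_upwards [hlim.eventually (gt_mem_nhds ha)] with ε hε
    rw [if_neg ha.ne, sign_neg hε, sign_neg ha]
  · filter_upwards [self_mem_nhdsWithin] with ε hε
    rw [if_pos rfl, zero_add, sign_mul, sign_pos hε, one_mul]
  · filter_upwards [hlim.eventually (lt_mem_nhds ha)] with ε hε
    rw [if_neg ha.ne', sign_pos hε, sign_pos ha]

theorem eventually_sign_eq_lexSign₂ {a b : ℚ} (c d : ℚ) (h : ¬ (a = 0 ∧ b = 0)) :
    ∀ᶠ ε in nhdsWithin (0 : ℚ) (Set.Ioi 0), ∀ᶠ ε' in nhdsWithin (0 : ℚ) (Set.Ioi 0),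
      SignType.sign (a + ε * b + ε' * (c + ε * d)) = lexSign a b := by
  filter_upwards [eventually_sign_eq_lexSign a b] with ε hε
  have h0 : a + ε * b ≠ 0 := fun h0 => by
    rw [h0, sign_zero] at hε
    exact lexSign_ne_zero h hε.symm
  filter_upwards [eventually_sign_eq_lexSign (a + ε * b) (c + ε * d)] with ε' hε'
  rw [hε', lexSign, if_neg h0, hε]

theorem eventually_sign_eq_side (α : V ≃ₗ[ℚ] V) (v : V) :
    ∀ᶠ ε in nhdsWithin (0 : ℚ) (Set.Ioi 0),
      SignType.sign (w.det ![v, α (w 0) + ε • α (w 1)]) = side w α v := by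
  filter_upwards [eventually_sign_eq_lexSign (w.det ![v, α (w 0)]) (w.det ![v, α (w 1)])] with ε hε
  rw [side, ← hε]
  congr 1
  simp only [Basis.det_fin_two, map_add, map_smul, Finsupp.add_apply, Finsupp.smul_apply,
    smul_eq_mul]
  ring

theorem eventually_sign_eq_orientation (α₁ α₂ : V ≃ₗ[ℚ] V) :
    ∀ᶠ ε in nhdsWithin (0 : ℚ) (Set.Ioi 0), ∀ᶠ ε' in nhdsWithin (0 : ℚ) (Set.Ioi 0),
      SignType.sign (w.det ![α₁ (w 0) + ε • α₁ (w 1), α₂ (w 0) + ε' • α₂ (w 1)]) =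
        orientation w α₁ α₂ := by
  filter_upwards [eventually_sign_eq_lexSign₂ (w.det ![α₁ (w 0), α₂ (w 1)])
    (w.det ![α₁ (w 1), α₂ (w 1)]) (orientation_aux w α₁ α₂)] with ε hε
  filter_upwards [hε] with ε' hε'
  rw [orientation, ← hε']
  congr 1
  simp only [Basis.det_fin_two, map_add, map_smul, Finsupp.add_apply, Finsupp.smul_apply,
    smul_eq_mul]
  ring

/-- The signs which occur in the three-term relation between four vectors of a plane. -/
theorem three_term_relation (α₀ α₁ α₂ : V ≃ₗ[ℚ] V) (v : V) {s : SignType} (hs : s ≠ 0) :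
    ¬ (side w α₀ v * orientation w α₁ α₂ = s ∧ -(side w α₁ v * orientation w α₀ α₂) = s ∧
      side w α₂ v * orientation w α₀ α₁ = s) := by
  -- The parameters are chosen in the order `ε₀, ε₁, ε₂`, because in each orientation the second
  -- parameter must be small relative to the first. Each `α_i` thus gets one vector `b_i` valid for
  -- all its signs.
  obtain ⟨ε₀, hs₀, h01, h02⟩ := ((eventually_sign_eq_side (w := w) α₀ v).and
    ((eventually_sign_eq_orientation (w := w) α₀ α₁).and
      (eventually_sign_eq_orientation (w := w) α₀ α₂))).exists
  obtain ⟨ε₁, hs₁, h01, h12⟩ := ((eventually_sign_eq_side (w := w) α₁ v).and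
    (h01.and (eventually_sign_eq_orientation (w := w) α₁ α₂))).exists
  obtain ⟨ε₂, hs₂, h02, h12⟩ := ((eventually_sign_eq_side (w := w) α₂ v).and
    (h02.and h12)).exists
  rintro ⟨h0, h1, h2⟩
  rw [← hs₀, ← h12, ← sign_mul] at h0
  rw [← hs₁, ← h02, ← sign_mul, ← Left.sign_neg] at h1
  rw [← hs₂, ← h01, ← sign_mul] at h2
  set b₀ := α₀ (w 0) + ε₀ • α₀ (w 1)
  set b₁ := α₁ (w 0) + ε₁ • α₁ (w 1)
  set b₂ := α₂ (w 0) + ε₂ • α₂ (w 1)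
  -- The Plücker relation: three numbers with sum zero cannot share a nonzero sign.
  have hsum : w.det ![v, b₀] * w.det ![b₁, b₂] + -(w.det ![v, b₁] * w.det ![b₀, b₂]) +
      w.det ![v, b₂] * w.det ![b₀, b₁] = 0 := by
    simp only [Basis.det_fin_two]
    ring
  rcases s with _ | _ | _
  · exact hs rfl
  · rw [SignType.neg_eq_neg_one, sign_eq_neg_one_iff] at h0 h1 h2
    linarith
  · rw [SignType.pos_eq_one, sign_eq_one_iff] at h0 h1 h2
    linarith

/-- Once the patterns forbidden by the Plücker relation are removed, a finite check shows that the
alternating sum no longer depends on the sides `s_i`, that is, on `v`. -/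
theorem cocycle_relation_aux : ∀ o₀₁ o₀₂ o₁₂ s₀ s₁ s₂ : SignType, o₀₁ ≠ 0 → o₀₂ ≠ 0 → o₁₂ ≠ 0 →
    s₀ ≠ 0 → s₁ ≠ 0 → s₂ ≠ 0 → ¬ (s₀ * o₁₂ = 1 ∧ -(s₁ * o₀₂) = 1 ∧ s₂ * o₀₁ = 1) →
    ¬ (s₀ * o₁₂ = -1 ∧ -(s₁ * o₀₂) = -1 ∧ s₂ * o₀₁ = -1) →
    (if s₂ = o₁₂ ∧ s₁ = -o₁₂ then (o₁₂ : ℤ) else 0) - (if s₂ = o₀₂ ∧ s₀ = -o₀₂ then (o₀₂ : ℤ) else 0) +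
      (if s₁ = o₀₁ ∧ s₀ = -o₀₁ then (o₀₁ : ℤ) else 0) =
    if o₁₂ = -o₀₂ ∧ o₁₂ = o₀₁ then (o₁₂ : ℤ) else 0 := by
  decide

/-- The alternating sum of the values of Hill's cocycle is constant outside the origin. -/
theorem hillCocycle_relation (α₀ α₁ α₂ : V ≃ₗ[ℚ] V) : ∃ c : ℤ, ∀ v, v ≠ 0 →
    hillCocycle w α₁ α₂ v - hillCocycle w α₀ α₂ v + hillCocycle w α₀ α₁ v = c := by
  refine ⟨if orientation w α₁ α₂ = -orientation w α₀ α₂ ∧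
    orientation w α₁ α₂ = orientation w α₀ α₁ then (orientation w α₁ α₂ : ℤ) else 0,
    fun v hv => ?_⟩
  rw [hillCocycle_apply, hillCocycle_apply, hillCocycle_apply]
  exact cocycle_relation_aux _ _ _ _ _ _ (orientation_ne_zero w _ _) (orientation_ne_zero w _ _)
    (orientation_ne_zero w _ _) (side_ne_zero w α₀ hv) (side_ne_zero w α₁ hv)
    (side_ne_zero w α₂ hv) (three_term_relation α₀ α₁ α₂ v (by decide))
    (three_term_relation α₀ α₁ α₂ v (by decide))

theorem hillCocycle_zero (α₁ α₂ : V ≃ₗ[ℚ] V) : hillCocycle w α₁ α₂ 0 = 0 := by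
  rw [hillCocycle_apply, side_zero, if_neg fun h => orientation_ne_zero w α₁ α₂ h.1.symm]

/-- All sides and the orientation are multiplied by the same sign, so the cone condition is
unchanged and only the sign in front varies. -/
theorem hillCocycle_equivariant (γ α₁ α₂ : V ≃ₗ[ℚ] V) (v : V) :
    hillCocycle w (γ * α₁) (γ * α₂) (γ v) = detSign γ * hillCocycle w α₁ α₂ v := by
  have hdet : ∀ x y, w.det ![γ x, γ y] = LinearMap.det (γ : V →ₗ[ℚ] V) * w.det ![x, y] :=
    Basis.det_map w (γ : V →ₗ[ℚ] V)
  have hside : ∀ α, side w (γ * α) (γ v) =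
      SignType.sign (LinearMap.det (γ : V →ₗ[ℚ] V)) * side w α v := fun α => by
    rw [side, LinearEquiv.mul_apply, LinearEquiv.mul_apply, hdet, hdet, lexSign_mul, side]
  have hor : orientation w (γ * α₁) (γ * α₂) =
      SignType.sign (LinearMap.det (γ : V →ₗ[ℚ] V)) * orientation w α₁ α₂ := by
    rw [orientation, LinearEquiv.mul_apply, LinearEquiv.mul_apply, LinearEquiv.mul_apply, hdet,
      hdet, lexSign_mul, orientation]
  rw [hillCocycle_apply, hillCocycle_apply, hside, hside, hor, detSign]
  have h0 : SignType.sign (LinearMap.det (γ : V →ₗ[ℚ] V)) ≠ 0 :=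
    sign_ne_zero.mpr γ.isUnit_det'.ne_zero
  revert h0
  generalize SignType.sign (LinearMap.det (γ : V →ₗ[ℚ] V)) = d
  generalize orientation w α₁ α₂ = o
  generalize side w α₁ v = s₁
  generalize side w α₂ v = s₂
  revert d o s₁ s₂
  decide

end Decomposition

end PadicShintani

/-! ### Finiteness after averaging -/

namespace PadicShintani

section Finiteness

theorem average_add {A : Type*} [AddGroup A] (M : ℕ) (u : A) (g g' : A → ℤ) :
    average M u (g + g') = average M u g + average M u g' := by
  ext v
  simp only [average, Pi.add_apply, Finset.sum_add_distrib]

theorem average_neg {A : Type*} [AddGroup A] (M : ℕ) (u : A) (g : A → ℤ) :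
    average M u (-g) = -average M u g := by
  ext v
  simp only [average, Pi.neg_apply, Finset.sum_neg_distrib]

theorem average_comm {A : Type*} [AddCommGroup A] (M : ℕ) (u u' : A) (g : A → ℤ) :
    average M u (average M u' g) = average M u' (average M u g) := by
  ext v
  simp only [average]
  rw [Finset.sum_comm]
  exact Finset.sum_congr rfl fun i _ => Finset.sum_congr rfl fun j _ => by rw [sub_right_comm]

theorem exists_ne_zero_of_average_ne_zero {A : Type*} [AddGroup A] {M : ℕ} {u v : A} {g : A → ℤ}
    (h : average M u g v ≠ 0) : ∃ i < M, g (v - i • u) ≠ 0 := by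
  obtain ⟨i, hi, h⟩ := Finset.exists_ne_zero_of_sum_ne_zero h
  exact ⟨i, Finset.mem_range.mp hi, h⟩

theorem finite_support_average {A : Type*} [AddGroup A] (M : ℕ) (u : A) {g : A → ℤ}
    (hg : (Function.support g).Finite) : (Function.support (average M u g)).Finite := by
  refine ((Set.finite_lt_nat M).biUnion fun i _ => hg.image (· + i • u)).subset fun v hv => ?_
  obtain ⟨i, hi, h⟩ := exists_ne_zero_of_average_ne_zero hv
  exact Set.mem_biUnion hi ⟨_, h, sub_add_cancel v _⟩

/-- The cancellation mechanism: a weight that is constant on the progression factors out of the sum.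
-/
theorem average_mul_eq_zero {A : Type*} [AddGroup A] {M : ℕ} {u v : A} {κ f : A → ℤ}
    (hf : average M u f v = 0) (hκ : ∃ c, ∀ i < M, κ (v - i • u) = c) :
    average M u (κ * f) v = 0 := by
  obtain ⟨c, hc⟩ := hκ
  have h : average M u (κ * f) v = c * average M u f v := by
    rw [average, average, Finset.mul_sum]
    refine Finset.sum_congr rfl fun i hi => ?_
    rw [Pi.mul_apply, hc i (Finset.mem_range.mp hi)]
  rw [h, hf, mul_zero]

/-- Two consecutive windows of length `M` have equal sums, and they differ only in their end terms.
-/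
theorem difference_eq_zero_of_average {A : Type*} [AddCommGroup A] {M : ℕ} {u : A} {f : A → ℤ}
    (hf : average M u f = 0) (v : A) : f (v - M • u) = f v := by
  have h := congrFun (difference_average M u f) v
  rw [hf] at h
  simp only [difference, Pi.zero_apply, sub_zero] at h
  exact (sub_eq_zero.mp h.symm).symm

/-- The cone functions whose product with `f` becomes finite after averaging over `y₁`
and `y₂`. -/
def averageFinite {V : Type*} [AddCommGroup V] (f : V → ℤ) (M : ℕ) (y₁ y₂ : V) : AddSubgroup (V → ℤ) where
  carrier := {κ | (Function.support (average M y₁ (average M y₂ (κ * f)))).Finite}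
  zero_mem' := by
    have h : average M y₁ (average M y₂ ((0 : V → ℤ) * f)) = 0 := by
      ext v
      simp [average]
    rw [Set.mem_ofPred_eq, h, Function.support_zero]
    exact Set.finite_empty
  add_mem' {κ κ'} h h' := by
    rw [Set.mem_ofPred_eq] at *
    rw [add_mul, average_add, average_add]
    exact (h.union h').subset (Function.support_add _ _)
  neg_mem' {κ} h := by
    rw [Set.mem_ofPred_eq] at *
    rwa [neg_mul, average_neg, average_neg, Function.support_neg]

theorem mem_averageFinite {V : Type*} [AddCommGroup V] {f : V → ℤ} {M : ℕ} {y₁ y₂ : V} {κ : V → ℤ} :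
    κ ∈ averageFinite f M y₁ y₂ ↔
      (Function.support (average M y₁ (average M y₂ (κ * f)))).Finite := Iff.rfl

variable {V : Type*} [AddCommGroup V] [Module ℚ V]

/-- A function whose support is finite in every bounded region of a plane. -/
def HasDiscreteSupport (f : V → ℤ) : Prop :=
  ∀ (v₁ v₂ : V) (C : ℚ),
    {v | f v ≠ 0 ∧ ∃ t₁ t₂ : ℚ, |t₁| ≤ C ∧ |t₂| ≤ C ∧ v = t₁ • v₁ + t₂ • v₂}.Finite

/-- Far from the origin a progression of length `M` does not cross zero. -/
theorem sub_natCast_mul_pos_iff {t : ℚ} {M i : ℕ} (ht : (M : ℚ) < |t|) (hi : i < M) (s : ℚ) :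
    0 < (t - i) * s ↔ 0 < t * s := by
  have hi' : (i : ℚ) < M := by exact_mod_cast hi
  have hi0 : (0 : ℚ) ≤ i := Nat.cast_nonneg i
  rcases lt_abs.mp ht with h | h
  · rw [mul_pos_iff_of_pos_left (by linarith), mul_pos_iff_of_pos_left (by linarith)]
  · rw [← neg_mul_neg, ← neg_mul_neg t, mul_pos_iff_of_pos_left (by linarith),
      mul_pos_iff_of_pos_left (by linarith)]

theorem sub_natCast_pos_iff {t : ℚ} {M i : ℕ} (ht : (M : ℚ) < |t|) (hi : i < M) :
    0 < t - i ↔ 0 < t := by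
  simpa using sub_natCast_mul_pos_iff ht hi 1

theorem smul_mem_posRay_iff {y : V} (hy : y ≠ 0) {s : ℚ} (hs : s ≠ 0) (t : ℚ) :
    t • y ∈ posRay (s • y) ↔ 0 < t * s := by
  have hs2 : 0 < s * s := mul_self_pos.mpr hs
  constructor
  · rintro ⟨a, ha, hta⟩
    rw [smul_smul] at hta
    rw [smul_left_injective ℚ hy hta, mul_assoc]
    exact mul_pos ha hs2
  · refine fun ht => ⟨t * s / (s * s), div_pos ht hs2, ?_⟩
    rw [smul_smul]
    congr 1
    field_simp

/-- If `v = t y` with `|t| > M`, all `M` points summed lie on the same side of the origin and the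
average vanishes. Only a bounded segment is left, where `f` has finite support. The sign of `s`
covers both rays of the line. -/
theorem finite_support_average_posRay {f : V → ℤ} (hf : HasDiscreteSupport f) {M : ℕ} {y : V}
    (hy0 : y ≠ 0) (hy : average M y f = 0) {s : ℚ} (hs : s ≠ 0) :
    (Function.support (average M y (Set.indicator (posRay (s • y)) 1 * f))).Finite := by
  classical
  refine ((Set.finite_lt_nat M).biUnion fun i _ =>
    (hf y 0 (M + M)).image fun v => v + i • y).subset fun v hv => ?_
  obtain ⟨i, hi, hne⟩ := exists_ne_zero_of_average_ne_zero hv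
  obtain ⟨hκ, hfne⟩ := mul_ne_zero_iff.mp hne
  obtain ⟨a, ha, hva⟩ := Set.mem_of_indicator_ne_zero hκ
  rw [smul_smul] at hva
  have hv' : v = (a * s + i) • y := by
    rw [add_smul, Nat.cast_smul_eq_nsmul, ← hva, sub_add_cancel]
  have hbig : |a * s + i| ≤ M := by
    by_contra! h
    refine hv (average_mul_eq_zero (congrFun hy v)
      ⟨if 0 < (a * s + i) * s then 1 else 0, fun k hk => ?_⟩)
    rw [hv', ← Nat.cast_smul_eq_nsmul ℚ, ← sub_smul, Set.indicator_apply,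
      smul_mem_posRay_iff hy0 hs]
    simp only [sub_natCast_mul_pos_iff h hk, Pi.one_apply]
  have hi' : (i : ℚ) < M := by exact_mod_cast hi
  have hi0 : (0 : ℚ) ≤ i := Nat.cast_nonneg i
  -- The point of the support of `f` is not `v` but a translate of it by fewer than `M` steps, hence
  -- the bound `M + M`.
  refine Set.mem_biUnion hi ⟨v - i • y, ⟨hfne, a * s, 0, ?_, ?_, ?_⟩, sub_add_cancel _ _⟩
  · rw [abs_le] at hbig ⊢
    constructor <;> linarith [hbig.1, hbig.2]
  · rw [abs_zero]
    linarith
  · rw [hva, zero_smul, add_zero]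

/-- The average along `y₁` vanishes where `|t₁| > M` and the one along `y₂` where `|t₂| > M`. The
two averages commute, so only a bounded parallelogram survives. -/
theorem finite_support_average_posCone {w : Module.Basis (Fin 2) ℚ V} {f : V → ℤ}
    (hf : HasDiscreteSupport f) {M : ℕ} {y₁ y₂ : V} (hy₁ : average M y₁ f = 0)
    (hy₂ : average M y₂ f = 0) (h : w.det ![y₁, y₂] ≠ 0) :
    (Function.support
      (average M y₁ (average M y₂ (Set.indicator (posCone y₁ y₂) 1 * f)))).Finite := by
  classical
  have hcoord : ∀ (t₁ t₂ : ℚ) (i j : ℕ),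
      t₁ • y₁ + t₂ • y₂ - i • y₁ - j • y₂ = (t₁ - i) • y₁ + (t₂ - j) • y₂ := fun t₁ t₂ i j => by
    rw [sub_smul, sub_smul, Nat.cast_smul_eq_nsmul, Nat.cast_smul_eq_nsmul]
    abel
  have hbig : ∀ t₁ t₂ : ℚ, average M y₁ (average M y₂ (Set.indicator (posCone y₁ y₂) 1 * f))
      (t₁ • y₁ + t₂ • y₂) ≠ 0 → |t₁| ≤ M ∧ |t₂| ≤ M := by
    refine fun t₁ t₂ hne => ⟨?_, ?_⟩
    · rw [average_comm] at hne
      by_contra! hM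
      refine hne (Finset.sum_eq_zero fun j _ => average_mul_eq_zero (congrFun hy₁ _)
        ⟨if 0 < t₁ ∧ 0 < t₂ - j then 1 else 0, fun i hi => ?_⟩)
      rw [sub_right_comm, hcoord, Set.indicator_apply, mem_posCone_iff h]
      simp only [sub_natCast_pos_iff hM hi, Pi.one_apply]
    · by_contra! hM
      refine hne (Finset.sum_eq_zero fun i _ => average_mul_eq_zero (congrFun hy₂ _)
        ⟨if 0 < t₁ - i ∧ 0 < t₂ then 1 else 0, fun j hj => ?_⟩)
      rw [hcoord, Set.indicator_apply, mem_posCone_iff h]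
      simp only [sub_natCast_pos_iff hM hj, Pi.one_apply]
  refine ((Set.finite_lt_nat M).biUnion fun i _ => (Set.finite_lt_nat M).biUnion fun j _ =>
    (hf y₁ y₂ (M + M)).image fun v => v + j • y₂ + i • y₁).subset fun v hv => ?_
  obtain ⟨t₁, t₂, rfl⟩ := exists_eq_smul_add_smul h v
  obtain ⟨i, hi, hne⟩ := exists_ne_zero_of_average_ne_zero hv
  obtain ⟨j, hj, hne⟩ := exists_ne_zero_of_average_ne_zero hne
  obtain ⟨h₁, h₂⟩ := hbig t₁ t₂ hv
  have hshift : ∀ (t : ℚ) (k : ℕ), |t| ≤ M → k < M → |t - k| ≤ M + M := fun t k ht hk => by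
    have hk' : (k : ℚ) < M := by exact_mod_cast hk
    have hk0 : (0 : ℚ) ≤ k := Nat.cast_nonneg k
    rw [abs_le] at ht ⊢
    constructor <;> linarith [ht.1, ht.2]
  refine Set.mem_biUnion hi (Set.mem_biUnion hj ⟨_, ⟨right_ne_zero_of_mul hne, t₁ - i, t₂ - j,
    hshift _ _ h₁ hi, hshift _ _ h₂ hj, hcoord _ _ _ _⟩, ?_⟩)
  simp only [sub_add_cancel]

variable {w : Module.Basis (Fin 2) ℚ V}

theorem posRay_smul {c : ℚ} (hc : 0 < c) (u : V) : posRay (c • u) = posRay u := by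
  ext x
  constructor
  · rintro ⟨a, ha, rfl⟩
    exact ⟨a * c, mul_pos ha hc, by rw [mul_smul]⟩
  · rintro ⟨a, ha, rfl⟩
    exact ⟨a / c, div_pos ha hc, by rw [smul_smul, div_mul_cancel₀ _ hc.ne']⟩

theorem posCone_smul {c : ℚ} (hc : 0 < c) (u₁ u₂ : V) :
    posCone (c • u₁) (c • u₂) = posCone u₁ u₂ := by
  ext x
  constructor
  · rintro ⟨a, b, ha, hb, rfl⟩
    exact ⟨a * c, b * c, mul_pos ha hc, mul_pos hb hc, by rw [mul_smul, mul_smul]⟩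
  · rintro ⟨a, b, ha, hb, rfl⟩
    exact ⟨a / c, b / c, div_pos ha hc, div_pos hb hc, by
      rw [smul_smul, smul_smul, div_mul_cancel₀ _ hc.ne', div_mul_cancel₀ _ hc.ne']⟩

theorem hillCocycle_mem_averageFinite {f : V → ℤ} (hf : HasDiscreteSupport f) {M : ℕ} {c : ℚ}
    (hc : 0 < c) (α₁ α₂ : V ≃ₗ[ℚ] V) (h₁ : average M (c • α₁ (w 0)) f = 0)
    (h₂ : average M (c • α₂ (w 0)) f = 0) :
    hillCocycle w α₁ α₂ ∈ averageFinite f M (c • α₁ (w 0)) (c • α₂ (w 0)) := by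
  have h0 : ∀ α : V ≃ₗ[ℚ] V, c • α (w 0) ≠ 0 := fun α h =>
    w.ne_zero 0 (α.map_eq_zero_iff.mp ((smul_eq_zero.mp h).resolve_left hc.ne'))
  refine hillCocycle_mem _ α₁ α₂ (fun hdet => ?_) ?_ ?_ ?_ fun s hs => ?_
  · rw [← posCone_smul hc]
    refine finite_support_average_posCone (w := w) hf h₁ h₂ ?_
    rw [Basis.det_smul_left, Basis.det_swap, Basis.det_smul_left, Basis.det_swap]
    simpa [hc.ne'] using hdet
  · rw [mem_averageFinite, average_comm, ← posRay_smul hc, ← one_smul ℚ (c • α₁ (w 0))]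
    refine finite_support_average _ _ ?_
    simpa using finite_support_average_posRay hf (h0 α₁) h₁ one_ne_zero
  · rw [← posRay_smul hc, ← one_smul ℚ (c • α₂ (w 0))]
    refine finite_support_average _ _ ?_
    simpa using finite_support_average_posRay hf (h0 α₂) h₂ one_ne_zero
  · rw [mem_averageFinite, average_comm, ← posRay_smul hc, smul_neg, ← neg_one_smul ℚ (c • _)]
    refine finite_support_average _ _ ?_
    exact finite_support_average_posRay hf (h0 α₁) h₁ (neg_ne_zero.mpr one_ne_zero)
  · rw [mem_averageFinite, average_comm]
    refine finite_support_average _ _ ?_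
    -- A half plane is invariant under translation along its boundary line, so here the cancellation
    -- is complete.
    have h : average M (c • α₁ (w 0)) (Set.indicator (halfPlane w (α₁ (w 0)) s) 1 * f) = 0 := by
      classical
      ext v
      refine average_mul_eq_zero (congrFun h₁ v)
        ⟨Set.indicator (halfPlane w (α₁ (w 0)) s) 1 v, fun i _ => ?_⟩
      have hdet : w.det ![v - i • c • α₁ (w 0), α₁ (w 0)] = w.det ![v, α₁ (w 0)] := by
        rw [← Nat.cast_smul_eq_nsmul ℚ, smul_smul, sub_eq_add_neg, ← neg_smul,
          ← one_smul ℚ v, Basis.det_add_smul, Basis.det_self, mul_zero, add_zero, one_mul,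
          one_smul]
      simp only [Set.indicator_apply, halfPlane, Set.mem_ofPred_eq, hdet, Pi.one_apply]
    rw [h, Function.support_zero]
    exact Set.finite_empty

end Finiteness

/-! ### The Shintani cocycle -/

section Main

variable {p : ℕ} [Fact p.Prime] {V : Type*} [AddCommGroup V] [Module ℚ V] {L : Submodule ℤ V}

theorem represents_pseudoMeasure {g : V → ℤ} {x : PseudoMeasure p L} (h : Represents g x) :
    pseudoMeasure p L g = x := by
  have hex : ∃ x : PseudoMeasure p L, Represents g x := ⟨x, h⟩
  rw [pseudoMeasure, dif_pos hex]
  exact hex.choose_spec.unique h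

/-- Because of this transport the Vanishing Hypothesis is needed for `w₁` only, and not for each `α
w₁`. -/
theorem average_globalTest_map {f' : V → ℤ} (α : stabilizer p L f') {M : ℕ} {y : V}
    (h : average M y (globalTest p L f') = 0) :
    average M ((α : V ≃ₗ[ℚ] V) y) (globalTest p L f') = 0 := by
  have hα : ∀ v, globalTest p L f' ((α : V ≃ₗ[ℚ] V) v) = globalTest p L f' v := α.2
  ext v
  refine Eq.trans ?_ (congrFun h ((α : V ≃ₗ[ℚ] V).symm v))
  refine Finset.sum_congr rfl fun i _ => ?_
  rw [← hα ((α : V ≃ₗ[ℚ] V).symm v - i • y), map_sub, map_nsmul, LinearEquiv.apply_symm_apply]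

/-- The formal sums attached to Hill's cocycle represent measures. -/
theorem exists_represents_ofMeasure [CompactSpace (localLattice p L)]
    {w : Module.Basis (Fin 2) ℚ V} {f' : V → ℤ} (hf : HasDiscreteSupport (globalTest p L f'))
    {c : ℚ} (hc : 0 < c) {M : ℕ} (hM0 : M ≠ 0) (hM : M.Coprime p)
    (hmem : ∀ α : stabilizer p L f', c • (α : V ≃ₗ[ℚ] V) (w 0) ∈ ratPoints p L)
    (hsum : average M (c • w 0) (globalTest p L f') = 0) (α₁ α₂ : stabilizer p L f') :
    ∃ μ : PMeasure p L, Represents (formalSum p L f' (hillCocycle w α₁ α₂)) (ofMeasure μ) := by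
  have hα : ∀ α : stabilizer p L f',
      average M (c • (α : V ≃ₗ[ℚ] V) (w 0)) (globalTest p L f') = 0 := fun α => by
    rw [← map_smul]
    exact average_globalTest_map α hsum
  have hne : ∀ α : stabilizer p L f', (⟨_, hmem α⟩ : ratPoints p L) ≠ 0 := fun α h => by
    have h1 : c • (α : V ≃ₗ[ℚ] V) (w 0) = 0 := congrArg Subtype.val h
    exact w.ne_zero 0 ((α : V ≃ₗ[ℚ] V).map_eq_zero_iff.mp
      ((smul_eq_zero.mp h1).resolve_left hc.ne'))
  refine represents_ofMeasure_of_average hM0 hM (hne α₁) (hne α₂) ?_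
  have hfin := hillCocycle_mem_averageFinite (w := w) hf hc (α₁ : V ≃ₗ[ℚ] V) (α₂ : V ≃ₗ[ℚ] V)
    (hα α₁) (hα α₂)
  refine Set.Finite.of_finite_image (f := Subtype.val)
    (hfin.subset ?_) Subtype.val_injective.injOn
  rintro _ ⟨v, hv, rfl⟩
  exact hv

end Main

end PadicShintani

theorem mainTheorem5 (p : ℕ) [Fact p.Prime] {V : Type*} [AddCommGroup V] [Module ℚ V]
    (L : Submodule ℤ V) (hLfg : L.FG) (hLspan : Submodule.span ℚ (L : Set V) = ⊤)
    (w : Module.Basis (Fin 2) ℚ V)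
    (f' : V → ℤ) (hf' : f' ∈ testFunctionsAway p L) (hf'0 : f' ≠ 0)
    (hvan : VanishingHypothesis p f' (w 0)) :
    -- `Φ_{f'}` is well defined: Hill's cocycle is cone-valued and yields pseudo-measures
    (∀ α₁ α₂ : stabilizer p L f',
      hillCocycle w α₁ α₂ ∈ coneFunctions V ∧
      Represents (formalSum p L f' (hillCocycle w α₁ α₂))
        (shintaniPseudoMeasure p L w f' α₁ α₂)) ∧
    -- `Γ` acts on `L_p`, and `Φ_{f'}` is `Γ`-equivariant
    (∀ γ : stabilizer p L f', ∃ h : PreservesLattice p L (γ : V ≃ₗ[ℚ] V),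
      ∀ α₁ α₂ : stabilizer p L f',
        shintani p L w f' (γ * α₁) (γ * α₂) =
          detSign (γ : V ≃ₗ[ℚ] V) • actModDirac (γ : V ≃ₗ[ℚ] V) h (shintani p L w f' α₁ α₂)) ∧
    -- the cocycle relation
    (∀ α₀ α₁ α₂ : stabilizer p L f',
      shintani p L w f' α₁ α₂ - shintani p L w f' α₀ α₂ + shintani p L w f' α₀ α₁ = 0) ∧
    -- all values are measures
    (∀ α₁ α₂ : stabilizer p L f', IsMeasure (shintani p L w f' α₁ α₂)) := by
  obtain ⟨e, he⟩ := exists_lattice_basis hLfg hLspan w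
  obtain ⟨N, hN⟩ := exists_isLevel he hf'
  have hcompact : CompactSpace (localLattice p L) := compactSpace_localLattice he
  obtain ⟨c, M, hc, hM0, hM, hmem, hsum⟩ := hN.exists_sum_eq_zero he (w.ne_zero 0) hvan
  have hsum' : average M (c • w 0) (globalTest p L f') = 0 := funext hsum
  have hrep := exists_represents_ofMeasure (hN.finite_support_inter he) hc hM0 hM
    (fun α => by rw [← map_smul]; exact hN.map_mem_ratPoints he hf'0 α hmem) hsum'
  choose μ hμ using hrep
  have hΦ : ∀ α₁ α₂, shintaniPseudoMeasure p L w f' α₁ α₂ = ofMeasure (μ α₁ α₂) :=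
    fun α₁ α₂ => represents_pseudoMeasure (hμ α₁ α₂)
  refine ⟨fun α₁ α₂ => ⟨hillCocycle_mem_coneFunctions _ _, hΦ α₁ α₂ ▸ hμ α₁ α₂⟩, fun γ => ?_,
    fun α₀ α₁ α₂ => ?_, fun α₁ α₂ => ⟨μ α₁ α₂, ?_⟩⟩
  · refine ⟨hN.preservesLattice he hf'0 γ, fun α₁ α₂ => ?_⟩
    have h1 := ((hμ α₁ α₂).map (γ : V ≃ₗ[ℚ] V) (hN.preservesLattice he hf'0 γ)
      (hN.ratPointsEquiv he hf'0 γ) fun _ => rfl).zsmul (detSign (γ : V ≃ₗ[ℚ] V))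
    have h2 : formalSum p L f' (hillCocycle w (γ * α₁ : stabilizer p L f') (γ * α₂ :
        stabilizer p L f')) = detSign (γ : V ≃ₗ[ℚ] V) •
        fun v => formalSum p L f' (hillCocycle w α₁ α₂) ((γ : V ≃ₗ[ℚ] V).symm v) := by
      ext v
      have h3 := hillCocycle_equivariant (w := w) (γ : V ≃ₗ[ℚ] V) α₁ α₂
        ((γ : V ≃ₗ[ℚ] V).symm v)
      have h4 : globalTest p L f' _ = _ := γ.2 ((γ : V ≃ₗ[ℚ] V).symm v)
      rw [LinearEquiv.apply_symm_apply] at h3 h4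
      rw [Pi.smul_apply, formalSum, formalSum, Subgroup.coe_mul, Subgroup.coe_mul, h3, h4,
        smul_eq_mul, mul_assoc]
    rw [← h2] at h1
    rw [shintani, shintani, shintaniPseudoMeasure, represents_pseudoMeasure h1, hΦ]
    rfl
  · obtain ⟨k, hk⟩ := hillCocycle_relation (w := w) (α₀ : V ≃ₗ[ℚ] V) (α₁ : V ≃ₗ[ℚ] V)
      (α₂ : V ≃ₗ[ℚ] V)
    have h1 := ((hμ α₁ α₂).sub (hμ α₀ α₂)).add (hμ α₀ α₁)
    classical
    -- Hill's cocycle vanishes at the origin while the constant `k` need not, so the alternating sum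
    -- is `k f` corrected at `0`.
    let g : V → ℤ := fun v => if v = 0 then -(k * globalTest p L f' 0) else 0
    -- The vanishing of the averages makes `M c w₁` a period of `f`; being nonzero, it shows that `k
    -- f` represents `0`.
    have hu : M • (⟨c • w 0, hmem⟩ : ratPoints p L) ≠ 0 := fun h => by
      have h3 : M • c • w 0 = 0 := congrArg Subtype.val h
      rw [← Nat.cast_smul_eq_nsmul ℚ, smul_smul] at h3
      exact w.ne_zero 0 ((smul_eq_zero.mp h3).resolve_left
        (mul_ne_zero (Nat.cast_ne_zero.mpr hM0) hc.ne'))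
    have h2 : Represents (globalTest p L f') (0 : PseudoMeasure p L) :=
      represents_of_difference_eq_zero hu fun v => difference_eq_zero_of_average hsum' v
    have h3 := (h2.zsmul k).add
      (represents_of_support_subset (p := p) (L := L) (g := g) fun v hv => if_neg hv)
    have h4 : formalSum p L f' (hillCocycle w α₁ α₂) - formalSum p L f' (hillCocycle w α₀ α₂) +
        formalSum p L f' (hillCocycle w α₀ α₁) = k • globalTest p L f' + g := by
      ext v
      simp only [Pi.add_apply, Pi.sub_apply, Pi.smul_apply, formalSum, smul_eq_mul, g]
      by_cases hv : v = 0
      · simp [hv, hillCocycle_zero]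
      · rw [if_neg hv, ← hk v hv]
        ring
    rw [h4] at h1
    have h5 := h1.unique h3
    rw [← hΦ, ← hΦ, ← hΦ, zsmul_zero, zero_add] at h5
    exact (QuotientAddGroup.eq_zero_iff _).mpr
      (AddSubgroup.mem_zmultiples_iff.mpr ⟨g 0, h5.symm⟩)
  · rw [shintani, hΦ]
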